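/- Let $\mathbf k$ be a field; homology is singular homology with coefficients in $\mathbf k$, $\otimes=\otimes_{\mathbf k}$, and $H_*(Y)$ is a graded coalgebra with the coproduct $H_*(Y)\to H_*(Y\times Y)\cong H_*(Y)\otimes H_*(Y)$ induced by the diagonal. Let $K$ be a simplicial complex with vertex set contained in $[m]=\{1,\dots,m\}$, i.e. a (possibly void) family of subsets of $[m]$ closed under passing to subsets, and let $(X_1,A_1),\dots,(X_m,A_m)$ be pairs of topological spaces; put $M=\mathcal Z_K(X,A)=\bigcup_{\sigma\in K}\{x\in\prod_kX_k : x_k\in A_k\text{ for }k\notin\sigma\}$. Let $i_k\colon H_*(A_k)\to H_*(X_k)$ be induced by the inclusion and $\mathfrak k_k=\ker i_k$. Suppose that for every $k$ a graded subcoalgebra $\mathfrak i_k\subset H_*(A_k)$ is given with $H_*(A_k)=\mathfrak k_k\oplus\mathfrak i_k$ (so $\mathfrak i_k\cong\operatorname{coim} i_k$) such that $i_k$ restricts to an isomorphism of coalgebras from $\mathfrak i_k$ onto $\operatorname{im} i_k$. For every $k$ let $\mathfrak c_k\subset H_*(X_k)$ be any graded complement of $\operatorname{im}i_k$ (so $\mathfrak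 c_k\cong\operatorname{coker}i_k$); thus $H_*(X_k)\cong\mathfrak i_k\oplus\mathfrak c_k$, where $\operatorname{im}i_k$ is identified with $\mathfrak i_k$ through $i_k$. Let $I_M$ be the set of pairs $(\sigma,\omega)$ with $\sigma\in K$, $\sigma\subset\{k:\mathfrak c_k\ne0\}$, $\omega\subset\{k:\mathfrak k_k\ne0\}$ and $\sigma\cap\omega=\emptyset$, and put $$T_*(M)=\bigoplus_{(\sigma,\omega)\in I_M}\mathfrak a_1\otimes\cdots\otimes\mathfrak a_m,\qquad \mathfrak a_k=\mathfrak c_k\ (k\in\sigma),\quad \mathfrak a_k=\mathfrak k_k\ (k\in\omega),\quad \mathfrak a_k=\mathfrak i_k\ \text{otherwise}.$$ For homogeneous $x_k\in\mathfrak a_k$ let $\sum_j x'_{k,j}\otimes x''_{k,j}$ be the coproduct of $x_k$, taken in $H_*(X_k)$ if $k\in\sigma$ and in $H_*(A_k)$ otherwise, with every $x'_{k,j}$ and $x''_{k,j}$ homogeneous and in one of $\mathfrak k_k,\mathfrak i_k,\mathfrak c_k$ (using the above identifications). Define $$\Delta^T(x_1\otimes\cdots\otimes x_m)=\sum_{j_1,\dots,j_m}(-1)^{\varepsilon}\,(x'_{1,j_1}\otimes\cdots\otimes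 x'_{m,j_m})\otimes(x''_{1,j_1}\otimes\cdots\otimes x''_{m,j_m}),\qquad \varepsilon=\sum_{a<b}|x''_{a,j_a}|\,|x'_{b,j_b}|.$$ Dually, let $T^*(M)=\bigoplus_{(\sigma,\omega)\in I_M}\mathfrak a_1^*\otimes\cdots\otimes\mathfrak a_m^*$, where $\mathfrak a_k^*$ is the graded dual, regarded as a subspace of $\operatorname{Hom}_{\mathbf k}(T_*(M),\mathbf k)$, and let $\langle\varphi,\psi\rangle_T=(\varphi\otimes\psi)\circ\Delta^T$ be the product dual to $\Delta^T$. Theorem 3.9. The map $\Delta^T$ takes values in $T_*(M)\otimes T_*(M)$, and $(T_*(M),\Delta^T)$ is a graded, counital, coassociative coalgebra over $\mathbf k$ that is cocommutative in the graded sense. Dually, $T^*(M)$ is closed under $\langle\,,\rangle_T$, and $(T^*(M),\langle\,,\rangle_T)$ is a graded, unital, associative algebra over $\mathbf k$ that is commutative in the graded sense: $\langle\varphi,\psi\rangle_T=(-1)^{pq}\langle\psi,\varphi\rangle_T$ for $\varphi,\psi$ of degrees $p,q$. The same product also makes the full dual space $\operatorname{Hom}_{\mathbf k}(T_*(M),\mathbf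 k)$ a unital associative algebra, in which homogeneous functionals commute in the graded sense and degrees add. -/

import Mathlib

open CategoryTheory AlgebraicTopology Simplicial TensorProduct DirectSum

universe u

noncomputable section

namespace MomentAngle

/-! Singular homology over a field and its coproduct -/

section Coproduct

variable (k : Type u) [Field k] (X : SSet.{u})

/-- The simplicial chain complex of `X` with coefficients in `k`. For `X = TopCat.toSSet.obj Y` this
is the singular chain complex of the space `Y`. -/
abbrev chains : ChainComplex (ModuleCat.{u} k) ℕ := X.chainComplex (ModuleCat.of k k)

/-- `H_n(X; k)`. For `X = TopCat.toSSet.obj Y` this is the singular homology of the space `Y`. -/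
abbrev Hn (n : ℕ) : ModuleCat.{u} k := X.homology (ModuleCat.of k k) n

/-- On singular simplicial sets, `Hn` is the singular homology of the space. -/
theorem Hn_toSSet (Y : TopCat.{u}) (n : ℕ) : Hn k (TopCat.toSSet.obj Y) n =
  ((singularHomologyFunctor (ModuleCat.{u} k) n).obj (ModuleCat.of k k)).obj Y := rfl

/-- The map induced on `H_n(-; k)`. -/
abbrev Hmap {X Y : SSet.{u}} (f : X ⟶ Y) (n : ℕ) : Hn k X n →ₗ[k] Hn k Y n :=
  (SSet.homologyMap f (ModuleCat.of k k) n).hom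

/-- The total homology `H_*(X; k)`. -/
abbrev H : Type u := ⨁ n : ℕ, Hn k X n

variable {X} in
/-- The basis chain of a simplex. -/
def simplexChain {n : ℕ} (x : X _⦋n⦌) : (chains k X).X n :=
  (X.ιChainComplex (R := ModuleCat.of k k) x).hom (1 : k)

/-- Over a field the projection from cycles to homology extends to all chains. -/
theorem exists_chainClass (n : ℕ) :
    ∃ p : (chains k X).X n →ₗ[k] Hn k X n,
      ∀ z, p (((chains k X).iCycles n).hom z) = ((chains k X).homologyπ n).hom z := by
  have hinj : Function.Injective ((chains k X).iCycles n).hom :=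
    (ModuleCat.mono_iff_injective _).1 inferInstance
  obtain ⟨g, hg⟩ := LinearMap.exists_leftInverse_of_injective _ (LinearMap.ker_eq_bot.2 hinj)
  refine ⟨((chains k X).homologyπ n).hom ∘ₗ g, fun z ↦ ?_⟩
  exact congrArg ((chains k X).homologyπ n).hom (LinearMap.congr_fun hg z)

/-- A linear map from `n`-chains to `H_n` which sends every cycle to its homology class. It vanishes
on boundaries, so it is a chain map onto the homology (with zero differential) which induces the
identity in homology. By the Künneth theorem, the map from the homology of `C ⊗ C` to `H ⊗ H`
induced by the tensor square of this chain map is the inverse of the canonical isomorphism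
`H(C) ⊗ H(C) ≅ H(C ⊗ C)`; in particular it does not depend on the extension chosen. -/
def chainClass (n : ℕ) : (chains k X).X n →ₗ[k] Hn k X n :=
  (exists_chainClass k X n).choose

theorem chainClass_d (n : ℕ) (c : (chains k X).X (n + 1)) :
    chainClass k X n (((chains k X).d (n + 1) n).hom c) = 0 := by
  have e : (chains k X).d (n + 1) n =
      (chains k X).toCycles (n + 1) n ≫ (chains k X).iCycles n := by simp
  rw [e]
  refine ((exists_chainClass k X n).choose_spec _).trans ?_
  exact congrArg (fun f => f.hom c) ((chains k X).toCycles_comp_homologyπ (n + 1) n)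

variable {X} in
/-- The face of an `n`-simplex spanned by the vertices `a, a + 1, …, a + l`. -/
def segment {n : ℕ} (x : X _⦋n⦌) (a l : ℕ) (h : a + l ≤ n) : X _⦋l⦌ :=
  X.map (SimplexCategory.subinterval a l h).op x

variable {X} in
/-- The value of `chainClass` at that face. -/
def segmentClass {n : ℕ} (x : X _⦋n⦌) (a l : ℕ) (h : a + l ≤ n) : H k X :=
  lof k ℕ (fun n ↦ Hn k X n) l (chainClass k X l (simplexChain k (segment x a l h)))

variable {X} in
/-- The Alexander–Whitney diagonal `∑ i, [v_0, …, v_i] ⊗ [v_i, …, v_n]` of an `n`-simplex, followed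
by the projection `chainClass ⊗ chainClass` to `H ⊗ H`. -/
def simplexDiag {n : ℕ} (x : X _⦋n⦌) : H k X ⊗[k] H k X :=
  ∑ i : Fin (n + 1),
    segmentClass k x 0 i (by omega) ⊗ₜ[k] segmentClass k x i (n - i) (by omega)

/-- The linear extension of `simplexDiag` to chains. -/
def chainDiag (n : ℕ) :
    (chains k X).X n ⟶ ModuleCat.of k (H k X ⊗[k] H k X) :=
  Limits.Sigma.desc fun x : X _⦋n⦌ ↦
    ModuleCat.ofHom (LinearMap.toSpanSingleton k _ (simplexDiag k x))

variable {X} in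
theorem chainDiag_simplexChain {n : ℕ} (x : X _⦋n⦌) :
    (chainDiag k X n).hom (simplexChain k x) = simplexDiag k x := by
  have h : X.ιChainComplex x ≫ chainDiag k X n = 
    ModuleCat.ofHom (LinearMap.toSpanSingleton k _ (simplexDiag k x)) := 
    Limits.Sigma.ι_desc _ _
  refine (congrArg (fun f => f.hom (1 : k)) h).trans ?_
  simp

variable {X} in
theorem simplexChain_d {n : ℕ} (x : X _⦋n + 1⦌) :
    ((chains k X).d (n + 1) n).hom (simplexChain k x) =
      ∑ j : Fin (n + 2), (-1 : ℤ) ^ (j : ℕ) • simplexChain k (X.δ j x) := by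
  refine (congrArg (fun f => f.hom (1:k))
    (X.ιChainComplex_d (R := ModuleCat.of k k) x)).trans ?_
  simp [ModuleCat.hom_sum, simplexChain]

variable {X} in
theorem sum_chainClass_δ {n : ℕ} (x : X _⦋n + 1⦌) :
    ∑ j : Fin (n + 2), (-1 : ℤ) ^ (j : ℕ) • chainClass k X n (simplexChain k (X.δ j x)) = 0 := by
  rw [← chainClass_d k X n (simplexChain k x), simplexChain_d]
  simp only [map_sum, map_zsmul]

theorem subinterval_apply {n : ℕ} (a l : ℕ) (h : a + l ≤ n) (v : Fin (l + 1)) :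
    (SimplexCategory.subinterval a l h).toOrderHom v = (⟨v + a, by omega⟩ : Fin (n + 1)) := rfl

variable {X} in
theorem segment_δ_of_lt {n : ℕ} (x : X _⦋n + 1⦌) (j : Fin (n + 2)) (a l : ℕ) (h : a + l ≤ n)
    (hj : a + l < (j : ℕ)) : segment (X.δ j x) a l h = segment x a l (by omega) := by
  simp only [segment, SimplicialObject.δ]
  rw [← ConcreteCategory.comp_apply, ← X.map_comp, ← op_comp]
  congr 3
  apply Quiver.Hom.unop_inj
  ext v
  simp [subinterval_apply, SimplexCategory.δ, Fin.succAbove, Fin.lt_def]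
  split_ifs
  · simp
  · simp; omega

variable {X} in
theorem segment_δ_of_le {n : ℕ} (x : X _⦋n + 1⦌) (j : Fin (n + 2)) (a l : ℕ) (h : a + l ≤ n)
    (hj : (j : ℕ) ≤ a) : segment (X.δ j x) a l h = segment x (a + 1) l (by omega) := by
  simp only [segment, SimplicialObject.δ]
  rw [← ConcreteCategory.comp_apply, ← X.map_comp, ← op_comp]
  congr 3
  apply Quiver.Hom.unop_inj
  ext v
  simp [subinterval_apply, SimplexCategory.δ, Fin.succAbove, Fin.lt_def]
  split_ifs <;> simp <;> omega

variable {X} in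
theorem segment_δ {n : ℕ} (x : X _⦋n + 1⦌) (j : Fin (n + 2)) (a l : ℕ) (h : a + l ≤ n)
    (i : Fin (l + 2)) (hi : (j : ℕ) = a + i) :
    segment (X.δ j x) a l h = X.δ i (segment x a (l + 1) (by omega)) := by
  simp only [segment, SimplicialObject.δ]
  rw [← ConcreteCategory.comp_apply, ← ConcreteCategory.comp_apply, ← X.map_comp, ← X.map_comp,
    ← op_comp, ← op_comp]
  congr 3
  apply Quiver.Hom.unop_inj
  ext v
  simp [subinterval_apply, SimplexCategory.δ, Fin.succAbove, Fin.lt_def]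
  split_ifs <;> simp <;> omega

variable {X} in
theorem sum_segmentClass_δ {n : ℕ} (x : X _⦋n⦌) (a l : ℕ) (h : a + (l + 1) ≤ n) :
    ∑ j : Fin (l + 2), (-1 : ℤ) ^ (j : ℕ) • lof k ℕ (fun n ↦ Hn k X n) l
      (chainClass k X l (simplexChain k (X.δ j (segment x a (l + 1) h)))) = 0 := by
  have := congrArg (lof k ℕ (fun n ↦ Hn k X n) l) (sum_chainClass_δ k (segment x a (l + 1) h))
  simpa only [map_sum, map_zsmul, map_zero] using this

theorem sum_fin_split {M : Type*} [AddCommMonoid M] (n i l : ℕ) (h : i + l = n)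
    (f : Fin (n + 2) → M) :
    ∑ j, f j = ∑ a : Fin (i + 1), f ⟨a, by omega⟩ + ∑ b : Fin (l + 1), f ⟨i + 1 + b, by omega⟩ := by
  have e : (i + 1) + (l + 1) = n + 2 := by omega
  rw [← (finCongr e).sum_comp, Fin.sum_univ_add]
  rfl

variable {X} in
theorem sum_simplexDiag_δ {n : ℕ} (x : X _⦋n + 1⦌) :
    ∑ j : Fin (n + 2), (-1 : ℤ) ^ (j : ℕ) • simplexDiag k (X.δ j x) = 0 := by
  simp only [simplexDiag, Finset.smul_sum]
  rw [Finset.sum_comm]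
  refine Finset.sum_eq_zero fun i _ ↦ ?_
  obtain ⟨i, hi⟩ := i
  obtain ⟨l, hl⟩ : ∃ l, l = n - i := ⟨_, rfl⟩
  simp only [← hl]
  rw [sum_fin_split n i l (by omega)]
  have h1 : ∀ a : Fin (i + 1),
      (-1 : ℤ) ^ (a : ℕ) • segmentClass k (X.δ (⟨a, by omega⟩ : Fin (n + 2)) x) 0 i (by omega) ⊗ₜ[k]
        segmentClass k (X.δ (⟨a, by omega⟩ : Fin (n + 2)) x) i l (by omega) =
      ((-1 : ℤ) ^ (a : ℕ) • lof k ℕ (fun n ↦ Hn k X n) i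
      (chainClass k X i (simplexChain k (X.δ a.castSucc (segment x 0 (i + 1) (by omega)))))) ⊗ₜ[k]
        segmentClass k x (i + 1) l (by omega) := by
    intro a
    rw [segmentClass, segmentClass, segment_δ x _ 0 i (by omega) a.castSucc (by simp),
      segment_δ_of_le x _ i l (by omega) (by simp; omega), TensorProduct.smul_tmul']
    rfl
  have h2 : ∀ b : Fin (l + 1),
      (-1 : ℤ) ^ (i + 1 + b : ℕ) •
        segmentClass k (X.δ (⟨i + 1 + b, by omega⟩ : Fin (n + 2)) x) 0 i (by omega) ⊗ₜ[k]
        segmentClass k (X.δ (⟨i + 1 + b, by omega⟩ : Fin (n + 2)) x) i l (by omega) =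
      segmentClass k x 0 i (by omega) ⊗ₜ[k] ((-1 : ℤ) ^ (i : ℕ) • 
      ((-1 : ℤ) ^ (b.succ : ℕ) • lof k ℕ (fun n ↦ Hn k X n) l
      (chainClass k X l (simplexChain k (X.δ b.succ (segment x i (l + 1) (by omega))))))) := by
    intro b
    rw [segmentClass, segmentClass, segment_δ x _ i l (by omega) b.succ (by simp; omega),
      segment_δ_of_lt x _ 0 i (by omega) (by simp; omega), TensorProduct.tmul_smul,
      TensorProduct.tmul_smul, smul_smul, ← pow_add]
    congr 2
    simp; omega
  rw [Finset.sum_congr rfl fun a _ ↦ h1 a, Finset.sum_congr rfl fun b _ ↦ h2 b,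
    ← TensorProduct.sum_tmul, ← TensorProduct.tmul_sum, ← Finset.smul_sum]
  have e1 := sum_segmentClass_δ k x 0 i (by omega)
  have e2 := sum_segmentClass_δ k x i l (by omega)
  rw [Fin.sum_univ_castSucc] at e1
  rw [Fin.sum_univ_succ] at e2
  have e1' := eq_neg_of_add_eq_zero_left e1
  have e2' := eq_neg_of_add_eq_zero_right e2
  have f1 : X.δ (Fin.last (i + 1)) (segment x 0 (i + 1) (by omega)) = segment x 0 i (by omega) := by
    rw [← segment_δ x ⟨i + 1, by omega⟩ 0 i (by omega) _ (by simp),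
      segment_δ_of_lt x _ 0 i (by omega) (by simp)]
  have f2 : X.δ 0 (segment x i (l + 1) (by omega)) = segment x (i + 1) l (by omega) := by
    rw [← segment_δ x ⟨i, by omega⟩ i l (by omega) _ (by simp),
      segment_δ_of_le x _ i l (by omega) (by simp)]
  rw [f1] at e1'
  rw [f2] at e2'
  rw [e2']
  simp only [Fin.val_castSucc] at e1'
  rw [e1']
  simp [segmentClass, pow_succ, TensorProduct.tmul_neg, TensorProduct.tmul_smul,
    TensorProduct.smul_tmul']

theorem d_comp_chainDiag (n : ℕ) :
    (chains k X).d (n + 1) n ≫ chainDiag k X n = 0 := by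
  refine SSet.chainComplex_hom_ext fun x ↦ ?_
  ext
  change (chainDiag k X n).hom (((chains k X).d (n + 1) n).hom (simplexChain k x)) = 0
  rw [simplexChain_d, ← sum_simplexDiag_δ k x]
  simp only [map_sum, map_zsmul]
  exact Finset.sum_congr rfl fun j _ ↦ congrArg _ (chainDiag_simplexChain k _)

/-- The homology coproduct on `H_n`: apply the Alexander–Whitney diagonal to a representing cycle. -/
def comulN (n : ℕ) : Hn k X n →ₗ[k] H k X ⊗[k] H k X :=
  ((chains k X).homologyι n ≫ 
  (chains k X).descOpcycles (chainDiag k X n) (n+1) (by simp) (d_comp_chainDiag k X n)).hom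

/-- The coproduct `H_*(X) → H_*(X × X) ≅ H_*(X) ⊗ H_*(X)` of the homology coalgebra of `X`. -/
def comul : H k X →ₗ[k] H k X ⊗[k] H k X :=
  toModule k ℕ _ fun n ↦ comulN k X n

end Coproduct
/-! Graded splittings of a map of graded vector spaces -/

section Splitting

variable {k : Type u} [Field k] {V W : ℕ → Type u}
  [∀ n, AddCommGroup (V n)] [∀ n, Module k (V n)] [∀ n, AddCommGroup (W n)] [∀ n, Module k (W n)]

/-- A splitting of a map `f : V → W` of graded vector spaces: graded complements `im` of the kernel in
`V` and `coker` of the image in `W`. Thus `V = 𝔨 ⊕ 𝔦` and `W = f(𝔦) ⊕ 𝔠`, where `𝔨` is the kernel, `𝔦` is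
a copy in `V` of the (co)image, and `𝔠` is a copy in `W` of the cokernel. -/
structure Splitting (f : ∀ n, V n →ₗ[k] W n) where
  im (n : ℕ) : Submodule k (V n)
  coker (n : ℕ) : Submodule k (W n)
  isCompl_im (n : ℕ) : IsCompl (LinearMap.ker (f n)) (im n)
  isCompl_coker (n : ℕ) : IsCompl (LinearMap.range (f n)) (coker n)

/-- Labels for the three summands of `𝔨 ⊕ 𝔦 ⊕ 𝔠`. -/
inductive Label where
  | ker | im | coker
  deriving DecidableEq

namespace Splitting

variable {f : ∀ n, V n →ₗ[k] W n} (S : Splitting f)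

/-- The degree `p.2` part of the summand `𝔨`, `𝔦` or `𝔠` named by the label `p.1`. Both `𝔨` and `𝔦` are
subspaces of `V`, and `𝔠` is a subspace of `W`; to have a uniform type they are placed in `V × W`. -/
def part (p : Label × ℕ) : Submodule k (V p.2 × W p.2) :=
  match p.1 with
  | .ker => (LinearMap.ker (f p.2)).prod ⊥
  | .im => (S.im p.2).prod ⊥
  | .coker => (⊥ : Submodule k (V p.2)).prod (S.coker p.2)

/-- The graded vector space `𝔨 ⊕ 𝔦 ⊕ 𝔠`. -/
abbrev Total : Type u := ⨁ p : Label × ℕ, S.part p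

/-- The inclusion of `𝔨` in `𝔨 ⊕ 𝔦 ⊕ 𝔠`. -/
def inclKer (n : ℕ) : LinearMap.ker (f n) →ₗ[k] S.Total :=
  lof k (Label × ℕ) (fun p ↦ S.part p) (.ker, n) ∘ₗ
    LinearMap.codRestrict (S.part (.ker, n)) (LinearMap.inl k _ _ ∘ₗ Submodule.subtype _)
      fun x ↦ ⟨x.2, rfl⟩

/-- The inclusion of `𝔦` in `𝔨 ⊕ 𝔦 ⊕ 𝔠`. -/
def inclIm (n : ℕ) : S.im n →ₗ[k] S.Total :=
  lof k (Label × ℕ) (fun p ↦ S.part p) (.im, n) ∘ₗ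
    LinearMap.codRestrict (S.part (.im, n)) (LinearMap.inl k _ _ ∘ₗ Submodule.subtype _)
      fun x ↦ ⟨x.2, rfl⟩

/-- The inclusion of `𝔠` in `𝔨 ⊕ 𝔦 ⊕ 𝔠`. -/
def inclCoker (n : ℕ) : S.coker n →ₗ[k] S.Total :=
  lof k (Label × ℕ) (fun p ↦ S.part p) (.coker, n) ∘ₗ
    LinearMap.codRestrict (S.part (.coker, n)) (LinearMap.inr k _ _ ∘ₗ Submodule.subtype _)
      fun x ↦ ⟨rfl, x.2⟩

/-- The identification of `V` with `𝔨 ⊕ 𝔦`. -/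
def ofSource : (⨁ n, V n) →ₗ[k] S.Total :=
  toModule k ℕ _ fun n ↦
    S.inclKer n ∘ₗ Submodule.projectionOnto _ _ (S.isCompl_im n) +
    S.inclIm n ∘ₗ Submodule.projectionOnto _ _ (S.isCompl_im n).symm

/-- The identification of `W = f(𝔦) ⊕ 𝔠` with `𝔦 ⊕ 𝔠`: the image of `f` is identified with `𝔦` through the
isomorphism `𝔦 ≅ im f` given by `f`. -/
def ofTarget : (⨁ n, W n) →ₗ[k] S.Total :=
  toModule k ℕ _ fun n ↦
    S.inclIm n ∘ₗ ((f n).kerComplementEquivRange (S.isCompl_im n).symm).symm.toLinearMap ∘ₗ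
      Submodule.projectionOnto _ _ (S.isCompl_coker n) +
    S.inclCoker n ∘ₗ Submodule.projectionOnto _ _ (S.isCompl_coker n).symm

variable (δV : (⨁ n, V n) →ₗ[k] (⨁ n, V n) ⊗[k] (⨁ n, V n))
  (δW : (⨁ n, W n) →ₗ[k] (⨁ n, W n) ⊗[k] (⨁ n, W n))

/-- The coproduct of `𝔨 ⊕ 𝔦 ⊕ 𝔠`: on `𝔨` and `𝔦` it is the coproduct of `V`, on `𝔠` it is the coproduct
of `W`. (The elements of `𝔨` and `𝔦` have second component zero, those of `𝔠` first component zero.) -/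
def comul : S.Total →ₗ[k] S.Total ⊗[k] S.Total :=
  toModule k _ _ fun p ↦
    (TensorProduct.map S.ofSource S.ofSource ∘ₗ δV ∘ₗ lof k ℕ V p.2 ∘ₗ LinearMap.fst k _ _ +
      TensorProduct.map S.ofTarget S.ofTarget ∘ₗ δW ∘ₗ lof k ℕ W p.2 ∘ₗ LinearMap.snd k _ _) ∘ₗ
    (S.part p).subtype

/-- The subspace `𝔦` of the total space of `V`. -/
def imTotal : Submodule k (⨁ n, V n) := ⨆ n, (S.im n).map (lof k ℕ V n)

/-- `𝔦` is a subcoalgebra of `V`, and the restriction of `f` to `𝔦`, which is a linear isomorphism onto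
the image of `f`, is compatible with the coproducts. -/
structure IsCoalgebraSplitting : Prop where
  subcoalgebra : ∀ x ∈ S.imTotal,
    δV x ∈ LinearMap.range (TensorProduct.map S.imTotal.subtype S.imTotal.subtype)
  map_comul : ∀ x ∈ S.imTotal,
    TensorProduct.map (DirectSum.lmap f) (DirectSum.lmap f) (δV x) = δW (DirectSum.lmap f x)

end Splitting

end Splitting

section Interleave

variable {k : Type u} [Field k] {m : ℕ} {M N : Fin m → Type u}
  [∀ j, AddCommGroup (M j)] [∀ j, Module k (M j)] [∀ j, AddCommGroup (N j)] [∀ j, Module k (N j)]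

variable (k M N) in
/-- `(⊗ x_j) ⊗ (⊗ y_j) ↦ ⊗ (x_j ⊗ y_j)` -/
def interleaveHom : (⨂[k] j, M j) ⊗[k] (⨂[k] j, N j) →ₗ[k] ⨂[k] j, M j ⊗[k] N j :=
  TensorProduct.lift (PiTensorProduct.map₂ fun j ↦ TensorProduct.mk k (M j) (N j))

variable (k M N) in
theorem interleaveHom_bijective : Function.Bijective (interleaveHom k M N) := by
  let b := fun j ↦ Module.Basis.ofVectorSpace k (M j)
  let c := fun j ↦ Module.Basis.ofVectorSpace k (N j)
  let B := (Basis.piTensorProduct b).tensorProduct (Basis.piTensorProduct c)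
  let C := Basis.piTensorProduct fun j ↦ (b j).tensorProduct (c j)
  have h : interleaveHom k M N =
      (B.equiv C (Equiv.arrowProdEquivProdArrow _ _ _).symm).toLinearMap := by
    refine B.ext fun p ↦ ?_
    obtain ⟨p, q⟩ := p
    rw [LinearEquiv.coe_coe, Module.Basis.equiv_apply]
    simp only [B, C, interleaveHom, Module.Basis.tensorProduct_apply, TensorProduct.lift.tmul,
      Basis.piTensorProduct_apply, PiTensorProduct.map₂_tprod_tprod, TensorProduct.mk_apply]
    exact congrArg _ (funext fun j ↦ ((b j).tensorProduct_apply (c j) _ _).symm)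
  rw [h]
  exact LinearEquiv.bijective _

variable (k M N) in
/-- The (unsigned) isomorphism `(⊗ M_j) ⊗ (⊗ N_j) ≅ ⊗ (M_j ⊗ N_j)`. -/
def interleave : (⨂[k] j, M j) ⊗[k] (⨂[k] j, N j) ≃ₗ[k] ⨂[k] j, M j ⊗[k] N j :=
  LinearEquiv.ofBijective (interleaveHom k M N) (interleaveHom_bijective k M N)

end Interleave

/-- The product on functionals dual to `Δ`: `(φ ψ)(x) = (φ ⊗ ψ)(Δ x)`. -/
def convolution {k : Type u} [Field k] {M : Type u} [AddCommMonoid M] [Module k M]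
    (Δ : M →ₗ[k] M ⊗[k] M) :
    Module.Dual k M →ₗ[k] Module.Dual k M →ₗ[k] Module.Dual k M :=
  (TensorProduct.mk k _ _).compr₂ (Module.Dual.transpose Δ ∘ₗ TensorProduct.dualDistrib k M M)

theorem convolution_apply {k : Type u} [Field k] {M : Type u} [AddCommMonoid M] [Module k M]
    (Δ : M →ₗ[k] M ⊗[k] M) (φ ψ : Module.Dual k M) (x : M) :
    convolution Δ φ ψ x = TensorProduct.dualDistrib k M M (φ ⊗ₜ[k] ψ) (Δ x) := rfl

section Graded

variable {k : Type u} [Field k] {ι : Type} [DecidableEq ι] {V : ι → Type u}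
  [∀ s, AddCommMonoid (V s)] [∀ s, Module k (V s)] (deg : ι → ℕ)

variable (k V) in
/-- The homogeneous part of degree `n` of `⨁ s, V s`, where `V s` is placed in degree `deg s`. -/
def homogeneous (n : ℕ) : Submodule k (⨁ s, V s) :=
  ⨆ (s : ι) (_ : deg s = n), LinearMap.range (lof k ι V s)

variable (k V) in
/-- The graded twist `x ⊗ y ↦ (-1) ^ (|x| |y|) y ⊗ x`. -/
def koszulSwap : (⨁ s, V s) ⊗[k] (⨁ s, V s) →ₗ[k] (⨁ s, V s) ⊗[k] (⨁ s, V s) :=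
  toModule k (ι × ι) _ (fun p ↦ ((-1 : k) ^ (deg p.1 * deg p.2)) •
      TensorProduct.map (lof k ι V p.2) (lof k ι V p.1) ∘ₗ
        (TensorProduct.comm k (V p.1) (V p.2)).toLinearMap) ∘ₗ
    (TensorProduct.directSum k k V V).toLinearMap

/-- `Δ` makes `⨁ s, V s` a graded coalgebra which is coassociative, counital, and cocommutative in the
graded sense. -/
structure IsGradedCocommutativeCoalgebra
    (Δ : (⨁ s, V s) →ₗ[k] (⨁ s, V s) ⊗[k] (⨁ s, V s)) : Prop where
  graded : ∀ n, ∀ x ∈ homogeneous k V deg n, Δ x ∈ ⨆ p ∈ Finset.HasAntidiagonal.antidiagonal n,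
    LinearMap.range (TensorProduct.map (homogeneous k V deg p.1).subtype
      (homogeneous k V deg p.2).subtype)
  coassoc : (TensorProduct.assoc k _ _ _).toLinearMap ∘ₗ Δ.rTensor _ ∘ₗ Δ = Δ.lTensor _ ∘ₗ Δ
  counit : ∃ ε : (⨁ s, V s) →ₗ[k] k,
    (∀ n ≠ 0, ∀ x ∈ homogeneous k V deg n, ε x = 0) ∧
    (∀ x, ε.rTensor _ (Δ x) = 1 ⊗ₜ[k] x) ∧ ∀ x, ε.lTensor _ (Δ x) = x ⊗ₜ[k] 1
  cocomm : koszulSwap k V deg ∘ₗ Δ = Δ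

variable (k V) in
/-- The functionals of degree `n`: those that vanish in all degrees other than `n`. -/
def dualHomogeneous (n : ℕ) : Submodule k (Module.Dual k (⨁ s, V s)) :=
  ⨅ (p : ℕ) (_ : p ≠ n), (homogeneous k V deg p).dualAnnihilator

/-- The subspace `A` of functionals is closed under the product, and is with it an associative unital
graded algebra over `k`, commutative in the graded sense. -/
structure IsGradedCommutativeAlgebra (A : Submodule k (Module.Dual k (⨁ s, V s)))
    (mul : Module.Dual k (⨁ s, V s) →ₗ[k]
      Module.Dual k (⨁ s, V s) →ₗ[k] Module.Dual k (⨁ s, V s)) : Prop where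
  mul_mem : ∀ φ ∈ A, ∀ ψ ∈ A, mul φ ψ ∈ A
  graded : ∀ p q, ∀ φ ∈ A ⊓ dualHomogeneous k V deg p, ∀ ψ ∈ A ⊓ dualHomogeneous k V deg q,
    mul φ ψ ∈ dualHomogeneous k V deg (p + q)
  assoc : ∀ φ ∈ A, ∀ ψ ∈ A, ∀ χ ∈ A, mul (mul φ ψ) χ = mul φ (mul ψ χ)
  unit : ∃ e ∈ A ⊓ dualHomogeneous k V deg 0, ∀ φ ∈ A, mul e φ = φ ∧ mul φ e = φ
  comm : ∀ p q, ∀ φ ∈ A ⊓ dualHomogeneous k V deg p, ∀ ψ ∈ A ⊓ dualHomogeneous k V deg q,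
    mul φ ψ = (-1 : k) ^ (p * q) • mul ψ φ

end Graded

section Tensor

variable {k : Type u} [Field k] {m : ℕ} {V W : Fin m → ℕ → Type u}
  [∀ j n, AddCommGroup (V j n)] [∀ j n, Module k (V j n)]
  [∀ j n, AddCommGroup (W j n)] [∀ j n, Module k (W j n)]
  {f : ∀ j n, V j n →ₗ[k] W j n}

/-- A choice of a label and of a degree for each `j`. -/
abbrev MultiIndex (m : ℕ) : Type := Fin m → Label × ℕ

/-- The total degree. -/
def MultiIndex.degree {m : ℕ} (s : MultiIndex m) : ℕ := ∑ j, (s j).2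

/-- The set `σ` of the `j` with label `𝔠`. -/
def MultiIndex.sigma (s : MultiIndex m) : Finset (Fin m) := {j | (s j).1 = Label.coker}

/-- The set `ω` of the `j` with label `𝔨`. -/
def MultiIndex.omega (s : MultiIndex m) : Finset (Fin m) := {j | (s j).1 = Label.ker}

/-- The set of all pairs `(σ, ω)` with `σ ∈ K`, `σ ⊆ {j | coker f_j ≠ 0}`, `ω ⊆ {j | ker f_j ≠ 0}` and
`σ ∩ ω = ∅`. The simplicial complex `K` is a downward closed set of finite sets; it may be void, may
consist of the empty simplex alone, and need not have every `j` as a vertex. -/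
def indexSet (f : ∀ j n, V j n →ₗ[k] W j n) (K : LowerSet (Finset (Fin m))) :
    Set (Finset (Fin m) × Finset (Fin m)) :=
  {p | p.1 ∈ K ∧ (∀ j ∈ p.1, ∃ n, LinearMap.range (f j n) ≠ ⊤) ∧
    (∀ j ∈ p.2, ∃ n, LinearMap.ker (f j n) ≠ ⊥) ∧ Disjoint p.1 p.2}

/-- The labelings and degrees for which `(σ, ω)` is in the index set. -/
abbrev AdmissibleIndex (f : ∀ j n, V j n →ₗ[k] W j n) (K : LowerSet (Finset (Fin m))) : Type :=
  {s : MultiIndex m // (s.sigma, s.omega) ∈ indexSet f K}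

/-- The total degree. -/
def AdmissibleIndex.degree {K : LowerSet (Finset (Fin m))} (s : AdmissibleIndex f K) : ℕ :=
  s.1.degree

variable (S : ∀ j, Splitting (f j)) (K : LowerSet (Finset (Fin m)))

/-- The tensor product of the graded pieces selected by `s`. -/
abbrev Piece (s : MultiIndex m) : Type u := ⨂[k] j, (S j).part (s j)

/-- The tensor product over all `j` of the spaces `𝔨_j ⊕ 𝔦_j ⊕ 𝔠_j`, as the direct sum of its
multihomogeneous pieces. -/
abbrev TotalTensor : Type u := ⨁ s : MultiIndex m, Piece S s

/-- `T_* = ⨁ T_*^{σ, ω}` over the pairs `(σ, ω)` in the index set, where `T_*^{σ, ω} = 𝔞_1 ⊗ ⋯ ⊗ 𝔞_m` with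
`𝔞_j = 𝔠_j` for `j ∈ σ`, `𝔞_j = 𝔨_j` for `j ∈ ω` and `𝔞_j = 𝔦_j` otherwise. Each `T_*^{σ, ω}` is written as
the direct sum of its multihomogeneous pieces. -/
abbrev T : Type u := ⨁ s : AdmissibleIndex f K, Piece S s.1

/-- The inclusion of `T_*` in the full tensor product. -/
def T.incl : T S K →ₗ[k] TotalTensor S :=
  toModule k _ _ fun s ↦ lof k (MultiIndex m) (fun s ↦ Piece S s) s.1

open Classical in
/-- The projection of the full tensor product to `T_*` which kills the other multihomogeneous
pieces. -/
def T.proj : TotalTensor S →ₗ[k] T S K :=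
  toModule k _ _ fun s ↦
    if h : (s.sigma, s.omega) ∈ indexSet f K then
      lof k (AdmissibleIndex f K) (fun s ↦ Piece S s.1) ⟨s, h⟩ else 0

/-- The sign `(-1) ^ ε` with `ε = ∑_{i < j} |x''_i| |x'_j|`, for `x'` and `x''` of multidegrees `s`, `t`. -/
def koszulSign (s t : MultiIndex m) : k :=
  (-1) ^ ∑ i, ∑ j with i < j, (t i).2 * (s j).2

/-- The map `⊗ (x'_j ⊗ x''_j) ↦ (-1) ^ ε (⊗ x'_j) ⊗ (⊗ x''_j)`. -/
def koszulShuffle :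
    (⨂[k] j, (S j).Total ⊗[k] (S j).Total) →ₗ[k] TotalTensor S ⊗[k] TotalTensor S :=
  toModule k (Fin m → (Label × ℕ) × (Label × ℕ)) _ (fun p ↦
      (koszulSign (fun j ↦ (p j).1) (fun j ↦ (p j).2) : k) •
      TensorProduct.map
        (lof k (MultiIndex m) (fun s ↦ Piece S s) fun j ↦ (p j).1)
        (lof k (MultiIndex m) (fun s ↦ Piece S s) fun j ↦ (p j).2) ∘ₗ
      (interleave k (fun j ↦ (S j).part (p j).1) (fun j ↦ (S j).part (p j).2)).symm.toLinearMap) ∘ₗ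
  (PiTensorProduct.ofDirectSumEquiv (R := k)
    (M := fun j (p : (Label × ℕ) × (Label × ℕ)) ↦ (S j).part p.1 ⊗[k] (S j).part p.2)).toLinearMap ∘ₗ
  PiTensorProduct.map fun j ↦ (TensorProduct.directSum k k
    (fun p ↦ (S j).part p) (fun p ↦ (S j).part p)).toLinearMap

theorem koszulShuffle_tprod (s t : MultiIndex m) (x : ∀ j, (S j).part (s j))
    (y : ∀ j, (S j).part (t j)) :
    koszulShuffle S (PiTensorProduct.tprod k fun j ↦
      lof k _ (fun p ↦ (S j).part p) (s j) (x j) ⊗ₜ[k] lof k _ (fun p ↦ (S j).part p) (t j) (y j)) =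
    (koszulSign s t : k) •
      (lof k _ (fun s ↦ Piece S s) s (PiTensorProduct.tprod k x) ⊗ₜ[k]
        lof k _ (fun s ↦ Piece S s) t (PiTensorProduct.tprod k y)) := by
  have h : PiTensorProduct.tprod k (fun j ↦ x j ⊗ₜ[k] y j) =
      interleave k (fun j ↦ (S j).part (s j)) (fun j ↦ (S j).part (t j))
        (PiTensorProduct.tprod k x ⊗ₜ[k] PiTensorProduct.tprod k y) := by
    exact (PiTensorProduct.map₂_tprod_tprod
      (fun j ↦ TensorProduct.mk k ((S j).part (s j)) ((S j).part (t j))) x y).symm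
  simp only [koszulShuffle, LinearMap.comp_apply, PiTensorProduct.map_tprod,
    LinearEquiv.coe_coe, TensorProduct.directSum_lof_tmul_lof]
  refine (congrArg _ (PiTensorProduct.ofDirectSumEquiv_tprod_lof (R := k)
    (M := fun j (p : (Label × ℕ) × (Label × ℕ)) ↦ (S j).part p.1 ⊗[k] (S j).part p.2)
    (fun j ↦ (s j, t j)) (fun j ↦ x j ⊗ₜ[k] y j))).trans ?_
  rw [toModule_lof]
  simp only [LinearMap.smul_apply, LinearMap.comp_apply, LinearEquiv.coe_coe]
  rw [h, LinearEquiv.symm_apply_apply, TensorProduct.map_tmul]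

variable (δV : ∀ j, (⨁ n, V j n) →ₗ[k] (⨁ n, V j n) ⊗[k] (⨁ n, V j n))
  (δW : ∀ j, (⨁ n, W j n) →ₗ[k] (⨁ n, W j n) ⊗[k] (⨁ n, W j n))

/-- The graded tensor product of the coproducts of the spaces `𝔨_j ⊕ 𝔦_j ⊕ 𝔠_j`. -/
def TotalTensor.comul : TotalTensor S →ₗ[k] TotalTensor S ⊗[k] TotalTensor S :=
  toModule k _ _ fun s ↦ koszulShuffle S ∘ₗ PiTensorProduct.map fun j ↦
    (S j).comul (δV j) (δW j) ∘ₗ lof k _ (fun p ↦ (S j).part p) (s j)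

/-- The coproduct `Δ^T` of `T_*`. The coproduct of an element of `T_*`, formed in the full tensor product,
has no component outside `T_* ⊗ T_*`, so the projection serves only to restrict the codomain. -/
def T.comul : T S K →ₗ[k] T S K ⊗[k] T S K :=
  TensorProduct.map (T.proj S K) (T.proj S K) ∘ₗ TotalTensor.comul S δV δW ∘ₗ T.incl S K

/-- `T^* = ⨁ T^*_{σ, ω}`, where `T^*_{σ, ω}` is the tensor product of the graded duals of the factors of
`T_*^{σ, ω}`. It is realized in the dual space of `T_*`: it is spanned by the functionals
`⊗ χ_j` on the multihomogeneous pieces. -/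
def T.dual : Submodule k (Module.Dual k (T S K)) :=
  Submodule.span k {φ | ∃ (s : AdmissibleIndex f K) (χ : ∀ j, Module.Dual k ((S j).part (s.1 j))),
    φ = PiTensorProduct.dualDistrib (PiTensorProduct.tprod k χ) ∘ₗ
      component k _ (fun s : AdmissibleIndex f K ↦ Piece S s.1) s}

end Tensor
section Pairs

variable (k : Type u) [Field k] {m : ℕ} (X : Fin m → TopCat.{u}) (A : ∀ j, Set (X j))

/-- The singular simplicial set of the `j`-th space. -/
abbrev ambient (j : Fin m) : SSet.{u} := TopCat.toSSet.obj (X j)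

/-- The singular simplicial set of the `j`-th subspace, with the subspace topology. -/
abbrev sub (j : Fin m) : SSet.{u} := TopCat.toSSet.obj (TopCat.of (A j))

/-- The inclusion of the `j`-th subspace, on singular simplicial sets. -/
def inclusion (j : Fin m) : sub X A j ⟶ ambient X j :=
  TopCat.toSSet.map (TopCat.ofHom ⟨Subtype.val, continuous_subtype_val⟩)

/-- The maps `i_j : H_n(A_j) → H_n(X_j)` induced by the inclusions. -/
abbrev inducedMap (j : Fin m) (n : ℕ) :
    Hn k (sub X A j) n →ₗ[k] Hn k (ambient X j) n :=
  Hmap k (inclusion X A j) n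

variable {k X A} (S : ∀ j, Splitting (inducedMap k X A j)) (K : LowerSet (Finset (Fin m)))

/-- The full tensor product of the spaces `𝔨_j ⊕ 𝔦_j ⊕ 𝔠_j` with the coproduct built from the homology
coalgebras of the `A_j` and `X_j`. -/
def totalComul : TotalTensor S →ₗ[k] TotalTensor S ⊗[k] TotalTensor S :=
  TotalTensor.comul S (fun j ↦ comul k (sub X A j)) (fun j ↦ comul k (ambient X j))

/-- The coproduct `Δ^T` of `T_*` built from the homology coalgebras of the `A_j` and `X_j`. -/
def deltaT : T S K →ₗ[k] T S K ⊗[k] T S K :=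
  T.comul S K (fun j ↦ comul k (sub X A j)) (fun j ↦ comul k (ambient X j))

end Pairs

end MomentAngle

end

noncomputable section

namespace MomentAngle

/-! ### Duality: coalgebra axioms from products of functionals. -/

section GradedDual

variable {k : Type u} [Field k]

/-! The coalgebra axioms are checked through functionals. The coordinates of a homogeneous basis
separate the points of all tensor powers (`dualDistrib_coord`), so grading, coassociativity, counit
and cocommutativity of a coproduct follow once the corresponding laws hold for products of
coordinate functionals. `IsDualAlgebra` records these laws for sets of functionals, and
`IsDualAlgebra.isGradedCocommutativeCoalgebra` turns them back into coalgebra axioms.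

For a space, the product of two homogeneous functionals on homology is represented by the cup
product of cocycles (`convolution_cycleClass`), which is associative and unital already on cochains.
Graded commutativity comes from reversing the vertex order of singular simplices: with the sign
`revSign` the reversal exchanges the two cup factors up to `(-1) ^ (p * q)` (`reverseCochain_cup`),
and it is homotopic to the identity by a cone construction on words of vertices
(`bdry_revHomotopy`).

For one pair, `𝔨 ⊕ 𝔦 ⊕ 𝔠` is covered by the images of `H_*(A)` and `H_*(X)`, which meet in `𝔦`. The
hypothesis on `𝔦` makes both maps compatible with the coproducts, so an identity of functionals may
be checked on the two homologies separately (`IsCoalgebraSplitting.isDualAlgebra`). On the full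
tensor product, tensor products of homogeneous functionals multiply factor by factor up to a Koszul
sign (`convolution_box`), and all laws are inherited from the factors.

Finally `𝔨 ⊕ 𝔦` and `𝔦 ⊕ 𝔠` are subcoalgebras, so a label `𝔠` in a term of a coproduct arises only
from `𝔠`, and a label `𝔨` only from `𝔨`. Passing to a tensor factor of a term thus shrinks both `σ`
and `ω`; since `K` is closed under subsets, `T_*` is a subcoalgebra (`map_incl_comp_comul`) and the
laws restrict to it. The two dual algebras then follow by transposing the coalgebra axioms. -/

/-- Restriction along a coalgebra map is multiplicative. This one fact transports every law, along
`ofSource`, `ofTarget` and `T.incl`. -/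
theorem convolution_comp {M N : Type u} [AddCommMonoid M] [Module k M] [AddCommMonoid N]
    [Module k N] {ΔM : M →ₗ[k] M ⊗[k] M} {ΔN : N →ₗ[k] N ⊗[k] N} {g : M →ₗ[k] N}
    (hg : ΔN ∘ₗ g = TensorProduct.map g g ∘ₗ ΔM) (φ ψ : Module.Dual k N) :
    convolution ΔN φ ψ ∘ₗ g = convolution ΔM (φ ∘ₗ g) (ψ ∘ₗ g) := by
  have h : TensorProduct.dualDistrib k N N (φ ⊗ₜ ψ) ∘ₗ TensorProduct.map g g =
      TensorProduct.dualDistrib k M M ((φ ∘ₗ g) ⊗ₜ (ψ ∘ₗ g)) :=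
    TensorProduct.ext' fun x y ↦ by simp
  change (TensorProduct.dualDistrib k N N (φ ⊗ₜ ψ) ∘ₗ ΔN) ∘ₗ g = _
  rw [LinearMap.comp_assoc, hg, ← LinearMap.comp_assoc, h]
  rfl

/-- Both bracketings of a triple product evaluate the same functional `φ ⊗ (ψ ⊗ χ)` on one of the
two iterated coproducts, so associativity is coassociativity tested against such functionals. -/
theorem convolution_convolution_left {M : Type u} [AddCommMonoid M] [Module k M]
    (Δ : M →ₗ[k] M ⊗[k] M) (φ ψ χ : Module.Dual k M) (x : M) :
    convolution Δ (convolution Δ φ ψ) χ x =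
      TensorProduct.dualDistrib k M _ (φ ⊗ₜ TensorProduct.dualDistrib k M M (ψ ⊗ₜ χ))
        (TensorProduct.assoc k M M M (Δ.rTensor M (Δ x))) := by
  have h : TensorProduct.dualDistrib k M M (convolution Δ φ ψ ⊗ₜ χ) =
      TensorProduct.dualDistrib k M _ (φ ⊗ₜ TensorProduct.dualDistrib k M M (ψ ⊗ₜ χ)) ∘ₗ
        (TensorProduct.assoc k M M M).toLinearMap ∘ₗ Δ.rTensor M := by
    have h' : TensorProduct.dualDistrib k _ M (TensorProduct.dualDistrib k M M (φ ⊗ₜ ψ) ⊗ₜ χ) =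
        TensorProduct.dualDistrib k M _ (φ ⊗ₜ TensorProduct.dualDistrib k M M (ψ ⊗ₜ χ)) ∘ₗ
          (TensorProduct.assoc k M M M).toLinearMap :=
      TensorProduct.ext_threefold fun x y z ↦ by simp [mul_assoc]
    rw [← LinearMap.comp_assoc, ← h']
    exact TensorProduct.ext' fun x y ↦ by simp [convolution_apply]
  rw [convolution_apply, h]
  rfl

theorem convolution_convolution_right {M : Type u} [AddCommMonoid M] [Module k M]
    (Δ : M →ₗ[k] M ⊗[k] M) (φ ψ χ : Module.Dual k M) (x : M) :
    convolution Δ φ (convolution Δ ψ χ) x =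
      TensorProduct.dualDistrib k M _ (φ ⊗ₜ TensorProduct.dualDistrib k M M (ψ ⊗ₜ χ))
        (Δ.lTensor M (Δ x)) := by
  have h : TensorProduct.dualDistrib k M M (φ ⊗ₜ convolution Δ ψ χ) =
      TensorProduct.dualDistrib k M _ (φ ⊗ₜ TensorProduct.dualDistrib k M M (ψ ⊗ₜ χ)) ∘ₗ
        Δ.lTensor M := TensorProduct.ext' fun x y ↦ by simp [convolution_apply]
  rw [convolution_apply, h]
  rfl

/-- For `φ` the unit and varying `ψ`, this reads the counit axiom off the unit law. -/
theorem dualDistrib_eq_lid_rTensor {M : Type u} [AddCommMonoid M] [Module k M]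
    (φ ψ : Module.Dual k M) (z : M ⊗[k] M) :
    TensorProduct.dualDistrib k M M (φ ⊗ₜ ψ) z = ψ (TensorProduct.lid k M (φ.rTensor M z)) := by
  have h : TensorProduct.dualDistrib k M M (φ ⊗ₜ ψ) =
      ψ ∘ₗ (TensorProduct.lid k M).toLinearMap ∘ₗ φ.rTensor M :=
    TensorProduct.ext' fun x y ↦ by simp
  rw [h]
  rfl

theorem dualDistrib_eq_rid_lTensor {M : Type u} [AddCommMonoid M] [Module k M]
    (φ ψ : Module.Dual k M) (z : M ⊗[k] M) :
    TensorProduct.dualDistrib k M M (φ ⊗ₜ ψ) z = φ (TensorProduct.rid k M (ψ.lTensor M z)) := by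
  have h : TensorProduct.dualDistrib k M M (φ ⊗ₜ ψ) =
      φ ∘ₗ (TensorProduct.rid k M).toLinearMap ∘ₗ ψ.lTensor M :=
    TensorProduct.ext' fun x y ↦ by simp [mul_comm]
  rw [h]
  rfl

/-- Hence an element of `M ⊗ N` is determined by its pairings with products of coordinates. -/
theorem dualDistrib_coord {M N κ κ' : Type*} [AddCommMonoid M] [Module k M] [AddCommMonoid N]
    [Module k N] (b : Module.Basis κ k M) (c : Module.Basis κ' k N) (i : κ) (j : κ') :
    TensorProduct.dualDistrib k M N (b.coord i ⊗ₜ c.coord j) = (b.tensorProduct c).coord (i, j) :=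
  TensorProduct.ext' fun x y ↦ by simp [mul_comm]

variable {ι : Type} [DecidableEq ι] {V : ι → Type u}
  [∀ s, AddCommMonoid (V s)] [∀ s, Module k (V s)] {deg : ι → ℕ}

theorem mem_dualHomogeneous {n : ℕ} {φ : Module.Dual k (⨁ s, V s)} :
    φ ∈ dualHomogeneous k V deg n ↔ ∀ s, deg s ≠ n → ∀ x, φ (lof k ι V s x) = 0 := by
  simp only [dualHomogeneous, Submodule.mem_iInf, Submodule.mem_dualAnnihilator]
  constructor
  · intro h s hs x
    exact h _ hs _ (Submodule.mem_iSup_of_mem s (Submodule.mem_iSup_of_mem rfl ⟨x, rfl⟩))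
  · intro h p hp w hw
    have : homogeneous k V deg p ≤ LinearMap.ker φ := by
      refine iSup₂_le fun s hs ↦ ?_
      rintro _ ⟨x, rfl⟩
      exact h s (hs ▸ hp) x
    exact this hw

theorem dualHomogeneous_apply_eq_zero {p n : ℕ} {φ : Module.Dual k (⨁ s, V s)}
    (hφ : φ ∈ dualHomogeneous k V deg p) (h : p ≠ n) {x : ⨁ s, V s}
    (hx : x ∈ homogeneous k V deg n) : φ x = 0 := by
  simp only [dualHomogeneous, Submodule.mem_iInf, Submodule.mem_dualAnnihilator] at hφ
  exact hφ n h.symm x hx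

theorem lof_mem_homogeneous (s : ι) (x : V s) : lof k ι V s x ∈ homogeneous k V deg (deg s) :=
  Submodule.mem_iSup_of_mem s (Submodule.mem_iSup_of_mem rfl ⟨x, rfl⟩)

/-- The swap has a sign depending on its arguments, but homogeneous functionals see only arguments
of their own degrees, where that sign is constant. -/
theorem dualDistrib_koszulSwap {p q : ℕ} {φ ψ : Module.Dual k (⨁ s, V s)}
    (hφ : φ ∈ dualHomogeneous k V deg p) (hψ : ψ ∈ dualHomogeneous k V deg q)
    (z : (⨁ s, V s) ⊗[k] (⨁ s, V s)) :
    TensorProduct.dualDistrib k _ _ (φ ⊗ₜ ψ) (koszulSwap k V deg z) =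
      (-1) ^ (p * q) * TensorProduct.dualDistrib k _ _ (ψ ⊗ₜ φ) z := by
  rw [mem_dualHomogeneous] at hφ hψ
  suffices h : TensorProduct.dualDistrib k _ _ (φ ⊗ₜ ψ) ∘ₗ koszulSwap k V deg =
      ((-1 : k) ^ (p * q)) • TensorProduct.dualDistrib k _ _ (ψ ⊗ₜ φ) from
    LinearMap.congr_fun h z
  refine TensorProduct.ext (DirectSum.linearMap_ext _ fun a ↦ LinearMap.ext fun x ↦
    DirectSum.linearMap_ext _ fun b ↦ LinearMap.ext fun y ↦ ?_)
  change TensorProduct.dualDistrib k _ _ (φ ⊗ₜ ψ) (koszulSwap k V deg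
    (lof k ι V a x ⊗ₜ lof k ι V b y)) = (-1) ^ (p * q) *
      TensorProduct.dualDistrib k _ _ (ψ ⊗ₜ φ) (lof k ι V a x ⊗ₜ lof k ι V b y)
  simp only [LinearMap.comp_apply, koszulSwap, LinearEquiv.coe_coe,
    TensorProduct.directSum_lof_tmul_lof, toModule_lof, LinearMap.smul_apply,
    TensorProduct.comm_tmul, TensorProduct.map_tmul, map_smul, TensorProduct.dualDistrib_apply,
    smul_eq_mul]
  by_cases ha : deg b = p
  · by_cases hb : deg a = q
    · rw [ha, hb]; ring
    · simp [hψ a hb]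
  · simp [hφ b ha]

/-- The functionals in the sets `G p`, which are of degree `p`, multiply as in an associative graded
commutative algebra with unit `e`. -/
structure IsDualAlgebra (deg : ι → ℕ) (G : ℕ → Set (Module.Dual k (⨁ s, V s)))
    (Δ : (⨁ s, V s) →ₗ[k] (⨁ s, V s) ⊗[k] (⨁ s, V s)) (e : Module.Dual k (⨁ s, V s)) : Prop where
  degree : ∀ p, ∀ φ ∈ G p, φ ∈ dualHomogeneous k V deg p
  mul_mem : ∀ p q, ∀ φ ∈ G p, ∀ ψ ∈ G q, convolution Δ φ ψ ∈ dualHomogeneous k V deg (p + q)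
  assoc : ∀ p q r, ∀ φ ∈ G p, ∀ ψ ∈ G q, ∀ χ ∈ G r,
    convolution Δ (convolution Δ φ ψ) χ = convolution Δ φ (convolution Δ ψ χ)
  comm : ∀ p q, ∀ φ ∈ G p, ∀ ψ ∈ G q, convolution Δ φ ψ = (-1 : k) ^ (p * q) • convolution Δ ψ φ
  unit_mem : e ∈ dualHomogeneous k V deg 0
  one_mul : ∀ p, ∀ φ ∈ G p, convolution Δ e φ = φ
  mul_one : ∀ p, ∀ φ ∈ G p, convolution Δ φ e = φ

variable {Δ : (⨁ s, V s) →ₗ[k] (⨁ s, V s) ⊗[k] (⨁ s, V s)}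

/-- Each coordinate lies in some `G p`, so the unit law shows that the two sides have equal
coordinates. -/
theorem IsDualAlgebra.lid_rTensor_unit {G : ℕ → Set (Module.Dual k (⨁ s, V s))}
    {e : Module.Dual k (⨁ s, V s)} (h : IsDualAlgebra deg G Δ e) {κ : Type*}
    (b : Module.Basis κ k (⨁ s, V s)) (d : κ → ℕ) (hG : ∀ i, b.coord i ∈ G (d i))
    (x : ⨁ s, V s) : TensorProduct.lid k _ (e.rTensor _ (Δ x)) = x := by
  refine b.ext_elem fun i ↦ ?_
  simp only [← Module.Basis.coord_apply]
  rw [← dualDistrib_eq_lid_rTensor, ← convolution_apply, h.one_mul _ _ (hG i)]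

theorem IsDualAlgebra.rid_lTensor_unit {G : ℕ → Set (Module.Dual k (⨁ s, V s))}
    {e : Module.Dual k (⨁ s, V s)} (h : IsDualAlgebra deg G Δ e) {κ : Type*}
    (b : Module.Basis κ k (⨁ s, V s)) (d : κ → ℕ) (hG : ∀ i, b.coord i ∈ G (d i))
    (x : ⨁ s, V s) : TensorProduct.rid k _ (e.lTensor _ (Δ x)) = x := by
  refine b.ext_elem fun i ↦ ?_
  simp only [← Module.Basis.coord_apply]
  rw [← dualDistrib_eq_rid_lTensor, ← convolution_apply, h.mul_one _ _ (hG i)]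

/-- The unit law passes from the sets `G p` to arbitrary functionals, including inhomogeneous ones,
because the coordinates already give the counit axiom. -/
theorem IsDualAlgebra.unit_convolution {G : ℕ → Set (Module.Dual k (⨁ s, V s))}
    {e : Module.Dual k (⨁ s, V s)} (h : IsDualAlgebra deg G Δ e) {κ : Type*}
    (b : Module.Basis κ k (⨁ s, V s)) (d : κ → ℕ) (hG : ∀ i, b.coord i ∈ G (d i))
    (φ : Module.Dual k (⨁ s, V s)) : convolution Δ e φ = φ := by
  refine LinearMap.ext fun x ↦ ?_
  rw [convolution_apply, dualDistrib_eq_lid_rTensor, h.lid_rTensor_unit b d hG]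

theorem IsDualAlgebra.convolution_unit {G : ℕ → Set (Module.Dual k (⨁ s, V s))}
    {e : Module.Dual k (⨁ s, V s)} (h : IsDualAlgebra deg G Δ e) {κ : Type*}
    (b : Module.Basis κ k (⨁ s, V s)) (d : κ → ℕ) (hG : ∀ i, b.coord i ∈ G (d i))
    (φ : Module.Dual k (⨁ s, V s)) : convolution Δ φ e = φ := by
  refine LinearMap.ext fun x ↦ ?_
  rw [convolution_apply, dualDistrib_eq_rid_lTensor, h.rid_lTensor_unit b d hG]

/-- If the coordinates of a homogeneous basis are among the functionals, then the axioms of a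
coalgebra follow from those of the dual algebra. -/
theorem IsDualAlgebra.isGradedCocommutativeCoalgebra {G : ℕ → Set (Module.Dual k (⨁ s, V s))}
    {e : Module.Dual k (⨁ s, V s)} (h : IsDualAlgebra deg G Δ e) {κ : Type*}
    (b : Module.Basis κ k (⨁ s, V s)) (d : κ → ℕ) (hb : ∀ i, b i ∈ homogeneous k V deg (d i))
    (hG : ∀ i, b.coord i ∈ G (d i)) : IsGradedCocommutativeCoalgebra deg Δ where
  graded n x hx := by
    -- The coefficient of `Δ x` at `(i, j)` is the value at `x` of the product of two coordinates, a
    -- functional of degree `d i + d j`; it vanishes unless this is the degree of `x`.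
    rw [← (b.tensorProduct b).linearCombination_repr (Δ x), Finsupp.linearCombination_apply]
    refine Submodule.sum_mem _ fun ⟨i, j⟩ _ ↦ ?_
    by_cases hij : d i + d j = n
    · refine Submodule.smul_mem _ _ (Submodule.mem_iSup_of_mem (d i, d j)
        (Submodule.mem_iSup_of_mem (Finset.HasAntidiagonal.mem_antidiagonal.2 hij) ?_))
      exact ⟨⟨b i, hb i⟩ ⊗ₜ ⟨b j, hb j⟩, by simp [Module.Basis.tensorProduct_apply]⟩
    · have : (b.tensorProduct b).repr (Δ x) (i, j) = 0 := by
        rw [← Module.Basis.coord_apply, ← dualDistrib_coord]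
        exact dualHomogeneous_apply_eq_zero (h.mul_mem _ _ _ (hG i) _ (hG j)) hij hx
      simp only [this, zero_smul]
      exact Submodule.zero_mem _
  coassoc := by
    refine LinearMap.ext fun x ↦ (b.tensorProduct (b.tensorProduct b)).ext_elem fun ⟨i, j, l⟩ ↦ ?_
    simp only [← Module.Basis.coord_apply]
    rw [← dualDistrib_coord, ← dualDistrib_coord]
    have := LinearMap.congr_fun (h.assoc _ _ _ _ (hG i) _ (hG j) _ (hG l)) x
    rwa [convolution_convolution_left, convolution_convolution_right] at this
  counit := by
    refine ⟨e, fun n hn x hx ↦ dualHomogeneous_apply_eq_zero h.unit_mem hn.symm hx,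
      fun x ↦ (TensorProduct.lid k _).injective ?_, fun x ↦ (TensorProduct.rid k _).injective ?_⟩
    · rw [h.lid_rTensor_unit b d hG, TensorProduct.lid_tmul, one_smul]
    · rw [h.rid_lTensor_unit b d hG, TensorProduct.rid_tmul, one_smul]
  cocomm := by
    refine LinearMap.ext fun x ↦ (b.tensorProduct b).ext_elem fun ⟨i, j⟩ ↦ ?_
    simp only [← Module.Basis.coord_apply]
    rw [← dualDistrib_coord, LinearMap.comp_apply, dualDistrib_koszulSwap
      (h.degree _ _ (hG i)) (h.degree _ _ (hG j))]
    exact (LinearMap.congr_fun (h.comm _ _ _ (hG i) _ (hG j)) x).symm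

/-- This covers all homogeneous functionals, not only the test functionals in `G`, as the full dual
space requires. -/
theorem IsGradedCocommutativeCoalgebra.convolution_mem (h : IsGradedCocommutativeCoalgebra deg Δ)
    {p q : ℕ} {φ ψ : Module.Dual k (⨁ s, V s)}
    (hφ : φ ∈ dualHomogeneous k V deg p) (hψ : ψ ∈ dualHomogeneous k V deg q) :
    convolution Δ φ ψ ∈ dualHomogeneous k V deg (p + q) := by
  rw [mem_dualHomogeneous]
  intro s hs x
  have hle : ⨆ c ∈ Finset.HasAntidiagonal.antidiagonal (deg s),
      LinearMap.range (TensorProduct.map (homogeneous k V deg c.1).subtype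
        (homogeneous k V deg c.2).subtype) ≤
      LinearMap.ker (TensorProduct.dualDistrib k _ _ (φ ⊗ₜ ψ)) := by
    refine iSup₂_le fun c hc ↦ LinearMap.range_le_ker_iff.2 (TensorProduct.ext' fun y z ↦ ?_)
    rw [Finset.HasAntidiagonal.mem_antidiagonal] at hc
    have : p ≠ c.1 ∨ q ≠ c.2 := by omega
    rcases this with h | h
    · simp [dualHomogeneous_apply_eq_zero hφ h y.2]
    · simp [dualHomogeneous_apply_eq_zero hψ h z.2]
  exact hle (h.graded _ _ (lof_mem_homogeneous s x))

/-- The dual algebra of a coalgebra, and those of its subspaces which are closed under products and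
contain the counit. -/
theorem IsGradedCocommutativeCoalgebra.isGradedCommutativeAlgebra
    (h : IsGradedCocommutativeCoalgebra deg Δ) (B : Submodule k (Module.Dual k (⨁ s, V s)))
    (hmul : ∀ φ ∈ B, ∀ ψ ∈ B, convolution Δ φ ψ ∈ B) {e : Module.Dual k (⨁ s, V s)} (heB : e ∈ B)
    (he : e ∈ dualHomogeneous k V deg 0) (h1 : ∀ φ ∈ B, convolution Δ e φ = φ)
    (h2 : ∀ φ ∈ B, convolution Δ φ e = φ) :
    IsGradedCommutativeAlgebra deg B (convolution Δ) where
  mul_mem := hmul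
  graded p q φ hφ ψ hψ := h.convolution_mem hφ.2 hψ.2
  assoc φ _ ψ _ χ _ := by
    refine LinearMap.ext fun x ↦ ?_
    rw [convolution_convolution_left, convolution_convolution_right]
    exact congrArg _ (LinearMap.congr_fun h.coassoc x)
  unit := ⟨e, ⟨heB, he⟩, fun φ hφ ↦ ⟨h1 φ hφ, h2 φ hφ⟩⟩
  comm p q φ hφ ψ hψ := by
    refine LinearMap.ext fun x ↦ ?_
    rw [convolution_apply, ← LinearMap.congr_fun h.cocomm x]
    exact dualDistrib_koszulSwap hφ.2 hψ.2 _

end GradedDual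

/-! ### The coalgebra `𝔨 ⊕ 𝔦 ⊕ 𝔠` of a single pair. -/

namespace Splitting

variable {k : Type u} [Field k] {V W : ℕ → Type u}
  [∀ n, AddCommGroup (V n)] [∀ n, Module k (V n)] [∀ n, AddCommGroup (W n)] [∀ n, Module k (W n)]
  {f : ∀ n, V n →ₗ[k] W n} (S : Splitting f)

theorem ofSource_of_mem_ker {n : ℕ} {x : V n} (hx : x ∈ LinearMap.ker (f n)) :
    S.ofSource (lof k ℕ V n x) = S.inclKer n ⟨x, hx⟩ := by
  have h1 := Submodule.projectionOnto_apply_left (S.isCompl_im n) ⟨x, hx⟩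
  have h2 := Submodule.projectionOnto_apply_right (S.isCompl_im n).symm ⟨x, hx⟩
  simp only [] at h1 h2
  simp [ofSource, h1, h2]

theorem ofSource_of_mem_im {n : ℕ} {x : V n} (hx : x ∈ S.im n) :
    S.ofSource (lof k ℕ V n x) = S.inclIm n ⟨x, hx⟩ := by
  have h1 := Submodule.projectionOnto_apply_left (S.isCompl_im n).symm ⟨x, hx⟩
  have h2 := Submodule.projectionOnto_apply_right (S.isCompl_im n) ⟨x, hx⟩
  simp only [] at h1 h2
  simp [ofSource, h1, h2]

theorem ofTarget_of_mem_coker {n : ℕ} {x : W n} (hx : x ∈ S.coker n) :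
    S.ofTarget (lof k ℕ W n x) = S.inclCoker n ⟨x, hx⟩ := by
  have h1 := Submodule.projectionOnto_apply_left (S.isCompl_coker n).symm ⟨x, hx⟩
  have h2 := Submodule.projectionOnto_apply_right (S.isCompl_coker n) ⟨x, hx⟩
  simp only [] at h1 h2
  simp only [ofTarget, toModule_lof, LinearMap.add_apply, LinearMap.comp_apply, h1, h2, map_zero,
    zero_add]

theorem ofTarget_apply_of_mem_im {n : ℕ} {x : V n} (hx : x ∈ S.im n) :
    S.ofTarget (lof k ℕ W n (f n x)) = S.inclIm n ⟨x, hx⟩ := by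
  have h1 := Submodule.projectionOnto_apply_left (S.isCompl_coker n)
    ⟨f n x, LinearMap.mem_range_self _ _⟩
  have h2 := Submodule.projectionOnto_apply_right (S.isCompl_coker n).symm
    ⟨f n x, LinearMap.mem_range_self _ _⟩
  have h3 : ((f n).kerComplementEquivRange (S.isCompl_im n).symm).symm
      ⟨f n x, LinearMap.mem_range_self _ _⟩ = ⟨x, hx⟩ := by
    rw [LinearEquiv.symm_apply_eq]
    rfl
  simp only [] at h1 h2
  simp [ofTarget, h1, h2, h3]

theorem source_induction {P : ∀ n, V n → Prop} (hadd : ∀ n x y, P n x → P n y → P n (x + y))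
    (hker : ∀ n, ∀ x ∈ LinearMap.ker (f n), P n x) (him : ∀ n, ∀ x ∈ S.im n, P n x)
    (n : ℕ) (x : V n) : P n x := by
  obtain ⟨y, hy, z, hz, rfl⟩ := Submodule.mem_sup.1
    ((S.isCompl_im n).sup_eq_top.symm ▸ Submodule.mem_top : x ∈ LinearMap.ker (f n) ⊔ S.im n)
  exact hadd n y z (hker n y hy) (him n z hz)

/-- Since `f` kills `𝔨`, every element of its range is already the image of an element of `𝔦`. -/
theorem target_induction {P : ∀ n, W n → Prop} (hadd : ∀ n x y, P n x → P n y → P n (x + y))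
    (him : ∀ n, ∀ x ∈ S.im n, P n (f n x)) (hcoker : ∀ n, ∀ x ∈ S.coker n, P n x)
    (n : ℕ) (x : W n) : P n x := by
  obtain ⟨y, ⟨v, rfl⟩, z, hz, rfl⟩ := Submodule.mem_sup.1 ((S.isCompl_coker n).sup_eq_top.symm ▸
    Submodule.mem_top : x ∈ LinearMap.range (f n) ⊔ S.coker n)
  obtain ⟨a, ha, b, hb, rfl⟩ := Submodule.mem_sup.1
    ((S.isCompl_im n).sup_eq_top.symm ▸ Submodule.mem_top : v ∈ LinearMap.ker (f n) ⊔ S.im n)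
  rw [map_add, LinearMap.mem_ker.1 ha, zero_add]
  exact hadd n _ z (him n b hb) (hcoker n z hz)

theorem lof_ker {n : ℕ} (x : S.part (.ker, n)) :
    lof k (Label × ℕ) (fun p ↦ S.part p) (.ker, n) x = S.ofSource (lof k ℕ V n x.1.1) := by
  obtain ⟨⟨x, y⟩, hx, hy⟩ := x
  obtain rfl : y = 0 := hy
  exact (S.ofSource_of_mem_ker hx).symm

theorem lof_im {n : ℕ} (x : S.part (.im, n)) :
    lof k (Label × ℕ) (fun p ↦ S.part p) (.im, n) x = S.ofSource (lof k ℕ V n x.1.1) := by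
  obtain ⟨⟨x, y⟩, hx, hy⟩ := x
  obtain rfl : y = 0 := hy
  exact (S.ofSource_of_mem_im hx).symm

/-- The summand `𝔦` is reached from `W` as well as from `V`; this second description shows that a
functional vanishing on `W` vanishes on `𝔦`. -/
theorem lof_im' {n : ℕ} (x : S.part (.im, n)) :
    lof k (Label × ℕ) (fun p ↦ S.part p) (.im, n) x = S.ofTarget (lof k ℕ W n (f n x.1.1)) := by
  obtain ⟨⟨x, y⟩, hx, hy⟩ := x
  obtain rfl : y = 0 := hy
  exact (S.ofTarget_apply_of_mem_im hx).symm

theorem lof_coker {n : ℕ} (x : S.part (.coker, n)) :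
    lof k (Label × ℕ) (fun p ↦ S.part p) (.coker, n) x = S.ofTarget (lof k ℕ W n x.1.2) := by
  obtain ⟨⟨x, y⟩, hx, hy⟩ := x
  obtain rfl : x = 0 := hx
  exact (S.ofTarget_of_mem_coker hy).symm

/-- The images of `V` and `W` together span `𝔨 ⊕ 𝔦 ⊕ 𝔠`, so identities can be tested on the two
separately. -/
theorem total_hom_ext {N : Type*} [AddCommMonoid N] [Module k N] {g h : S.Total →ₗ[k] N}
    (h1 : g ∘ₗ S.ofSource = h ∘ₗ S.ofSource) (h2 : g ∘ₗ S.ofTarget = h ∘ₗ S.ofTarget) : g = h := by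
  refine DirectSum.linearMap_ext _ fun ⟨l, n⟩ ↦ LinearMap.ext fun x ↦ ?_
  simp only [LinearMap.comp_apply]
  cases l
  · rw [lof_ker]
    exact LinearMap.congr_fun h1 _
  · rw [lof_im]
    exact LinearMap.congr_fun h1 _
  · rw [lof_coker]
    exact LinearMap.congr_fun h2 _

/-- The two identifications agree on the overlap `𝔦`. On `𝔨` they do not: there `f` is zero while
`ofSource` is injective. -/
theorem ofTarget_lmap {x : ⨁ n, V n} (hx : x ∈ S.imTotal) :
    S.ofTarget (DirectSum.lmap f x) = S.ofSource x := by
  have h : S.imTotal ≤ LinearMap.eqLocus (S.ofTarget ∘ₗ DirectSum.lmap f) S.ofSource := by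
    refine iSup_le fun n ↦ ?_
    rintro _ ⟨y, hy, rfl⟩
    simp only [LinearMap.mem_eqLocus, LinearMap.comp_apply]
    rw [S.ofSource_of_mem_im hy, ← S.ofTarget_apply_of_mem_im hy]
    congr 1
    exact DirectSum.lmap_lof f n y
  exact h hx

variable {δV : (⨁ n, V n) →ₗ[k] (⨁ n, V n) ⊗[k] (⨁ n, V n)}
  {δW : (⨁ n, W n) →ₗ[k] (⨁ n, W n) ⊗[k] (⨁ n, W n)}

variable (δV δW) in
theorem comul_comp_ofSource :
    S.comul δV δW ∘ₗ S.ofSource = TensorProduct.map S.ofSource S.ofSource ∘ₗ δV := by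
  refine DirectSum.linearMap_ext _ fun n ↦ LinearMap.ext fun x ↦ ?_
  simp only [LinearMap.comp_apply]
  revert n
  refine S.source_induction (fun n x y hx hy ↦ by simp only [map_add, hx, hy]) ?_ ?_
  · intro n x hx
    rw [ofSource_of_mem_ker S hx]
    refine (toModule_lof _ _ _).trans ?_
    change TensorProduct.map S.ofSource S.ofSource (δV (lof k ℕ V n x)) +
      TensorProduct.map S.ofTarget S.ofTarget (δW (lof k ℕ W n 0)) = _
    simp
  · intro n x hx
    rw [ofSource_of_mem_im S hx]
    refine (toModule_lof _ _ _).trans ?_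
    change TensorProduct.map S.ofSource S.ofSource (δV (lof k ℕ V n x)) +
      TensorProduct.map S.ofTarget S.ofTarget (δW (lof k ℕ W n 0)) = _
    simp

variable {S} in
-- On `𝔠` this is the definition. On `f(𝔦)` the coproduct was defined by that of `V`, and the
-- comparison with `W` needs both hypotheses on `𝔦`.
theorem IsCoalgebraSplitting.comul_comp_ofTarget (hS : S.IsCoalgebraSplitting δV δW) :
    S.comul δV δW ∘ₗ S.ofTarget = TensorProduct.map S.ofTarget S.ofTarget ∘ₗ δW := by
  refine DirectSum.linearMap_ext _ fun n ↦ LinearMap.ext fun x ↦ ?_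
  simp only [LinearMap.comp_apply]
  revert n
  refine S.target_induction (fun n x y hx hy ↦ by simp only [map_add, hx, hy]) ?_ ?_
  · intro n x hx
    have hmem : lof k ℕ V n x ∈ S.imTotal :=
      Submodule.mem_iSup_of_mem n (Submodule.mem_map_of_mem hx)
    have e : lof k ℕ W n (f n x) = DirectSum.lmap f (lof k ℕ V n x) :=
      (DirectSum.lmap_lof f n x).symm
    rw [e, ofTarget_lmap S hmem, ← hS.map_comul _ hmem, ← LinearMap.comp_apply,
      comul_comp_ofSource, LinearMap.comp_apply]
    -- The coproduct lies in `𝔦 ⊗ 𝔦`, so there are no terms with a factor in `𝔨`, and on `𝔦` the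
    -- maps `ofTarget ∘ f` and `ofSource` coincide.
    obtain ⟨z, hz⟩ := hS.subcoalgebra _ hmem
    rw [← hz, ← LinearMap.comp_apply, ← LinearMap.comp_apply, ← LinearMap.comp_apply,
      ← TensorProduct.map_comp, ← TensorProduct.map_comp, ← TensorProduct.map_comp]
    congr 2 <;> exact LinearMap.ext fun y ↦ (ofTarget_lmap S y.2).symm
  · intro n x hx
    rw [ofTarget_of_mem_coker S hx]
    refine (toModule_lof _ _ _).trans ?_
    change TensorProduct.map S.ofSource S.ofSource (δV (lof k ℕ V n 0)) +
      TensorProduct.map S.ofTarget S.ofTarget (δW (lof k ℕ W n x)) = _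
    simp

/-- A functional on `𝔨 ⊕ 𝔦 ⊕ 𝔠` is homogeneous if its restrictions to `V` and `W` are. -/
theorem mem_dualHomogeneous_iff {d : ℕ} {φ : Module.Dual k S.Total} :
    φ ∈ dualHomogeneous k (fun p ↦ S.part p) Prod.snd d ↔
      φ ∘ₗ S.ofSource ∈ dualHomogeneous k V id d ∧ φ ∘ₗ S.ofTarget ∈ dualHomogeneous k W id d := by
  simp only [mem_dualHomogeneous, LinearMap.comp_apply, id]
  constructor
  · intro h
    constructor
    · refine fun n hn x ↦ ?_
      revert hn
      revert n
      refine S.source_induction (fun n x y hx hy hn ↦ ?_) ?_ ?_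
      · simp only [map_add, hx hn, hy hn, add_zero]
      · intro n x hx hn
        rw [ofSource_of_mem_ker S hx]
        exact h (.ker, n) hn _
      · intro n x hx hn
        rw [ofSource_of_mem_im S hx]
        exact h (.im, n) hn _
    · refine fun n hn x ↦ ?_
      revert hn
      revert n
      refine S.target_induction (fun n x y hx hy hn ↦ ?_) ?_ ?_
      · simp only [map_add, hx hn, hy hn, add_zero]
      · intro n x hx hn
        rw [ofTarget_apply_of_mem_im S hx]
        exact h (.im, n) hn _
      · intro n x hx hn
        rw [ofTarget_of_mem_coker S hx]
        exact h (.coker, n) hn _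
  · rintro ⟨h1, h2⟩ ⟨l, n⟩ hn x
    cases l
    · rw [lof_ker]
      exact h1 n hn _
    · rw [lof_im]
      exact h1 n hn _
    · rw [lof_coker]
      exact h2 n hn _

variable {eV : Module.Dual k (⨁ n, V n)} {eW : Module.Dual k (⨁ n, W n)}

variable (eV eW) in
/-- The functional on `𝔨 ⊕ 𝔦 ⊕ 𝔠` given by `eV` on `𝔨` and `𝔦` and by `eW` on `𝔠`. -/
def counit : Module.Dual k S.Total :=
  toModule k _ _ fun p ↦
    (eV ∘ₗ lof k ℕ V p.2 ∘ₗ LinearMap.fst k _ _ + eW ∘ₗ lof k ℕ W p.2 ∘ₗ LinearMap.snd k _ _) ∘ₗ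
      (S.part p).subtype

variable (eV eW) in
theorem counit_comp_ofSource : S.counit eV eW ∘ₗ S.ofSource = eV := by
  refine DirectSum.linearMap_ext _ fun n ↦ LinearMap.ext fun x ↦ ?_
  simp only [LinearMap.comp_apply]
  revert n
  refine S.source_induction (fun n x y hx hy ↦ by simp only [map_add, hx, hy]) ?_ ?_
  · intro n x hx
    rw [ofSource_of_mem_ker S hx]
    refine (toModule_lof _ _ _).trans ?_
    change eV (lof k ℕ V n x) + eW (lof k ℕ W n 0) = _
    simp
  · intro n x hx
    rw [ofSource_of_mem_im S hx]
    refine (toModule_lof _ _ _).trans ?_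
    change eV (lof k ℕ V n x) + eW (lof k ℕ W n 0) = _
    simp

/-- On `f(𝔦)` the functional was defined through `V`, so the counits of `V` and `W` must be
compatible with `f`. -/
theorem counit_comp_ofTarget (he : eW ∘ₗ DirectSum.lmap f = eV) :
    S.counit eV eW ∘ₗ S.ofTarget = eW := by
  refine DirectSum.linearMap_ext _ fun n ↦ LinearMap.ext fun x ↦ ?_
  simp only [LinearMap.comp_apply]
  revert n
  refine S.target_induction (fun n x y hx hy ↦ by simp only [map_add, hx, hy]) ?_ ?_
  · intro n x hx
    have e : lof k ℕ W n (f n x) = DirectSum.lmap f (lof k ℕ V n x) :=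
      (DirectSum.lmap_lof f n x).symm
    rw [ofTarget_apply_of_mem_im S hx, e, ← LinearMap.comp_apply eW, he]
    refine (toModule_lof _ _ _).trans ?_
    change eV (lof k ℕ V n x) + eW (lof k ℕ W n 0) = _
    simp
  · intro n x hx
    rw [ofTarget_of_mem_coker S hx]
    refine (toModule_lof _ _ _).trans ?_
    change eV (lof k ℕ V n 0) + eW (lof k ℕ W n x) = _
    simp

variable {S} in
theorem IsCoalgebraSplitting.convolution_comp_ofTarget (hS : S.IsCoalgebraSplitting δV δW)
    (φ ψ : Module.Dual k S.Total) :
    convolution (S.comul δV δW) φ ψ ∘ₗ S.ofTarget =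
      convolution δW (φ ∘ₗ S.ofTarget) (ψ ∘ₗ S.ofTarget) :=
  convolution_comp hS.comul_comp_ofTarget φ ψ

variable (δV δW) in
theorem convolution_comp_ofSource (φ ψ : Module.Dual k S.Total) :
    convolution (S.comul δV δW) φ ψ ∘ₗ S.ofSource =
      convolution δV (φ ∘ₗ S.ofSource) (ψ ∘ₗ S.ofSource) :=
  convolution_comp (S.comul_comp_ofSource δV δW) φ ψ

variable {S} in
/-- If `V` and `W` have graded commutative dual algebras, then so has `𝔨 ⊕ 𝔦 ⊕ 𝔠`. -/
theorem IsCoalgebraSplitting.isDualAlgebra (hS : S.IsCoalgebraSplitting δV δW)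
    (hV : IsDualAlgebra id (fun n ↦ dualHomogeneous k V id n) δV eV)
    (hW : IsDualAlgebra id (fun n ↦ dualHomogeneous k W id n) δW eW)
    (he : eW ∘ₗ DirectSum.lmap f = eV) :
    IsDualAlgebra Prod.snd (fun n ↦ dualHomogeneous k (fun p ↦ S.part p) Prod.snd n)
      (S.comul δV δW) (S.counit eV eW) where
  degree _ _ h := h
  mul_mem p q φ hφ ψ hψ := by
    obtain ⟨a, b⟩ := S.mem_dualHomogeneous_iff.1 hφ
    obtain ⟨c, d⟩ := S.mem_dualHomogeneous_iff.1 hψ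
    rw [mem_dualHomogeneous_iff, convolution_comp_ofSource, hS.convolution_comp_ofTarget]
    exact ⟨hV.mul_mem _ _ _ a _ c, hW.mul_mem _ _ _ b _ d⟩
  assoc p q r φ hφ ψ hψ χ hχ := by
    obtain ⟨a, b⟩ := S.mem_dualHomogeneous_iff.1 hφ
    obtain ⟨c, d⟩ := S.mem_dualHomogeneous_iff.1 hψ
    obtain ⟨g, h⟩ := S.mem_dualHomogeneous_iff.1 hχ
    refine S.total_hom_ext ?_ ?_
    · simp only [convolution_comp_ofSource]
      exact hV.assoc _ _ _ _ a _ c _ g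
    · simp only [hS.convolution_comp_ofTarget]
      exact hW.assoc _ _ _ _ b _ d _ h
  comm p q φ hφ ψ hψ := by
    obtain ⟨a, b⟩ := S.mem_dualHomogeneous_iff.1 hφ
    obtain ⟨c, d⟩ := S.mem_dualHomogeneous_iff.1 hψ
    refine S.total_hom_ext ?_ ?_
    · simp only [convolution_comp_ofSource, LinearMap.smul_comp]
      exact hV.comm _ _ _ a _ c
    · simp only [hS.convolution_comp_ofTarget, LinearMap.smul_comp]
      exact hW.comm _ _ _ b _ d
  unit_mem := by
    rw [mem_dualHomogeneous_iff, counit_comp_ofSource, S.counit_comp_ofTarget he]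
    exact ⟨hV.unit_mem, hW.unit_mem⟩
  one_mul p φ hφ := by
    obtain ⟨a, b⟩ := S.mem_dualHomogeneous_iff.1 hφ
    refine S.total_hom_ext ?_ ?_
    · rw [convolution_comp_ofSource, counit_comp_ofSource]
      exact hV.one_mul _ _ a
    · rw [hS.convolution_comp_ofTarget, S.counit_comp_ofTarget he]
      exact hW.one_mul _ _ b
  mul_one p φ hφ := by
    obtain ⟨a, b⟩ := S.mem_dualHomogeneous_iff.1 hφ
    refine S.total_hom_ext ?_ ?_
    · rw [convolution_comp_ofSource, counit_comp_ofSource]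
      exact hV.mul_one _ _ a
    · rw [hS.convolution_comp_ofTarget, S.counit_comp_ofTarget he]
      exact hW.mul_one _ _ b

/-- A functional is supported on the label `l` if it vanishes on the other two summands. -/
def IsSupported (φ : Module.Dual k S.Total) (l : Label) : Prop :=
  ∀ p : Label × ℕ, p.1 ≠ l → ∀ x : S.part p, φ (lof k _ (fun p ↦ S.part p) p x) = 0

variable {S} in
theorem IsSupported.comp_ofSource {φ : Module.Dual k S.Total} (h : S.IsSupported φ .coker) :
    φ ∘ₗ S.ofSource = 0 := by
  refine DirectSum.linearMap_ext _ fun n ↦ LinearMap.ext fun x ↦ ?_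
  simp only [LinearMap.comp_apply]
  revert n
  refine S.source_induction (fun n x y hx hy ↦ by simp only [map_add, hx, hy]) ?_ ?_
  · intro n x hx
    rw [ofSource_of_mem_ker S hx]
    exact h (.ker, n) (by simp) _
  · intro n x hx
    rw [ofSource_of_mem_im S hx]
    exact h (.im, n) (by simp) _

variable {S} in
theorem IsSupported.comp_ofTarget {φ : Module.Dual k S.Total} (h : S.IsSupported φ .ker) :
    φ ∘ₗ S.ofTarget = 0 := by
  refine DirectSum.linearMap_ext _ fun n ↦ LinearMap.ext fun x ↦ ?_
  simp only [LinearMap.comp_apply]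
  revert n
  refine S.target_induction (fun n x y hx hy ↦ by simp only [map_add, hx, hy]) ?_ ?_
  · intro n x hx
    rw [ofTarget_apply_of_mem_im S hx]
    exact h (.im, n) (by simp) _
  · intro n x hx
    rw [ofTarget_of_mem_coker S hx]
    exact h (.coker, n) (by simp) _

variable (δV δW) in
/-- `𝔨 ⊕ 𝔦` is a subcoalgebra. -/
theorem convolution_eq_zero_of_coker {φ ψ : Module.Dual k S.Total}
    (h : S.IsSupported φ .coker ∨ S.IsSupported ψ .coker) :
    S.IsSupported (convolution (S.comul δV δW) φ ψ) .coker := by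
  -- A functional supported on `𝔠` restricts to zero on `V`, and restriction to `V` is
  -- multiplicative.
  have h0 : convolution (S.comul δV δW) φ ψ ∘ₗ S.ofSource = 0 := by
    rw [convolution_comp_ofSource]
    rcases h with h | h <;> simp [h.comp_ofSource]
  rintro ⟨_ | _ | _, n⟩ hl x
  · rw [lof_ker]
    exact LinearMap.congr_fun h0 _
  · rw [lof_im]
    exact LinearMap.congr_fun h0 _
  · exact absurd rfl hl

variable {S} in
/-- `𝔦 ⊕ 𝔠` is a subcoalgebra. -/
theorem IsCoalgebraSplitting.convolution_eq_zero_of_ker (hS : S.IsCoalgebraSplitting δV δW)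
    {φ ψ : Module.Dual k S.Total} (h : S.IsSupported φ .ker ∨ S.IsSupported ψ .ker) :
    S.IsSupported (convolution (S.comul δV δW) φ ψ) .ker := by
  have h0 : convolution (S.comul δV δW) φ ψ ∘ₗ S.ofTarget = 0 := by
    rw [hS.convolution_comp_ofTarget]
    rcases h with h | h <;> simp [h.comp_ofTarget]
  rintro ⟨_ | _ | _, n⟩ hl x
  · exact absurd rfl hl
  · rw [lof_im']
    exact LinearMap.congr_fun h0 _
  · rw [lof_coker]
    exact LinearMap.congr_fun h0 _

end Splitting

/-! ### Bases of direct sums and their coordinates. -/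

section DirectSumBasis

variable {k : Type*} [Field k] {ι : Type*} {V : ι → Type*}
  [∀ s, AddCommMonoid (V s)] [∀ s, Module k (V s)] {κ : ι → Type*}

/-- The basis of a direct sum formed by bases of the summands. -/
def directSumBasis (b : ∀ s, Module.Basis (κ s) k (V s)) : Module.Basis (Σ s, κ s) k (⨁ s, V s) :=
  DFinsupp.basis b

theorem directSumBasis_coord (b : ∀ s, Module.Basis (κ s) k (V s)) (p : Σ s, κ s) :
    (directSumBasis b).coord p = (b p.1).coord p.2 ∘ₗ component k ι V p.1 :=
  LinearMap.ext fun _ ↦ rfl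

variable [DecidableEq ι]

theorem directSumBasis_apply (b : ∀ s, Module.Basis (κ s) k (V s)) (p : Σ s, κ s) :
    directSumBasis b p = lof k ι V p.1 (b p.1 p.2) := by
  classical
  refine (directSumBasis b).ext_elem fun q ↦ ?_
  simp only [← Module.Basis.coord_apply]
  obtain ⟨s, i⟩ := p
  obtain ⟨t, j⟩ := q
  rw [Module.Basis.coord_apply, Module.Basis.repr_self, directSumBasis_coord, LinearMap.comp_apply]
  by_cases h : s = t
  · subst h
    rw [component.lof_self]
    simp [Finsupp.single_apply]
  · rw [component.of, dif_neg h, map_zero, Finsupp.single_apply, if_neg]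
    exact fun e ↦ h (congrArg Sigma.fst e)

theorem component_lof_of_ne {s t : ι} (h : s ≠ t) (x : V s) :
    component k ι V t (lof k ι V s x) = 0 := by
  rw [component.of, dif_neg h]

theorem directSumBasis_coord_lof (b : ∀ s, Module.Basis (κ s) k (V s)) (s : ι) (i : κ s)
    (x : V s) : (directSumBasis b).coord ⟨s, i⟩ (lof k ι V s x) = (b s).coord i x := by
  rw [directSumBasis_coord, LinearMap.comp_apply, component.lof_self]

theorem directSumBasis_coord_lof_of_ne (b : ∀ s, Module.Basis (κ s) k (V s)) {t : ι}
    (p : Σ s, κ s) (h : t ≠ p.1) (x : V t) :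
    (directSumBasis b).coord p (lof k ι V t x) = 0 := by
  rw [directSumBasis_coord, LinearMap.comp_apply, component_lof_of_ne h, map_zero]

end DirectSumBasis

/-! ### Koszul signs. -/

section TensorSign

variable {k : Type u} [Field k] {m : ℕ}

/-- The sign of the interchange of two families of factors, in terms of their degrees. -/
def shuffleSign (d d' : Fin m → ℕ) : k := (-1) ^ ∑ i, ∑ j with i < j, d' i * d j

theorem koszulSign_eq (s t : MultiIndex m) :
    (koszulSign s t : k) = shuffleSign (fun j ↦ (s j).2) (fun j ↦ (t j).2) := rfl

theorem shuffleSign_zero_left (d : Fin m → ℕ) : (shuffleSign 0 d : k) = 1 := by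
  simp [shuffleSign]

theorem shuffleSign_zero_right (d : Fin m → ℕ) : (shuffleSign d 0 : k) = 1 := by
  simp [shuffleSign]

/-- The exponent is biadditive, so both sides collect the same three pairings of `d`, `d'` and
`d''`. -/
theorem shuffleSign_assoc (d d' d'' : Fin m → ℕ) :
    (shuffleSign d d' * shuffleSign (d + d') d'' : k) =
      shuffleSign d' d'' * shuffleSign d (d' + d'') := by
  simp only [shuffleSign, ← pow_add]
  congr 1
  simp only [Pi.add_apply, add_mul, mul_add, Finset.sum_add_distrib]
  ring

theorem sum_mul_sum_eq (d d' : Fin m → ℕ) :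
    (∑ i, d i) * ∑ j, d' j = ∑ i, ∑ j with i < j, d i * d' j + ∑ i, d i * d' i +
      ∑ i, ∑ j with i < j, d' i * d j := by
  have h : ∀ i, ∑ j, d i * d' j = ∑ j with i < j, d i * d' j + d i * d' i +
      ∑ j with j < i, d i * d' j := by
    intro i
    rw [← Finset.sum_filter_add_sum_filter_not Finset.univ (fun j ↦ i < j), add_assoc]
    congr 1
    rw [← Finset.sum_filter_add_sum_filter_not (Finset.univ.filter fun j ↦ ¬ i < j) (fun j ↦ j = i),
      Finset.filter_filter, Finset.filter_filter]
    congr 1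
    · rw [Finset.sum_eq_single i (by simp +contextual) (by simp)]
    · refine Finset.sum_congr (Finset.filter_congr fun j _ ↦ ?_) fun _ _ ↦ rfl
      rw [not_lt, lt_iff_le_and_ne]
  rw [Finset.sum_mul_sum, Finset.sum_congr rfl fun i _ ↦ h i, Finset.sum_add_distrib,
    Finset.sum_add_distrib]
  congr 1
  simp only [Finset.sum_filter]
  rw [Finset.sum_comm]
  simp only [mul_comm]

/-- Split the product of the total degrees into the pairs above, on and below the diagonal: one
triangle occurs twice and cancels, the diagonal gives the signs of the factorwise swaps, and the
other triangle is the remaining shuffle sign. -/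
theorem shuffleSign_comm (d d' : Fin m → ℕ) :
    (shuffleSign d d' * ∏ j, (-1 : k) ^ (d j * d' j) : k) =
      (-1) ^ ((∑ j, d j) * ∑ j, d' j) * shuffleSign d' d := by
  rw [Finset.prod_pow_eq_pow_sum, sum_mul_sum_eq]
  simp only [shuffleSign, ← pow_add]
  rw [show ∀ a b c : ℕ, a + b + c + a = (c + b) + 2 * a by intros; ring, pow_add _ _ (2 * _),
    pow_mul, neg_one_sq, one_pow, mul_one]

end TensorSign

/-! ### Tensor products of functionals on the full tensor product. -/

section Box

variable {k : Type u} [Field k] {m : ℕ} {V W : Fin m → ℕ → Type u}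
  [∀ j n, AddCommGroup (V j n)] [∀ j n, Module k (V j n)]
  [∀ j n, AddCommGroup (W j n)] [∀ j n, Module k (W j n)]
  {f : ∀ j n, V j n →ₗ[k] W j n} (S : ∀ j, Splitting (f j)) (K : LowerSet (Finset (Fin m)))

/-- The tensor product of functionals on the factors, as a functional on the full tensor product. -/
def box (χ : ∀ j, Module.Dual k (S j).Total) : Module.Dual k (TotalTensor S) :=
  toModule k _ _ fun s ↦ PiTensorProduct.dualDistrib
    (PiTensorProduct.tprod k fun j ↦ χ j ∘ₗ lof k _ (fun p ↦ (S j).part p) (s j))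

theorem box_lof_tprod (χ : ∀ j, Module.Dual k (S j).Total) (s : MultiIndex m)
    (x : ∀ j, (S j).part (s j)) :
    box S χ (lof k (MultiIndex m) (fun s ↦ Piece S s) s (PiTensorProduct.tprod k x)) =
      ∏ j, χ j (lof k _ (fun p ↦ (S j).part p) (s j) (x j)) := by
  rw [box, toModule_lof, PiTensorProduct.dualDistrib_apply]
  rfl

variable {S} in
theorem totalTensor_hom_ext {N : Type*} [AddCommMonoid N] [Module k N] {g h : TotalTensor S →ₗ[k] N}
    (H : ∀ (s : MultiIndex m) (x : ∀ j, (S j).part (s j)),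
      g (lof k (MultiIndex m) (fun s ↦ Piece S s) s (PiTensorProduct.tprod k x)) =
        h (lof k (MultiIndex m) (fun s ↦ Piece S s) s (PiTensorProduct.tprod k x))) : g = h :=
  DirectSum.linearMap_ext _ fun s ↦ PiTensorProduct.ext <| MultilinearMap.ext fun x ↦ H s x

variable {S K} in
theorem T_hom_ext {N : Type*} [AddCommMonoid N] [Module k N] {g h : T S K →ₗ[k] N}
    (H : ∀ (s : AdmissibleIndex f K) (x : ∀ j, (S j).part (s.1 j)),
      g (lof k (AdmissibleIndex f K) (fun s ↦ Piece S s.1) s (PiTensorProduct.tprod k x)) =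
        h (lof k (AdmissibleIndex f K) (fun s ↦ Piece S s.1) s (PiTensorProduct.tprod k x))) :
    g = h :=
  DirectSum.linearMap_ext _ fun s ↦ PiTensorProduct.ext <| MultilinearMap.ext fun x ↦ H s x

theorem box_smul_family (c : Fin m → k) (χ : ∀ j, Module.Dual k (S j).Total) :
    box S (fun j ↦ c j • χ j) = (∏ j, c j) • box S χ :=
  totalTensor_hom_ext fun s x ↦ by
    simp only [LinearMap.smul_apply, box_lof_tprod, smul_eq_mul, Finset.prod_mul_distrib]

variable {S} in
theorem box_mem_dualHomogeneous {d : Fin m → ℕ} {χ : ∀ j, Module.Dual k (S j).Total}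
    (hχ : ∀ j, χ j ∈ dualHomogeneous k (fun p ↦ (S j).part p) Prod.snd (d j)) :
    box S χ ∈ dualHomogeneous k (fun s ↦ Piece S s) MultiIndex.degree (∑ j, d j) := by
  rw [mem_dualHomogeneous]
  intro s hs x
  suffices box S χ ∘ₗ lof k (MultiIndex m) (fun s ↦ Piece S s) s = 0 from LinearMap.congr_fun this x
  refine PiTensorProduct.ext <| MultilinearMap.ext fun x ↦ ?_
  refine (box_lof_tprod S χ s x).trans ?_
  -- If the total degrees differ, the degrees differ in some factor, and one vanishing factor kills
  -- the product.
  obtain ⟨j, hj⟩ : ∃ j, (s j).2 ≠ d j := by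
    by_contra! h
    exact hs (Finset.sum_congr rfl fun j _ ↦ h j)
  exact Finset.prod_eq_zero (Finset.mem_univ j) (mem_dualHomogeneous.1 (hχ j) _ hj _)

/-- A homogeneous basis of `𝔨 ⊕ 𝔦 ⊕ 𝔠`. -/
abbrev totalBasis (j : Fin m) :
    Module.Basis (Σ p : Label × ℕ, Module.Basis.ofVectorSpaceIndex k ((S j).part p)) k
      (S j).Total :=
  directSumBasis fun p ↦ Module.Basis.ofVectorSpace k ((S j).part p)

theorem totalBasis_coord_mem (j : Fin m)
    (p : Σ p : Label × ℕ, Module.Basis.ofVectorSpaceIndex k ((S j).part p)) :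
    (totalBasis S j).coord p ∈ dualHomogeneous k (fun p ↦ (S j).part p) Prod.snd p.1.2 := by
  rw [mem_dualHomogeneous]
  intro t ht x
  rw [directSumBasis_coord, LinearMap.comp_apply, component_lof_of_ne (fun h ↦ ht (congrArg Prod.snd h)),
    map_zero]

theorem totalBasis_coord_isSupported (j : Fin m)
    (p : Σ p : Label × ℕ, Module.Basis.ofVectorSpaceIndex k ((S j).part p)) :
    (S j).IsSupported ((totalBasis S j).coord p) p.1.1 := by
  intro t ht x
  rw [directSumBasis_coord, LinearMap.comp_apply, component_lof_of_ne (fun h ↦ ht (congrArg Prod.fst h)),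
    map_zero]

/-- The sign of the shuffle depends on the elements, but where all the functionals are nonzero the
degrees are forced to be `d` and `d'`; elsewhere both sides vanish. -/
theorem dualDistrib_box_koszulShuffle_lof {d d' : Fin m → ℕ}
    {χ χ' : ∀ j, Module.Dual k (S j).Total}
    (hχ : ∀ j, χ j ∈ dualHomogeneous k (fun p ↦ (S j).part p) Prod.snd (d j))
    (hχ' : ∀ j, χ' j ∈ dualHomogeneous k (fun p ↦ (S j).part p) Prod.snd (d' j))
    (s t : MultiIndex m) (x : ∀ j, (S j).part (s j)) (y : ∀ j, (S j).part (t j)) :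
    TensorProduct.dualDistrib k _ _ (box S χ ⊗ₜ box S χ')
      (koszulShuffle S (PiTensorProduct.tprod k fun j ↦ lof k _ (fun p ↦ (S j).part p) (s j) (x j) ⊗ₜ
        lof k _ (fun p ↦ (S j).part p) (t j) (y j))) =
      shuffleSign d d' * ∏ j, χ j (lof k _ (fun p ↦ (S j).part p) (s j) (x j)) *
        χ' j (lof k _ (fun p ↦ (S j).part p) (t j) (y j)) := by
  rw [koszulShuffle_tprod, LinearMap.map_smul, TensorProduct.dualDistrib_apply, box_lof_tprod S χ s,
    box_lof_tprod S χ' t, ← Finset.prod_mul_distrib, smul_eq_mul, koszulSign_eq]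
  by_cases h : (∀ j, (s j).2 = d j) ∧ ∀ j, (t j).2 = d' j
  · rw [funext h.1, funext h.2]
  · have : ∃ j, (s j).2 ≠ d j ∨ (t j).2 ≠ d' j := by
      by_contra! h'
      exact h ⟨fun j ↦ (h' j).1, fun j ↦ (h' j).2⟩
    obtain ⟨j, hj⟩ := this
    rw [Finset.prod_eq_zero (Finset.mem_univ j), mul_zero, mul_zero]
    rcases hj with hj | hj
    · rw [mem_dualHomogeneous.1 (hχ j) _ hj, zero_mul]
    · rw [mem_dualHomogeneous.1 (hχ' j) _ hj, mul_zero]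

theorem dualDistrib_box_koszulShuffle {d d' : Fin m → ℕ} {χ χ' : ∀ j, Module.Dual k (S j).Total}
    (hχ : ∀ j, χ j ∈ dualHomogeneous k (fun p ↦ (S j).part p) Prod.snd (d j))
    (hχ' : ∀ j, χ' j ∈ dualHomogeneous k (fun p ↦ (S j).part p) Prod.snd (d' j))
    (z : ∀ j, (S j).Total ⊗[k] (S j).Total) :
    TensorProduct.dualDistrib k _ _ (box S χ ⊗ₜ box S χ')
      (koszulShuffle S (PiTensorProduct.tprod k z)) =
      shuffleSign d d' * ∏ j, TensorProduct.dualDistrib k _ _ (χ j ⊗ₜ χ' j) (z j) := by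
  suffices h : (TensorProduct.dualDistrib k _ _ (box S χ ⊗ₜ box S χ') ∘ₗ
      koszulShuffle S).compMultilinearMap (PiTensorProduct.tprod k) =
      (shuffleSign d d' : k) • (PiTensorProduct.dualDistrib (PiTensorProduct.tprod k
        fun j ↦ TensorProduct.dualDistrib k _ _ (χ j ⊗ₜ χ' j))).compMultilinearMap
          (PiTensorProduct.tprod k) by
    have := MultilinearMap.congr_fun h z
    simpa [PiTensorProduct.dualDistrib_apply] using this
  -- Both sides are multilinear in `z`, which reduces the claim to tensors of homogeneous basis
  -- vectors.
  refine Module.Basis.ext_multilinear (fun j ↦ (totalBasis S j).tensorProduct (totalBasis S j))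
    fun v ↦ ?_
  simp only [LinearMap.compMultilinearMap_apply, LinearMap.comp_apply,
    Module.Basis.tensorProduct_apply', directSumBasis_apply, _root_.smul_apply,
    PiTensorProduct.dualDistrib_apply, TensorProduct.dualDistrib_apply, smul_eq_mul]
  exact dualDistrib_box_koszulShuffle_lof S hχ hχ' (fun j ↦ (v j).1.1) (fun j ↦ (v j).2.1)
    (fun j ↦ Module.Basis.ofVectorSpace k _ (v j).1.2)
    fun j ↦ Module.Basis.ofVectorSpace k _ (v j).2.2

variable {δV : ∀ j, (⨁ n, V j n) →ₗ[k] (⨁ n, V j n) ⊗[k] (⨁ n, V j n)}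
  {δW : ∀ j, (⨁ n, W j n) →ₗ[k] (⨁ n, W j n) ⊗[k] (⨁ n, W j n)}

variable (δV δW) in
-- This reduces each law on the full tensor product to the law on the factors and an identity
-- between signs.
theorem convolution_box {d d' : Fin m → ℕ} {χ χ' : ∀ j, Module.Dual k (S j).Total}
    (hχ : ∀ j, χ j ∈ dualHomogeneous k (fun p ↦ (S j).part p) Prod.snd (d j))
    (hχ' : ∀ j, χ' j ∈ dualHomogeneous k (fun p ↦ (S j).part p) Prod.snd (d' j)) :
    convolution (TotalTensor.comul S δV δW) (box S χ) (box S χ') =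
      (shuffleSign d d' : k) •
        box S fun j ↦ convolution ((S j).comul (δV j) (δW j)) (χ j) (χ' j) := by
  refine totalTensor_hom_ext fun s x ↦ ?_
  rw [convolution_apply, TotalTensor.comul, toModule_lof, LinearMap.comp_apply,
    PiTensorProduct.map_tprod, dualDistrib_box_koszulShuffle S hχ hχ', LinearMap.smul_apply,
    box_lof_tprod]
  rfl

/-- The functionals of degree `n` on the full tensor product which are tensor products of homogeneous
functionals on the factors. -/
def boxes (n : ℕ) : Set (Module.Dual k (TotalTensor S)) :=
  {φ | ∃ (d : Fin m → ℕ) (χ : ∀ j, Module.Dual k (S j).Total), ∑ j, d j = n ∧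
    (∀ j, χ j ∈ dualHomogeneous k (fun p ↦ (S j).part p) Prod.snd (d j)) ∧ φ = box S χ}

theorem box_mem_boxes {d : Fin m → ℕ} {χ : ∀ j, Module.Dual k (S j).Total}
    (hχ : ∀ j, χ j ∈ dualHomogeneous k (fun p ↦ (S j).part p) Prod.snd (d j)) :
    box S χ ∈ boxes S (∑ j, d j) :=
  ⟨d, χ, rfl, hχ, rfl⟩

variable {S} in
-- Only products of homogeneous functionals are treated; this is enough since the coordinates of
-- `tensorBasis` are of this form.
theorem isDualAlgebra_boxes {e : ∀ j, Module.Dual k (S j).Total}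
    (h : ∀ j, IsDualAlgebra Prod.snd (fun n ↦ dualHomogeneous k (fun p ↦ (S j).part p) Prod.snd n)
      ((S j).comul (δV j) (δW j)) (e j)) :
    IsDualAlgebra MultiIndex.degree (boxes S) (TotalTensor.comul S δV δW) (box S e) where
  degree := by
    rintro _ _ ⟨d, χ, rfl, hχ, rfl⟩
    exact box_mem_dualHomogeneous hχ
  mul_mem := by
    rintro _ _ _ ⟨d, χ, rfl, hχ, rfl⟩ _ ⟨d', χ', rfl, hχ', rfl⟩
    rw [convolution_box S δV δW hχ hχ', ← Finset.sum_add_distrib]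
    exact Submodule.smul_mem _ _
      (box_mem_dualHomogeneous fun j ↦ (h j).mul_mem _ _ _ (hχ j) _ (hχ' j))
  assoc := by
    rintro _ _ _ _ ⟨d, χ, rfl, hχ, rfl⟩ _ ⟨d', χ', rfl, hχ', rfl⟩ _ ⟨d'', χ'', rfl, hχ'', rfl⟩
    rw [convolution_box S δV δW hχ hχ', convolution_box S δV δW hχ' hχ'', map_smul, map_smul,
      LinearMap.smul_apply,
      convolution_box S δV δW (d := d + d') (fun j ↦ (h j).mul_mem _ _ _ (hχ j) _ (hχ' j)) hχ'',
      convolution_box S δV δW (d' := d' + d'') hχ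
        (fun j ↦ (h j).mul_mem _ _ _ (hχ' j) _ (hχ'' j)), smul_smul, smul_smul, shuffleSign_assoc]
    congr 2
    exact funext fun j ↦ (h j).assoc _ _ _ _ (hχ j) _ (hχ' j) _ (hχ'' j)
  comm := by
    rintro _ _ _ ⟨d, χ, rfl, hχ, rfl⟩ _ ⟨d', χ', rfl, hχ', rfl⟩
    -- Commuting each factor produces the signs `(-1) ^ (d j * d' j)`, which are pulled out of `box`
    -- and absorbed by `shuffleSign_comm`.
    rw [convolution_box S δV δW hχ hχ', convolution_box S δV δW hχ' hχ, smul_smul,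
      ← shuffleSign_comm, mul_smul, ← box_smul_family]
    congr 2
    exact funext fun j ↦ (h j).comm _ _ _ (hχ j) _ (hχ' j)
  unit_mem := by
    simpa using box_mem_dualHomogeneous (d := 0) fun j ↦ (h j).unit_mem
  one_mul := by
    rintro _ _ ⟨d, χ, rfl, hχ, rfl⟩
    rw [convolution_box S δV δW (d := 0) (fun j ↦ (h j).unit_mem) hχ, shuffleSign_zero_left, one_smul]
    congr 1
    exact funext fun j ↦ (h j).one_mul _ _ (hχ j)
  mul_one := by
    rintro _ _ ⟨d, χ, rfl, hχ, rfl⟩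
    rw [convolution_box S δV δW (d' := 0) hχ (fun j ↦ (h j).unit_mem), shuffleSign_zero_right,
      one_smul]
    congr 1
    exact funext fun j ↦ (h j).mul_one _ _ (hχ j)

/-- A basis of a multihomogeneous piece. -/
def pieceBasis (s : MultiIndex m) : Module.Basis
    (∀ j, Module.Basis.ofVectorSpaceIndex k ((S j).part (s j))) k (Piece S s) :=
  Basis.piTensorProduct fun j ↦ Module.Basis.ofVectorSpace k ((S j).part (s j))

theorem pieceBasis_coord_tprod (s : MultiIndex m)
    (i : ∀ j, Module.Basis.ofVectorSpaceIndex k ((S j).part (s j))) (x : ∀ j, (S j).part (s j)) :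
    (pieceBasis S s).coord i (PiTensorProduct.tprod k x) =
      ∏ j, (Module.Basis.ofVectorSpace k ((S j).part (s j))).coord (i j) (x j) :=
  Basis.piTensorProduct_repr_tprod_apply _ x i

/-- A basis of the full tensor product whose coordinates are tensor products of functionals. -/
def tensorBasis : Module.Basis
    (Σ s : MultiIndex m, ∀ j, Module.Basis.ofVectorSpaceIndex k ((S j).part (s j))) k
    (TotalTensor S) :=
  directSumBasis (V := fun s : MultiIndex m ↦ Piece S s) fun s ↦ pieceBasis S s

theorem tensorBasis_coord_lof (s : MultiIndex m)
    (i : ∀ j, Module.Basis.ofVectorSpaceIndex k ((S j).part (s j))) (x : Piece S s) :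
    (tensorBasis S).coord ⟨s, i⟩ (lof k (MultiIndex m) (fun s ↦ Piece S s) s x) =
      (pieceBasis S s).coord i x :=
  directSumBasis_coord_lof (fun s ↦ pieceBasis S s) s i x

theorem tensorBasis_coord_lof_of_ne {t : MultiIndex m}
    (p : Σ s : MultiIndex m, ∀ j, Module.Basis.ofVectorSpaceIndex k ((S j).part (s j)))
    (h : t ≠ p.1) (x : Piece S t) :
    (tensorBasis S).coord p (lof k (MultiIndex m) (fun s ↦ Piece S s) t x) = 0 :=
  directSumBasis_coord_lof_of_ne (fun s ↦ pieceBasis S s) p h x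

/-- Thus the coordinates of a basis are among the functionals `boxes`, as the duality argument
demands. -/
theorem tensorBasis_coord
    (p : Σ s : MultiIndex m, ∀ j, Module.Basis.ofVectorSpaceIndex k ((S j).part (s j))) :
    (tensorBasis S).coord p = box S fun j ↦ (totalBasis S j).coord ⟨p.1 j, p.2 j⟩ := by
  obtain ⟨s, i⟩ := p
  refine totalTensor_hom_ext fun t x ↦ ?_
  rw [box_lof_tprod]
  by_cases h : t = s
  · subst h
    rw [tensorBasis_coord_lof, pieceBasis_coord_tprod]
    refine Finset.prod_congr rfl fun j _ ↦ ?_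
    rw [directSumBasis_coord, LinearMap.comp_apply, component.lof_self]
  · rw [tensorBasis_coord_lof_of_ne _ _ h]
    obtain ⟨j, hj⟩ := Function.ne_iff.1 h
    refine (Finset.prod_eq_zero (Finset.mem_univ j) ?_).symm
    rw [directSumBasis_coord, LinearMap.comp_apply, component_lof_of_ne hj, map_zero]

/-- The basis of `T_*` consisting of members of `tensorBasis`. -/
def TBasis : Module.Basis
    (Σ s : AdmissibleIndex f K, ∀ j, Module.Basis.ofVectorSpaceIndex k ((S j).part (s.1 j))) k
    (T S K) :=
  directSumBasis (V := fun s : AdmissibleIndex f K ↦ Piece S s.1) fun s ↦ pieceBasis S s.1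

theorem incl_lof (s : AdmissibleIndex f K) (x : Piece S s.1) :
    T.incl S K (lof k (AdmissibleIndex f K) (fun s ↦ Piece S s.1) s x) =
      lof k (MultiIndex m) (fun s ↦ Piece S s) s.1 x := by
  rw [T.incl, toModule_lof]

theorem TBasis_coord_lof (s : AdmissibleIndex f K)
    (i : ∀ j, Module.Basis.ofVectorSpaceIndex k ((S j).part (s.1 j))) (x : Piece S s.1) :
    (TBasis S K).coord ⟨s, i⟩ (lof k (AdmissibleIndex f K) (fun s ↦ Piece S s.1) s x) =
      (pieceBasis S s.1).coord i x :=
  directSumBasis_coord_lof (fun s : AdmissibleIndex f K ↦ pieceBasis S s.1) s i x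

theorem TBasis_coord_lof_of_ne {t : AdmissibleIndex f K}
    (p : Σ s : AdmissibleIndex f K, ∀ j, Module.Basis.ofVectorSpaceIndex k ((S j).part (s.1 j)))
    (h : t ≠ p.1) (x : Piece S t.1) :
    (TBasis S K).coord p (lof k (AdmissibleIndex f K) (fun s ↦ Piece S s.1) t x) = 0 :=
  directSumBasis_coord_lof_of_ne (fun s : AdmissibleIndex f K ↦ pieceBasis S s.1) p h x

theorem TBasis_coord
    (p : Σ s : AdmissibleIndex f K, ∀ j, Module.Basis.ofVectorSpaceIndex k ((S j).part (s.1 j))) :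
    (TBasis S K).coord p = (tensorBasis S).coord ⟨p.1.1, p.2⟩ ∘ₗ T.incl S K := by
  obtain ⟨s, i⟩ := p
  refine T_hom_ext fun t x ↦ ?_
  rw [LinearMap.comp_apply, incl_lof]
  by_cases h : t = s
  · subst h
    rw [TBasis_coord_lof, tensorBasis_coord_lof]
  · rw [TBasis_coord_lof_of_ne S K _ h,
      tensorBasis_coord_lof_of_ne S _ fun e ↦ h (Subtype.ext e)]

/-- Projecting to `T_*` and including again discards only inadmissible pieces, which an admissible
coordinate does not see. -/
theorem tensorBasis_coord_comp_incl_comp_proj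
    (p : Σ s : MultiIndex m, ∀ j, Module.Basis.ofVectorSpaceIndex k ((S j).part (s j)))
    (hp : (p.1.sigma, p.1.omega) ∈ indexSet f K) :
    (tensorBasis S).coord p ∘ₗ T.incl S K ∘ₗ T.proj S K = (tensorBasis S).coord p := by
  refine totalTensor_hom_ext fun t x ↦ ?_
  simp only [LinearMap.comp_apply, T.proj, toModule_lof]
  split_ifs with h
  · rw [incl_lof]
  · rw [LinearMap.zero_apply, map_zero, map_zero, tensorBasis_coord_lof_of_ne]
    rintro rfl
    exact h hp

theorem tensorBasis_coord_comp_incl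
    (p : Σ s : MultiIndex m, ∀ j, Module.Basis.ofVectorSpaceIndex k ((S j).part (s j)))
    (hp : (p.1.sigma, p.1.omega) ∉ indexSet f K) :
    (tensorBasis S).coord p ∘ₗ T.incl S K = 0 := by
  refine T_hom_ext fun t x ↦ ?_
  rw [LinearMap.comp_apply, incl_lof, tensorBasis_coord_lof_of_ne, LinearMap.zero_apply]
  intro h
  exact hp (h ▸ t.2)

/-! ### `T_*` as a subcoalgebra of the full tensor product. -/

variable {K} in
-- Every condition on `(σ, ω)` is inherited by smaller sets; for `σ ∈ K` this is the defining
-- property of a simplicial complex.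
theorem indexSet_mono {s u : MultiIndex m} (hu : (u.sigma, u.omega) ∈ indexSet f K)
    (hσ : ∀ j, (s j).1 = Label.coker → (u j).1 = Label.coker)
    (hω : ∀ j, (s j).1 = Label.ker → (u j).1 = Label.ker) :
    (s.sigma, s.omega) ∈ indexSet f K := by
  have h1 : s.sigma ⊆ u.sigma := fun j ↦ by simpa [MultiIndex.sigma] using hσ j
  have h2 : s.omega ⊆ u.omega := fun j ↦ by simpa [MultiIndex.omega] using hω j
  exact ⟨K.lower h1 hu.1, fun j hj ↦ hu.2.1 j (h1 hj), fun j hj ↦ hu.2.2.1 j (h2 hj),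
    hu.2.2.2.mono h1 h2⟩

variable {S} in
-- A coproduct creates the labels `𝔠` and `𝔨` only from themselves, so both tensor factors of a term
-- in the coproduct of an admissible piece have smaller `σ` and `ω` and are admissible.
theorem convolution_coord_comp_incl (hS : ∀ j, (S j).IsCoalgebraSplitting (δV j) (δW j))
    (p q : Σ s : MultiIndex m, ∀ j, Module.Basis.ofVectorSpaceIndex k ((S j).part (s j)))
    (hpq : (p.1.sigma, p.1.omega) ∉ indexSet f K ∨ (q.1.sigma, q.1.omega) ∉ indexSet f K) :
    convolution (TotalTensor.comul S δV δW) ((tensorBasis S).coord p) ((tensorBasis S).coord q) ∘ₗ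
      T.incl S K = 0 := by
  refine T_hom_ext fun u x ↦ ?_
  rw [LinearMap.comp_apply, incl_lof, tensorBasis_coord, tensorBasis_coord,
    convolution_box S δV δW (fun j ↦ totalBasis_coord_mem S j _)
      (fun j ↦ totalBasis_coord_mem S j _), LinearMap.smul_apply, box_lof_tprod,
    LinearMap.zero_apply, smul_eq_mul]
  refine mul_eq_zero_of_right _ ?_
  by_contra hne
  rw [← ne_eq, Finset.prod_ne_zero_iff] at hne
  -- To be used with `r` the multi-index of `p` or of `q`. Were a label `𝔠` or `𝔨` of `r` absent
  -- from `u` at the place `j`, the `j`-th factor of the nonzero product would vanish.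
  have key : ∀ r : MultiIndex m,
      (∀ j, (S j).IsSupported ((totalBasis S j).coord ⟨p.1 j, p.2 j⟩) (r j).1 ∨
        (S j).IsSupported ((totalBasis S j).coord ⟨q.1 j, q.2 j⟩) (r j).1) →
      (r.sigma, r.omega) ∈ indexSet f K := by
    intro r hr
    refine indexSet_mono u.2 (fun j hj ↦ ?_) fun j hj ↦ ?_
    · by_contra hu
      have := hr j
      rw [hj] at this
      exact hne j (Finset.mem_univ j)
        ((S j).convolution_eq_zero_of_coker (δV j) (δW j) this _ hu (x j))
    · by_contra hu
      have := hr j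
      rw [hj] at this
      exact hne j (Finset.mem_univ j) ((hS j).convolution_eq_zero_of_ker this _ hu (x j))
  rcases hpq with h | h
  · exact h (key _ fun j ↦ Or.inl (totalBasis_coord_isSupported S j _))
  · exact h (key _ fun j ↦ Or.inr (totalBasis_coord_isSupported S j _))

variable {S} in
/-- `T_*` is a subcoalgebra of the full tensor product. -/
theorem map_incl_comp_comul (hS : ∀ j, (S j).IsCoalgebraSplitting (δV j) (δW j)) :
    TensorProduct.map (T.incl S K) (T.incl S K) ∘ₗ T.comul S K δV δW =
      TotalTensor.comul S δV δW ∘ₗ T.incl S K := by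
  refine LinearMap.ext fun x ↦ ((tensorBasis S).tensorProduct (tensorBasis S)).ext_elem fun p ↦ ?_
  simp only [← Module.Basis.coord_apply]
  obtain ⟨p, q⟩ := p
  rw [← dualDistrib_coord]
  have h : ∀ z, TensorProduct.dualDistrib k _ _ ((tensorBasis S).coord p ⊗ₜ (tensorBasis S).coord q)
      (TensorProduct.map (T.incl S K) (T.incl S K)
        (TensorProduct.map (T.proj S K) (T.proj S K) z)) =
      TensorProduct.dualDistrib k _ _
        (((tensorBasis S).coord p ∘ₗ T.incl S K ∘ₗ T.proj S K) ⊗ₜ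
          ((tensorBasis S).coord q ∘ₗ T.incl S K ∘ₗ T.proj S K)) z := by
    intro z
    induction z with
    | zero => simp
    | tmul x y => simp
    | add x y hx hy => simp only [map_add, hx, hy]
  simp only [LinearMap.comp_apply, T.comul]
  rw [h]
  -- If both coordinates are admissible, the projection in `T.comul` is invisible to them. Otherwise
  -- the left side vanishes because one coordinate is zero on `T_*`, and the right side by
  -- `convolution_coord_comp_incl`.
  by_cases hp : (p.1.sigma, p.1.omega) ∈ indexSet f K
  · by_cases hq : (q.1.sigma, q.1.omega) ∈ indexSet f K
    · rw [tensorBasis_coord_comp_incl_comp_proj S K p hp,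
        tensorBasis_coord_comp_incl_comp_proj S K q hq]
    · rw [← LinearMap.comp_assoc _ _ ((tensorBasis S).coord q), tensorBasis_coord_comp_incl S K q hq]
      simp only [LinearMap.zero_comp, TensorProduct.tmul_zero, map_zero, LinearMap.zero_apply]
      exact (LinearMap.congr_fun (convolution_coord_comp_incl K hS p q (Or.inr hq)) x).symm
  · rw [← LinearMap.comp_assoc _ _ ((tensorBasis S).coord p), tensorBasis_coord_comp_incl S K p hp]
    simp only [LinearMap.zero_comp, TensorProduct.zero_tmul, map_zero, LinearMap.zero_apply]
    exact (LinearMap.congr_fun (convolution_coord_comp_incl K hS p q (Or.inl hp)) x).symm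

/-- The restrictions to `T_*` of the tensor products of homogeneous functionals. -/
def TBoxes (n : ℕ) : Set (Module.Dual k (T S K)) :=
  (fun φ ↦ φ ∘ₗ T.incl S K) '' boxes S n

variable {S K} in
theorem comp_incl_mem_dualHomogeneous {n : ℕ} {φ : Module.Dual k (TotalTensor S)}
    (hφ : φ ∈ dualHomogeneous k (fun s ↦ Piece S s) MultiIndex.degree n) :
    φ ∘ₗ T.incl S K ∈ dualHomogeneous k (fun s : AdmissibleIndex f K ↦ Piece S s.1)
      AdmissibleIndex.degree n := by
  rw [mem_dualHomogeneous] at hφ ⊢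
  intro s hs x
  rw [LinearMap.comp_apply, incl_lof]
  exact hφ s.1 hs x

variable {S} in
-- Since `T_*` is a subcoalgebra, restriction of functionals to it is multiplicative, and each law
-- is the restriction of the one for `boxes`.
theorem isDualAlgebra_TBoxes (hS : ∀ j, (S j).IsCoalgebraSplitting (δV j) (δW j))
    {e : ∀ j, Module.Dual k (S j).Total}
    (h : ∀ j, IsDualAlgebra Prod.snd (fun n ↦ dualHomogeneous k (fun p ↦ (S j).part p) Prod.snd n)
      ((S j).comul (δV j) (δW j)) (e j)) :
    IsDualAlgebra AdmissibleIndex.degree (TBoxes S K) (T.comul S K δV δW)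
      (box S e ∘ₗ T.incl S K) := by
  have H := isDualAlgebra_boxes h
  have hc := fun φ ψ ↦ (convolution_comp (map_incl_comp_comul K hS).symm φ ψ).symm
  constructor
  · rintro p _ ⟨φ, hφ, rfl⟩
    exact comp_incl_mem_dualHomogeneous (H.degree p φ hφ)
  · rintro p q _ ⟨φ, hφ, rfl⟩ _ ⟨ψ, hψ, rfl⟩
    dsimp only
    rw [hc]
    exact comp_incl_mem_dualHomogeneous (H.mul_mem p q φ hφ ψ hψ)
  · rintro p q r _ ⟨φ, hφ, rfl⟩ _ ⟨ψ, hψ, rfl⟩ _ ⟨χ, hχ, rfl⟩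
    dsimp only
    rw [hc, hc, hc, hc, H.assoc p q r φ hφ ψ hψ χ hχ]
  · rintro p q _ ⟨φ, hφ, rfl⟩ _ ⟨ψ, hψ, rfl⟩
    dsimp only
    rw [hc, hc, H.comm p q φ hφ ψ hψ, LinearMap.smul_comp]
  · exact comp_incl_mem_dualHomogeneous H.unit_mem
  · rintro p _ ⟨φ, hφ, rfl⟩
    dsimp only
    rw [hc, H.one_mul p φ hφ]
  · rintro p _ ⟨φ, hφ, rfl⟩
    dsimp only
    rw [hc, H.mul_one p φ hφ]

theorem TBasis_mem_homogeneous
    (p : Σ s : AdmissibleIndex f K, ∀ j, Module.Basis.ofVectorSpaceIndex k ((S j).part (s.1 j))) :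
    TBasis S K p ∈ homogeneous k (fun s : AdmissibleIndex f K ↦ Piece S s.1)
      AdmissibleIndex.degree p.1.degree := by
  rw [TBasis, directSumBasis_apply]
  exact lof_mem_homogeneous (V := fun s : AdmissibleIndex f K ↦ Piece S s.1) p.1 _

theorem TBasis_coord_mem
    (p : Σ s : AdmissibleIndex f K, ∀ j, Module.Basis.ofVectorSpaceIndex k ((S j).part (s.1 j))) :
    (TBasis S K).coord p ∈ TBoxes S K p.1.degree := by
  rw [TBasis_coord, tensorBasis_coord]
  exact Set.mem_image_of_mem _ (box_mem_boxes S fun j ↦ totalBasis_coord_mem S j ⟨p.1.1 j, p.2 j⟩)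

/-! ### The dual `T^*` and its closure under products. -/

/-- The tensor product of functionals on the factors of one multihomogeneous piece. -/
def pieceDual (s : AdmissibleIndex f K) (χ : ∀ j, Module.Dual k ((S j).part (s.1 j))) :
    Module.Dual k (T S K) :=
  PiTensorProduct.dualDistrib (PiTensorProduct.tprod k χ) ∘ₗ
    component k _ (fun s : AdmissibleIndex f K ↦ Piece S s.1) s

theorem pieceDual_mem_dual (s : AdmissibleIndex f K)
    (χ : ∀ j, Module.Dual k ((S j).part (s.1 j))) : pieceDual S K s χ ∈ T.dual S K :=
  Submodule.subset_span ⟨s, χ, rfl⟩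

theorem pieceDual_lof (s : AdmissibleIndex f K) (χ : ∀ j, Module.Dual k ((S j).part (s.1 j)))
    (x : ∀ j, (S j).part (s.1 j)) :
    pieceDual S K s χ (lof k (AdmissibleIndex f K) (fun s ↦ Piece S s.1) s
      (PiTensorProduct.tprod k x)) = ∏ j, χ j (x j) := by
  rw [pieceDual, LinearMap.comp_apply, component.lof_self, PiTensorProduct.dualDistrib_apply]

theorem pieceDual_lof_of_ne {s t : AdmissibleIndex f K} (h : t ≠ s)
    (χ : ∀ j, Module.Dual k ((S j).part (s.1 j))) (x : Piece S t.1) :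
    pieceDual S K s χ (lof k (AdmissibleIndex f K) (fun s ↦ Piece S s.1) t x) = 0 := by
  rw [pieceDual, LinearMap.comp_apply, component_lof_of_ne h, map_zero]

/-- Finiteness of the set of labels makes the sum in `box_comp_incl_eq_sum` finite. -/
instance : Fintype Label := ⟨{.ker, .im, .coker}, by rintro (_ | _ | _) <;> simp⟩

open Classical in
variable {S} in
-- Homogeneity fixes the degree in each factor and leaves only the labels free, so such a functional
-- meets finitely many pieces. This places it in `T^*` rather than merely in the full dual.
theorem box_comp_incl_eq_sum {d : Fin m → ℕ} {χ : ∀ j, Module.Dual k (S j).Total}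
    (hχ : ∀ j, χ j ∈ dualHomogeneous k (fun p ↦ (S j).part p) Prod.snd (d j)) :
    box S χ ∘ₗ T.incl S K = ∑ l : Fin m → Label,
      if h : (MultiIndex.sigma (fun j ↦ (l j, d j)), MultiIndex.omega (fun j ↦ (l j, d j))) ∈
        indexSet f K then
        pieceDual S K ⟨fun j ↦ (l j, d j), h⟩
          fun j ↦ χ j ∘ₗ lof k _ (fun p ↦ (S j).part p) (l j, d j)
      else 0 := by
  refine T_hom_ext fun s x ↦ ?_
  rw [LinearMap.comp_apply, incl_lof, box_lof_tprod, LinearMap.sum_apply]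
  by_cases hd : ∀ j, (s.1 j).2 = d j
  · obtain rfl : (fun j ↦ (s.1 j).2) = d := funext hd
    rw [Finset.sum_eq_single fun j ↦ (s.1 j).1]
    · have h : ((MultiIndex.sigma fun j ↦ ((s.1 j).1, (s.1 j).2)),
          MultiIndex.omega fun j ↦ ((s.1 j).1, (s.1 j).2)) ∈ indexSet f K := s.2
      rw [dif_pos h]
      exact (pieceDual_lof S K s (fun j ↦ χ j ∘ₗ lof k _ (fun p ↦ (S j).part p) (s.1 j)) x).symm
    · intro l _ hl
      split_ifs with h
      · exact pieceDual_lof_of_ne S K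
          (fun e ↦ hl (funext fun j ↦ (congrArg (fun s ↦ (s.1 j).1) e).symm)) _ _
      · rfl
    · exact fun h ↦ absurd (Finset.mem_univ _) h
  · push Not at hd
    obtain ⟨j, hj⟩ := hd
    rw [Finset.prod_eq_zero (Finset.mem_univ j) (mem_dualHomogeneous.1 (hχ j) _ hj _)]
    refine (Finset.sum_eq_zero fun l _ ↦ ?_).symm
    split_ifs with h
    · exact pieceDual_lof_of_ne S K (fun e ↦ hj (congrArg (fun s ↦ (s.1 j).2) e)) _ _
    · rfl

variable {S} in
theorem box_comp_incl_mem_dual {d : Fin m → ℕ} {χ : ∀ j, Module.Dual k (S j).Total}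
    (hχ : ∀ j, χ j ∈ dualHomogeneous k (fun p ↦ (S j).part p) Prod.snd (d j)) :
    box S χ ∘ₗ T.incl S K ∈ T.dual S K := by
  classical
  rw [box_comp_incl_eq_sum K hχ]
  refine Submodule.sum_mem _ fun l _ ↦ ?_
  split_ifs with h
  · exact pieceDual_mem_dual S K _ _
  · exact Submodule.zero_mem _

theorem pieceDual_mem_TBoxes (s : AdmissibleIndex f K)
    (χ : ∀ j, Module.Dual k ((S j).part (s.1 j))) : pieceDual S K s χ ∈ TBoxes S K s.degree := by
  -- Each functional is extended by zero from its summand to the whole factor.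
  refine ⟨box S fun j ↦ χ j ∘ₗ component k _ (fun p ↦ (S j).part p) (s.1 j),
    ⟨fun j ↦ (s.1 j).2, _, rfl, fun j ↦ ?_, rfl⟩, ?_⟩
  · rw [mem_dualHomogeneous]
    intro p hp x
    rw [LinearMap.comp_apply, component_lof_of_ne (fun h ↦ hp (congrArg Prod.snd h)), map_zero]
  · refine T_hom_ext fun t x ↦ ?_
    dsimp only
    rw [LinearMap.comp_apply, incl_lof, box_lof_tprod]
    by_cases h : t = s
    · subst h
      rw [pieceDual_lof]
      exact Finset.prod_congr rfl fun j _ ↦ by rw [LinearMap.comp_apply, component.lof_self]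
    · rw [pieceDual_lof_of_ne S K h]
      obtain ⟨j, hj⟩ := Function.ne_iff.1 (fun e ↦ h (Subtype.ext e))
      refine Finset.prod_eq_zero (Finset.mem_univ j) ?_
      rw [LinearMap.comp_apply, component_lof_of_ne hj, map_zero]

/-- With this spanning set, closure of `T^*` under products is a matter of `convolution_box`. -/
theorem dual_eq_span : T.dual S K = Submodule.span k (⋃ n, TBoxes S K n) := by
  refine le_antisymm (Submodule.span_le.2 ?_) (Submodule.span_le.2 ?_)
  · rintro _ ⟨s, χ, rfl⟩
    exact Submodule.subset_span (Set.mem_iUnion.2 ⟨s.degree, pieceDual_mem_TBoxes S K s χ⟩)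
  · refine Set.iUnion_subset fun n ↦ ?_
    rintro _ ⟨_, ⟨d, χ, _, hχ, rfl⟩, rfl⟩
    exact box_comp_incl_mem_dual K hχ

variable {S} in
theorem convolution_mem_dual (hS : ∀ j, (S j).IsCoalgebraSplitting (δV j) (δW j))
    {e : ∀ j, Module.Dual k (S j).Total}
    (h : ∀ j, IsDualAlgebra Prod.snd (fun n ↦ dualHomogeneous k (fun p ↦ (S j).part p) Prod.snd n)
      ((S j).comul (δV j) (δW j)) (e j)) (φ : Module.Dual k (T S K)) (hφ : φ ∈ T.dual S K)
    (ψ : Module.Dual k (T S K)) (hψ : ψ ∈ T.dual S K) :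
    convolution (T.comul S K δV δW) φ ψ ∈ T.dual S K := by
  rw [dual_eq_span] at hφ hψ
  have := Submodule.apply_mem_map₂ (convolution (T.comul S K δV δW)) hφ hψ
  rw [Submodule.map₂_span_span] at this
  refine Submodule.span_le.2 ?_ this
  rintro _ ⟨a, ha, b, hb, rfl⟩
  obtain ⟨_, _, ⟨d, χ, rfl, hχ, rfl⟩, rfl⟩ := Set.mem_iUnion.1 ha
  obtain ⟨_, _, ⟨d', χ', rfl, hχ', rfl⟩, rfl⟩ := Set.mem_iUnion.1 hb
  dsimp only
  rw [← convolution_comp (map_incl_comp_comul K hS).symm, convolution_box S δV δW hχ hχ',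
    LinearMap.smul_comp]
  exact Submodule.smul_mem _ _
    (box_comp_incl_mem_dual K fun j ↦ (h j).mul_mem _ _ _ (hχ j) _ (hχ' j))

variable {S} in
/-- The coalgebra `T_*` and its dual algebras, for factors with graded commutative dual algebras. -/
theorem comul_properties (hS : ∀ j, (S j).IsCoalgebraSplitting (δV j) (δW j))
    {e : ∀ j, Module.Dual k (S j).Total}
    (h : ∀ j, IsDualAlgebra Prod.snd (fun n ↦ dualHomogeneous k (fun p ↦ (S j).part p) Prod.snd n)
      ((S j).comul (δV j) (δW j)) (e j)) :
    IsGradedCocommutativeCoalgebra AdmissibleIndex.degree (T.comul S K δV δW) ∧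
      IsGradedCommutativeAlgebra AdmissibleIndex.degree (T.dual S K)
        (convolution (T.comul S K δV δW)) ∧
      IsGradedCommutativeAlgebra AdmissibleIndex.degree ⊤ (convolution (T.comul S K δV δW)) := by
  have H := isDualAlgebra_TBoxes K hS h
  have hco := H.isGradedCocommutativeCoalgebra (TBasis S K) (fun p ↦ p.1.degree)
    (TBasis_mem_homogeneous S K) (TBasis_coord_mem S K)
  have h1 := H.unit_convolution (TBasis S K) (fun p ↦ p.1.degree) (TBasis_coord_mem S K)
  have h2 := H.convolution_unit (TBasis S K) (fun p ↦ p.1.degree) (TBasis_coord_mem S K)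
  exact ⟨hco,
    hco.isGradedCommutativeAlgebra _ (convolution_mem_dual K hS h)
      (box_comp_incl_mem_dual K fun j ↦ (h j).unit_mem) H.unit_mem (fun φ _ ↦ h1 φ)
      fun φ _ ↦ h2 φ,
    hco.isGradedCommutativeAlgebra _ (fun _ _ _ _ ↦ Submodule.mem_top) Submodule.mem_top
      H.unit_mem (fun φ _ ↦ h1 φ) fun φ _ ↦ h2 φ⟩

end Box

/-! ### Cochains and the Alexander–Whitney cup product. -/

section Cochains

variable {k : Type u} [Field k] {X : SSet.{u}}

theorem chain_hom_ext {N : Type u} [AddCommGroup N] [Module k N] {n : ℕ}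
    {g h : (chains k X).X n →ₗ[k] N} (H : ∀ x, g (simplexChain k x) = h (simplexChain k x)) :
    g = h := by
  have : (ModuleCat.ofHom g : (chains k X).X n ⟶ ModuleCat.of k N) = ModuleCat.ofHom h :=
    SSet.chainComplex_hom_ext fun x ↦ by
      ext
      exact H x
  exact congrArg ModuleCat.Hom.hom this

/-- The linear extension of a function on simplices. -/
def evalChain {n : ℕ} (α : X _⦋n⦌ → k) : (chains k X).X n →ₗ[k] k :=
  (Limits.Sigma.desc fun x : X _⦋n⦌ ↦ ModuleCat.ofHom (LinearMap.toSpanSingleton k k (α x)) :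
    (chains k X).X n ⟶ ModuleCat.of k k).hom

@[simp]
theorem evalChain_simplexChain {n : ℕ} (α : X _⦋n⦌ → k) (x : X _⦋n⦌) :
    evalChain α (simplexChain k x) = α x := by
  have h : X.ιChainComplex x ≫ (Limits.Sigma.desc fun x : X _⦋n⦌ ↦
      ModuleCat.ofHom (LinearMap.toSpanSingleton k k (α x)) :
        (chains k X).X n ⟶ ModuleCat.of k k) =
      ModuleCat.ofHom (LinearMap.toSpanSingleton k _ (α x)) :=
    Limits.Sigma.ι_desc _ _
  refine (congrArg (fun f ↦ f.hom (1 : k)) h).trans ?_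
  simp

theorem evalChain_apply_simplexChain {n : ℕ} (g : (chains k X).X n →ₗ[k] k) :
    evalChain (fun x ↦ g (simplexChain k x)) = g :=
  chain_hom_ext fun x ↦ evalChain_simplexChain _ x

theorem evalChain_sub {n : ℕ} (α β : X _⦋n⦌ → k) :
    evalChain (α - β) = evalChain α - evalChain β :=
  chain_hom_ext fun x ↦ by simp

theorem evalChain_smul {n : ℕ} (c : k) (α : X _⦋n⦌ → k) :
    evalChain (c • α) = c • evalChain α :=
  chain_hom_ext fun x ↦ by simp

theorem evalChain_zero {n : ℕ} : evalChain (0 : X _⦋n⦌ → k) = 0 :=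
  chain_hom_ext fun x ↦ by simp

/-- The coboundary of a simplicial cochain. -/
def coboundary {n : ℕ} (α : X _⦋n⦌ → k) (x : X _⦋n + 1⦌) : k :=
  ∑ j : Fin (n + 2), (-1) ^ (j : ℕ) * α (X.δ j x)

theorem evalChain_coboundary {n : ℕ} (α : X _⦋n⦌ → k) :
    evalChain (coboundary α) = evalChain α ∘ₗ ((chains k X).d (n + 1) n).hom :=
  chain_hom_ext fun x ↦ by
    rw [LinearMap.comp_apply, simplexChain_d, evalChain_simplexChain, map_sum]
    refine Finset.sum_congr rfl fun j _ ↦ ?_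
    rw [map_zsmul, evalChain_simplexChain]
    simp

/-- The value of a cochain on a cycle. -/
def evalCycle {n : ℕ} (α : X _⦋n⦌ → k) (z : (chains k X).cycles n) : k :=
  evalChain α (((chains k X).iCycles n).hom z)

theorem iCycles_d (n : ℕ) (z : (chains k X).cycles (n + 1)) :
    ((chains k X).d (n + 1) n).hom (((chains k X).iCycles (n + 1)).hom z) = 0 :=
  congrArg (fun f ↦ f.hom z) ((chains k X).iCycles_d (n + 1) n)

theorem evalCycle_coboundary {n : ℕ} (α : X _⦋n⦌ → k) (z : (chains k X).cycles (n + 1)) :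
    evalCycle (coboundary α) z = 0 := by
  rw [evalCycle, evalChain_coboundary, LinearMap.comp_apply, iCycles_d, map_zero]

theorem exists_cycle_of_zero (c : (chains k X).X 0) :
    ∃ z, ((chains k X).iCycles 0).hom z = c := by
  let g : ModuleCat.of k k ⟶ (chains k X).X 0 := ModuleCat.ofHom (LinearMap.toSpanSingleton k _ c)
  refine ⟨((chains k X).liftCycles g 0 (by simp) (by simp)).hom (1 : k), ?_⟩
  have := congrArg (fun f ↦ f.hom (1 : k))
    ((chains k X).liftCycles_i g 0 (by simp) (by simp))
  exact this.trans (one_smul k c)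

theorem exists_cycle_of_succ {n : ℕ} (c : (chains k X).X (n + 1))
    (hc : ((chains k X).d (n + 1) n).hom c = 0) : ∃ z, ((chains k X).iCycles (n + 1)).hom z = c := by
  let g : ModuleCat.of k k ⟶ (chains k X).X (n + 1) :=
    ModuleCat.ofHom (LinearMap.toSpanSingleton k _ c)
  have hg : g ≫ (chains k X).d (n + 1) n = 0 := by
    refine ModuleCat.hom_ext (LinearMap.ext_ring ?_)
    change ((chains k X).d (n + 1) n).hom ((1 : k) • c) = 0
    rw [one_smul, hc]
  refine ⟨((chains k X).liftCycles g n (by simp) hg).hom (1 : k), ?_⟩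
  have := congrArg (fun f ↦ f.hom (1 : k)) ((chains k X).liftCycles_i g n (by simp) hg)
  exact this.trans (one_smul k c)

/-- Every vertex is a cycle, so in degree zero there is no ambiguity by coboundaries. -/
theorem eq_zero_of_evalCycle {α : X _⦋0⦌ → k} (h : ∀ z, evalCycle α z = 0) : α = 0 := by
  ext x
  obtain ⟨z, hz⟩ := exists_cycle_of_zero (simplexChain k x)
  have := h z
  rwa [evalCycle, hz, evalChain_simplexChain] at this

/-- Over a field the range of the transpose of `d` is the annihilator of `ker d`. -/
theorem exists_coboundary_of_evalCycle {n : ℕ} {α : X _⦋n + 1⦌ → k} (h : ∀ z, evalCycle α z = 0) :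
    ∃ γ : X _⦋n⦌ → k, α = coboundary γ := by
  have hmem : evalChain α ∈ LinearMap.range ((chains k X).d (n + 1) n).hom.dualMap := by
    rw [LinearMap.range_dualMap_eq_dualAnnihilator_ker, Submodule.mem_dualAnnihilator]
    intro c hc
    obtain ⟨z, rfl⟩ := exists_cycle_of_succ c hc
    exact h z
  obtain ⟨g, hg⟩ := hmem
  refine ⟨fun x ↦ g (simplexChain k x), funext fun x ↦ ?_⟩
  rw [← evalChain_simplexChain (coboundary _) x, evalChain_coboundary,
    evalChain_apply_simplexChain, ← evalChain_simplexChain α x, ← hg]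
  rfl

/-- The Alexander–Whitney cup product of cochains. -/
def cup {p q n : ℕ} (h : p + q = n) (α : X _⦋p⦌ → k) (β : X _⦋q⦌ → k) (x : X _⦋n⦌) : k :=
  α (segment x 0 p (by omega)) * β (segment x p q (by omega))

/-- Leibniz rule: the first `p + 1` faces of `x` change the front factor only up to a shift of the
back one, the remaining `q + 1` faces change the back factor. -/
theorem coboundary_cup {p q n : ℕ} (h : p + q = n) (α : X _⦋p⦌ → k) (β : X _⦋q⦌ → k) :
    coboundary (cup h α β) = cup (show p + 1 + q = n + 1 by omega) (coboundary α) β +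
      (-1 : k) ^ p • cup (show p + (q + 1) = n + 1 by omega) α (coboundary β) := by
  ext x
  simp only [coboundary, cup, Pi.add_apply, Pi.smul_apply, smul_eq_mul]
  rw [sum_fin_split n p q h, Fin.sum_univ_castSucc (n := p + 1), Fin.sum_univ_succ (n := q + 1)]
  -- The right side has two more summands, from the last face of the front part and the zeroth face
  -- of the back part. They have equal values and signs `(-1) ^ (p + 1)` and `(-1) ^ p`, so they
  -- cancel.
  have f1 : X.δ (Fin.last (p + 1)) (segment x 0 (p + 1) (by omega)) = segment x 0 p (by omega) := by
    rw [← segment_δ x ⟨p + 1, by omega⟩ 0 p (by omega) _ (by simp),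
      segment_δ_of_lt x _ 0 p (by omega) (by simp)]
  have f2 : X.δ 0 (segment x p (q + 1) (by omega)) = segment x (p + 1) q (by omega) := by
    rw [← segment_δ x ⟨p, by omega⟩ p q (by omega) _ (by simp),
      segment_δ_of_le x _ p q (by omega) (by simp)]
  rw [f1, f2]
  have h1 : ∀ a : Fin (p + 1),
      (-1 : k) ^ (a : ℕ) * (α (segment (X.δ (⟨a, by omega⟩ : Fin (n + 2)) x) 0 p (by omega)) *
        β (segment (X.δ (⟨a, by omega⟩ : Fin (n + 2)) x) p q (by omega))) =
      (-1) ^ (a : ℕ) * α (X.δ a.castSucc (segment x 0 (p + 1) (by omega))) *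
        β (segment x (p + 1) q (by omega)) := by
    intro a
    rw [segment_δ x _ 0 p (by omega) a.castSucc (by simp),
      segment_δ_of_le x _ p q (by omega) (by simp; omega), mul_assoc]
  have h2 : ∀ b : Fin (q + 1),
      (-1 : k) ^ (p + 1 + b : ℕ) *
        (α (segment (X.δ (⟨p + 1 + b, by omega⟩ : Fin (n + 2)) x) 0 p (by omega)) *
        β (segment (X.δ (⟨p + 1 + b, by omega⟩ : Fin (n + 2)) x) p q (by omega))) =
      (-1) ^ p * α (segment x 0 p (by omega)) * ((-1) ^ (b.succ : ℕ) *
        β (X.δ b.succ (segment x p (q + 1) (by omega)))) := by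
    intro b
    rw [segment_δ x _ p q (by omega) b.succ (by simp; omega),
      segment_δ_of_lt x _ 0 p (by omega) (by simp; omega)]
    simp only [Fin.val_succ]
    ring
  rw [Finset.sum_congr rfl fun a _ ↦ h1 a, Finset.sum_congr rfl fun b _ ↦ h2 b, ← Finset.mul_sum,
    ← Finset.sum_mul]
  simp only [Fin.val_castSucc, Fin.val_last, Fin.val_zero]
  ring

theorem segment_segment {n : ℕ} (x : X _⦋n⦌) (a l b l' : ℕ) (h : a + l ≤ n) (h' : b + l' ≤ l) :
    segment (segment x a l h) b l' h' = segment x (a + b) l' (by omega) := by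
  simp only [segment]
  rw [← ConcreteCategory.comp_apply, ← X.map_comp, ← op_comp]
  congr 3
  apply Quiver.Hom.unop_inj
  ext v
  simp [subinterval_apply]
  omega

theorem segment_self {n : ℕ} (x : X _⦋n⦌) : segment x 0 n (by omega) = x := by
  have : SimplexCategory.subinterval 0 n (show 0 + n ≤ n by omega) = 𝟙 _ := by
    ext v
    simp [subinterval_apply]
  rw [segment, this, op_id, X.map_id]
  rfl

theorem cup_assoc {p q r a b n : ℕ} (h1 : p + q = a) (h2 : a + r = n) (h3 : q + r = b)
    (h4 : p + b = n) (α : X _⦋p⦌ → k) (β : X _⦋q⦌ → k) (γ : X _⦋r⦌ → k) :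
    cup h2 (cup h1 α β) γ = cup h4 α (cup h3 β γ) := by
  subst h1 h3
  ext x
  simp only [cup, segment_segment, Nat.zero_add, Nat.add_zero, mul_assoc]

theorem one_cup {n : ℕ} (h : 0 + n = n) (α : X _⦋n⦌ → k) : cup h 1 α = α := by
  ext x
  simp [cup, segment_self]

theorem cup_one {n : ℕ} (h : n + 0 = n) (α : X _⦋n⦌ → k) : cup h α 1 = α := by
  ext x
  simp [cup, segment_self]

/-- If `α` is the coboundary of `γ` and `β` is a cocycle, then the cup product is the coboundary of
`γ ∪ β`. In degree zero `α` itself vanishes. -/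
theorem evalCycle_cup_of_left {p q n : ℕ} (h : p + q = n) {α : X _⦋p⦌ → k} {β : X _⦋q⦌ → k}
    (hα : ∀ z, evalCycle α z = 0) (hβ : coboundary β = 0) (z : (chains k X).cycles n) :
    evalCycle (cup h α β) z = 0 := by
  obtain _ | p := p
  · rw [eq_zero_of_evalCycle hα]
    have : cup h (0 : X _⦋0⦌ → k) β = 0 := funext fun x ↦ zero_mul _
    rw [this, evalCycle, evalChain_zero, LinearMap.zero_apply]
  · obtain ⟨γ, rfl⟩ := exists_coboundary_of_evalCycle hα
    obtain ⟨n, rfl⟩ : ∃ l, n = l + 1 := ⟨p + q, by omega⟩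
    have h0 : cup (show p + (q + 1) = n + 1 by omega) γ (0 : X _⦋q + 1⦌ → k) = 0 :=
      funext fun x ↦ mul_zero _
    have := coboundary_cup (show p + q = n by omega) γ β
    rw [hβ, h0, smul_zero, add_zero] at this
    rw [← this, evalCycle_coboundary]

theorem evalCycle_cup_of_right {p q n : ℕ} (h : p + q = n) {α : X _⦋p⦌ → k} {β : X _⦋q⦌ → k}
    (hα : coboundary α = 0) (hβ : ∀ z, evalCycle β z = 0) (z : (chains k X).cycles n) :
    evalCycle (cup h α β) z = 0 := by
  obtain _ | q := q
  · rw [eq_zero_of_evalCycle hβ]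
    have : cup h α (0 : X _⦋0⦌ → k) = 0 := funext fun x ↦ mul_zero _
    rw [this, evalCycle, evalChain_zero, LinearMap.zero_apply]
  · obtain ⟨γ, rfl⟩ := exists_coboundary_of_evalCycle hβ
    obtain ⟨n, rfl⟩ : ∃ l, n = l + 1 := ⟨p + q, by omega⟩
    have h0 : cup (show p + 1 + q = n + 1 by omega) (0 : X _⦋p + 1⦌ → k) γ = 0 :=
      funext fun x ↦ zero_mul _
    have e := coboundary_cup (show p + q = n by omega) α γ
    rw [hα, h0, zero_add] at e
    have e' : cup h α (coboundary γ) = (-1 : k) ^ p • coboundary (cup (by omega) α γ) := by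
      rw [e, smul_smul, ← pow_add, ← two_mul, pow_mul, neg_one_sq, one_pow, one_smul]
    rw [e', evalCycle, evalChain_smul, LinearMap.smul_apply]
    exact (congrArg _ (evalCycle_coboundary _ z)).trans (smul_zero _)

/-- The value of the cup product of cocycles on a cycle depends on their classes only. -/
theorem evalCycle_cup_congr {p q n : ℕ} (h : p + q = n) {α α' : X _⦋p⦌ → k} {β β' : X _⦋q⦌ → k}
    (hα' : coboundary α' = 0) (hβ : coboundary β = 0)
    (hα : ∀ z, evalCycle α z = evalCycle α' z) (hβ' : ∀ z, evalCycle β z = evalCycle β' z)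
    (z : (chains k X).cycles n) : evalCycle (cup h α β) z = evalCycle (cup h α' β') z := by
  -- The difference of the products is `(α - α') ∪ β + α' ∪ (β - β')`, so only `β` and `α'` have to
  -- be cocycles.
  have h1 := evalCycle_cup_of_left h (α := α - α') (fun z ↦ by
    simpa [evalCycle, evalChain_sub, sub_eq_zero] using hα z) hβ z
  have h2 := evalCycle_cup_of_right h (β := β - β') hα' (fun z ↦ by
    simpa [evalCycle, evalChain_sub, sub_eq_zero] using hβ' z) z
  have e1 : cup h (α - α') β = cup h α β - cup h α' β := funext fun x ↦ sub_mul _ _ _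
  have e2 : cup h α' (β - β') = cup h α' β - cup h α' β' := funext fun x ↦ mul_sub _ _ _
  rw [e1, evalCycle, evalChain_sub, LinearMap.sub_apply, sub_eq_zero] at h1
  rw [e2, evalCycle, evalChain_sub, LinearMap.sub_apply, sub_eq_zero] at h2
  exact h1.trans h2

theorem coboundary_cup_eq_zero {p q n : ℕ} (h : p + q = n) {α : X _⦋p⦌ → k} {β : X _⦋q⦌ → k}
    (hα : coboundary α = 0) (hβ : coboundary β = 0) : coboundary (cup h α β) = 0 := by
  rw [coboundary_cup, hα, hβ]
  ext x
  simp [cup]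

end Cochains

/-! ### Functionals on homology, represented by cocycles. -/

section HomologyDual

variable {k : Type u} [Field k] {X : SSet.{u}}

/-- A cocycle representing a functional on homology. -/
def representative (φ : Module.Dual k (H k X)) (n : ℕ) (x : X _⦋n⦌) : k :=
  φ (lof k ℕ (fun n ↦ Hn k X n) n (chainClass k X n (simplexChain k x)))

theorem evalChain_representative (φ : Module.Dual k (H k X)) (n : ℕ) :
    evalChain (representative φ n) =
      φ ∘ₗ lof k ℕ (fun n ↦ Hn k X n) n ∘ₗ chainClass k X n :=
  chain_hom_ext fun x ↦ evalChain_simplexChain _ x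

/-- `chainClass` vanishes on boundaries. -/
theorem coboundary_representative (φ : Module.Dual k (H k X)) (n : ℕ) :
    coboundary (representative φ n) = 0 := by
  ext x
  rw [← evalChain_simplexChain (coboundary _) x, evalChain_coboundary, evalChain_representative]
  simp only [LinearMap.comp_apply]
  rw [chainClass_d, map_zero, map_zero]
  rfl

/-- The homology class of a cycle. -/
def cycleClass {n : ℕ} (z : (chains k X).cycles n) : H k X :=
  lof k ℕ (fun n ↦ Hn k X n) n (((chains k X).homologyπ n).hom z)

theorem evalCycle_representative (φ : Module.Dual k (H k X)) {n : ℕ}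
    (z : (chains k X).cycles n) : evalCycle (representative φ n) z = φ (cycleClass z) := by
  rw [evalCycle, evalChain_representative]
  simp only [LinearMap.comp_apply]
  rw [chainClass, (exists_chainClass k X n).choose_spec]
  rfl

theorem homologyπ_surjective (n : ℕ) : Function.Surjective ((chains k X).homologyπ n).hom :=
  (ModuleCat.epi_iff_surjective _).1 inferInstance

theorem homology_hom_ext {N : Type*} [AddCommMonoid N] [Module k N] {g h : H k X →ₗ[k] N}
    (H : ∀ (n : ℕ) (z : (chains k X).cycles n), g (cycleClass z) = h (cycleClass z)) : g = h := by
  refine DirectSum.linearMap_ext _ fun n ↦ LinearMap.ext fun y ↦ ?_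
  obtain ⟨z, rfl⟩ := homologyπ_surjective n y
  exact H n z

theorem desc_homologyπ {n : ℕ} {N : ModuleCat.{u} k} (g : (chains k X).X n ⟶ N)
    (hg : (chains k X).d (n + 1) n ≫ g = 0) (z : (chains k X).cycles n) :
    ((chains k X).homologyι n ≫ (chains k X).descOpcycles g (n + 1) (by simp) hg).hom
      (((chains k X).homologyπ n).hom z) = g.hom (((chains k X).iCycles n).hom z) := by
  have : (chains k X).homologyπ n ≫
      ((chains k X).homologyι n ≫ (chains k X).descOpcycles g (n + 1) (by simp) hg) =
      (chains k X).iCycles n ≫ g := by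
    simp
  exact congrArg (fun f ↦ f.hom z) this

theorem comul_cycleClass {n : ℕ} (z : (chains k X).cycles n) :
    comul k X (cycleClass z) = (chainDiag k X n).hom (((chains k X).iCycles n).hom z) := by
  rw [comul, cycleClass, toModule_lof]
  exact desc_homologyπ _ _ z

theorem cycleClass_mem_homogeneous {n : ℕ} (z : (chains k X).cycles n) :
    cycleClass z ∈ homogeneous k (fun n ↦ Hn k X n) id n :=
  lof_mem_homogeneous (V := fun n ↦ Hn k X n) (deg := id) n _

theorem dualHomogeneous_segmentClass {p : ℕ} {φ : Module.Dual k (H k X)}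
    (hφ : φ ∈ dualHomogeneous k (fun n ↦ Hn k X n) id p) {n : ℕ} (x : X _⦋n⦌) (a l : ℕ)
    (h : a + l ≤ n) (hl : l ≠ p) : φ (segmentClass k x a l h) = 0 :=
  mem_dualHomogeneous.1 hφ l hl _

/-- The product of functionals on homology is represented by the cup product. -/
theorem convolution_cycleClass {p q n : ℕ} (h : p + q = n) {φ ψ : Module.Dual k (H k X)}
    (hφ : φ ∈ dualHomogeneous k (fun n ↦ Hn k X n) id p)
    (z : (chains k X).cycles n) :
    convolution (comul k X) φ ψ (cycleClass z) =
      evalCycle (cup h (representative φ p) (representative ψ q)) z := by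
  rw [convolution_apply, comul_cycleClass, evalCycle]
  refine LinearMap.congr_fun (f := TensorProduct.dualDistrib k _ _ (φ ⊗ₜ ψ) ∘ₗ
    (chainDiag k X n).hom) (chain_hom_ext fun x ↦ ?_) _
  -- As `φ` has degree `p`, only the term of the diagonal with a front face of dimension `p`
  -- survives.
  rw [LinearMap.comp_apply, chainDiag_simplexChain, evalChain_simplexChain, simplexDiag, map_sum,
    Finset.sum_eq_single ⟨p, by omega⟩]
  · obtain rfl : q = n - p := by omega
    rfl
  · intro i _ hi
    rw [TensorProduct.dualDistrib_apply, dualHomogeneous_segmentClass hφ, zero_mul]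
    exact fun e ↦ hi (Fin.ext e)
  · exact fun h ↦ absurd (Finset.mem_univ _) h

theorem convolution_mem_dualHomogeneous {p q : ℕ} {φ ψ : Module.Dual k (H k X)}
    (hφ : φ ∈ dualHomogeneous k (fun n ↦ Hn k X n) id p)
    (hψ : ψ ∈ dualHomogeneous k (fun n ↦ Hn k X n) id q) :
    convolution (comul k X) φ ψ ∈ dualHomogeneous k (fun n ↦ Hn k X n) id (p + q) := by
  rw [mem_dualHomogeneous]
  intro n hn y
  obtain ⟨z, rfl⟩ := homologyπ_surjective n y
  change convolution (comul k X) φ ψ (cycleClass z) = 0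
  rw [convolution_apply, comul_cycleClass]
  refine LinearMap.congr_fun (f := TensorProduct.dualDistrib k _ _ (φ ⊗ₜ ψ) ∘ₗ
    (chainDiag k X n).hom) (g := 0) (chain_hom_ext fun x ↦ ?_) _
  rw [LinearMap.comp_apply, chainDiag_simplexChain, simplexDiag, map_sum]
  refine Finset.sum_eq_zero fun i _ ↦ ?_
  rw [TensorProduct.dualDistrib_apply]
  by_cases hi : (i : ℕ) = p
  · rw [dualHomogeneous_segmentClass hψ x i (n - i), mul_zero]
    intro e
    have : n ≠ p + q := hn
    omega
  · rw [dualHomogeneous_segmentClass hφ x 0 i _ hi, zero_mul]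

/-- The two cochains are compared on cycles only, which is what `evalCycle_cup_congr` requires. -/
theorem evalCycle_representative_convolution {p q n : ℕ} (h : p + q = n)
    {φ ψ : Module.Dual k (H k X)} (hφ : φ ∈ dualHomogeneous k (fun n ↦ Hn k X n) id p)
    (z : (chains k X).cycles n) :
    evalCycle (representative (convolution (comul k X) φ ψ) n) z =
      evalCycle (cup h (representative φ p) (representative ψ q)) z := by
  rw [evalCycle_representative, convolution_cycleClass h hφ]

theorem homology_functional_ext {n : ℕ} {φ ψ : Module.Dual k (H k X)}
    (hφ : φ ∈ dualHomogeneous k (fun n ↦ Hn k X n) id n)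
    (hψ : ψ ∈ dualHomogeneous k (fun n ↦ Hn k X n) id n)
    (h : ∀ z : (chains k X).cycles n, φ (cycleClass z) = ψ (cycleClass z)) : φ = ψ := by
  refine homology_hom_ext fun l z ↦ ?_
  by_cases hl : n = l
  · subst hl
    exact h z
  · rw [dualHomogeneous_apply_eq_zero hφ hl (cycleClass_mem_homogeneous z),
      dualHomogeneous_apply_eq_zero hψ hl (cycleClass_mem_homogeneous z)]

/-- Representatives of products are replaced by cup products of representatives without changing
values on cycles; then `cup_assoc` applies. -/
theorem convolution_assoc {p q r : ℕ} {φ ψ χ : Module.Dual k (H k X)}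
    (hφ : φ ∈ dualHomogeneous k (fun n ↦ Hn k X n) id p)
    (hψ : ψ ∈ dualHomogeneous k (fun n ↦ Hn k X n) id q)
    (hχ : χ ∈ dualHomogeneous k (fun n ↦ Hn k X n) id r) :
    convolution (comul k X) (convolution (comul k X) φ ψ) χ =
      convolution (comul k X) φ (convolution (comul k X) ψ χ) := by
  refine homology_functional_ext (n := p + q + r)
    (convolution_mem_dualHomogeneous (convolution_mem_dualHomogeneous hφ hψ) hχ)
    (add_assoc p q r ▸ convolution_mem_dualHomogeneous hφ (convolution_mem_dualHomogeneous hψ hχ))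
    fun z ↦ ?_
  rw [convolution_cycleClass rfl (convolution_mem_dualHomogeneous hφ hψ),
    convolution_cycleClass (add_assoc p q r).symm hφ,
    evalCycle_cup_congr rfl
      (coboundary_cup_eq_zero rfl (coboundary_representative φ p) (coboundary_representative ψ q))
      (coboundary_representative χ r) (evalCycle_representative_convolution rfl hφ)
      (fun _ ↦ rfl), cup_assoc rfl rfl rfl (add_assoc p q r).symm]
  exact (evalCycle_cup_congr _ (coboundary_representative φ p) (coboundary_representative _ _)
    (fun _ ↦ rfl) (evalCycle_representative_convolution rfl hψ) z).symm

theorem coboundary_one : coboundary (1 : X _⦋0⦌ → k) = 0 := by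
  ext x
  simp [coboundary]

variable (k X) in
theorem d_comp_evalChain_one :
    (chains k X).d 1 0 ≫ (ModuleCat.ofHom (evalChain (1 : X _⦋0⦌ → k)) :
      (chains k X).X 0 ⟶ ModuleCat.of k k) = 0 := by
  ext1
  refine (evalChain_coboundary (1 : X _⦋0⦌ → k)).symm.trans ?_
  rw [coboundary_one]
  exact evalChain_zero

variable (k X) in
/-- The augmentation of homology in degree `n`. -/
def augmentationN (n : ℕ) : Hn k X n →ₗ[k] k :=
  Nat.casesOn (motive := fun n ↦ Hn k X n →ₗ[k] k) n
    ((chains k X).homologyι 0 ≫ (chains k X).descOpcycles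
      (ModuleCat.ofHom (evalChain (1 : X _⦋0⦌ → k))) 1 (by simp) (d_comp_evalChain_one k X)).hom
    fun _ ↦ 0

variable (k X) in
/-- The augmentation of homology, which is the counit of the homology coalgebra. -/
def augmentation : Module.Dual k (H k X) := toModule k ℕ _ (augmentationN k X)

theorem augmentation_mem : augmentation k X ∈ dualHomogeneous k (fun n ↦ Hn k X n) id 0 := by
  rw [mem_dualHomogeneous]
  rintro (_ | n) hn y
  · exact absurd rfl hn
  · rw [augmentation, toModule_lof]
    rfl

theorem augmentation_cycleClass (z : (chains k X).cycles 0) :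
    augmentation k X (cycleClass z) = evalCycle 1 z := by
  rw [augmentation, cycleClass, toModule_lof]
  exact desc_homologyπ _ _ z

/-- This is an equality of cochains, because a `0`-cochain is determined by its values on cycles;
the unit laws then reduce to `one_cup` and `cup_one`. -/
theorem representative_augmentation : representative (augmentation k X) 0 = 1 := by
  refine sub_eq_zero.1 (eq_zero_of_evalCycle fun z ↦ ?_)
  rw [evalCycle, evalChain_sub, LinearMap.sub_apply, sub_eq_zero]
  exact (evalCycle_representative _ z).trans (augmentation_cycleClass z)

theorem augmentation_convolution {p : ℕ} {φ : Module.Dual k (H k X)}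
    (hφ : φ ∈ dualHomogeneous k (fun n ↦ Hn k X n) id p) :
    convolution (comul k X) (augmentation k X) φ = φ := by
  refine homology_functional_ext
    (zero_add p ▸ convolution_mem_dualHomogeneous augmentation_mem hφ) hφ fun z ↦ ?_
  rw [convolution_cycleClass (zero_add p) augmentation_mem, representative_augmentation, one_cup,
    evalCycle_representative]

theorem convolution_augmentation {p : ℕ} {φ : Module.Dual k (H k X)}
    (hφ : φ ∈ dualHomogeneous k (fun n ↦ Hn k X n) id p) :
    convolution (comul k X) φ (augmentation k X) = φ := by
  refine homology_functional_ext
    (convolution_mem_dualHomogeneous (q := 0) hφ augmentation_mem) hφ fun z ↦ ?_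
  rw [convolution_cycleClass (add_zero p) hφ, representative_augmentation, cup_one,
    evalCycle_representative]

/-- A simplicial map sends simplices to simplices, so it pulls the constant cochain `1` back to
itself; in positive degrees both augmentations vanish. -/
theorem augmentation_comp_lmap {Y : SSet.{u}} (g : X ⟶ Y) :
    augmentation k Y ∘ₗ DirectSum.lmap (fun n ↦ Hmap k g n) = augmentation k X := by
  refine homology_hom_ext fun n z ↦ ?_
  have e : DirectSum.lmap (fun n ↦ Hmap k g n) (cycleClass z) =
      cycleClass ((HomologicalComplex.cyclesMap (SSet.chainComplexMap g (ModuleCat.of k k)) n).hom z)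
      := by
    refine (DirectSum.lmap_lof _ n _).trans (congrArg (lof k ℕ (fun n ↦ Hn k Y n) n) ?_)
    exact congrArg (fun f ↦ f.hom z) (HomologicalComplex.homologyπ_naturality
      (SSet.chainComplexMap g (ModuleCat.of k k)) n)
  rw [LinearMap.comp_apply, e]
  obtain _ | n := n
  · rw [augmentation_cycleClass, augmentation_cycleClass, evalCycle, evalCycle]
    have e' := congrArg (fun f ↦ f.hom z) (HomologicalComplex.cyclesMap_i
      (SSet.chainComplexMap g (ModuleCat.of k k)) 0)
    refine (congrArg (evalChain 1) e').trans ?_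
    refine LinearMap.congr_fun (f := evalChain 1 ∘ₗ
      ((SSet.chainComplexMap g (ModuleCat.of k k)).f 0).hom) (chain_hom_ext fun x ↦ ?_) _
    rw [LinearMap.comp_apply, evalChain_simplexChain]
    have e2 := congrArg (fun f ↦ f.hom (1 : k))
      (SSet.ι_chainComplexMap_f X Y g (ModuleCat.of k k) x)
    exact (congrArg (evalChain 1) e2).trans (evalChain_simplexChain _ _)
  · rw [dualHomogeneous_apply_eq_zero augmentation_mem (by simp) (cycleClass_mem_homogeneous _),
      dualHomogeneous_apply_eq_zero augmentation_mem (by simp) (cycleClass_mem_homogeneous _)]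

end HomologyDual

/-! ### Signed reversal of words of vertices and its homotopy to the identity. -/

section Words

variable {k : Type*} [Field k] {A B : Type*}

/-- The sign of the reversal of `n` letters. -/
def revSign (k : Type*) [Field k] (n : ℕ) : k := n.rec 1 fun n e ↦ (-1) ^ n * e

theorem revSign_zero : revSign k 0 = 1 := rfl

theorem revSign_succ (n : ℕ) : revSign k (n + 1) = (-1) ^ n * revSign k n := rfl

theorem revSign_add (a b : ℕ) : revSign k (a + b) = (-1) ^ (a * b) * revSign k a * revSign k b := by
  induction b with
  | zero => simp [revSign_zero]
  | succ b ih =>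
    rw [← add_assoc, revSign_succ, ih, revSign_succ]
    ring

/-- The front `a`-face and the back `b`-face have `a + 1` and `b + 1` vertices but share one, which
is why `a + b + 1` letters are reversed. The factor `(-1) ^ (a * b)` is the sign of graded
commutativity. -/
theorem revSign_add_succ (a b : ℕ) :
    revSign k (a + b + 1) = (-1) ^ (a * b) * (revSign k (a + 1) * revSign k (b + 1)) := by
  rw [revSign_succ, revSign_succ, revSign_succ, revSign_add]
  ring

/-- The map of free modules on words which puts a letter in front of a word. -/
def wordCons (a : A) : (List A →₀ k) →ₗ[k] (List A →₀ k) := Finsupp.lmapDomain k k (List.cons a)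

/-- The map of free modules on words which puts a letter behind a word. -/
def wordSnoc (a : A) : (List A →₀ k) →ₗ[k] (List A →₀ k) :=
  Finsupp.lmapDomain k k fun l ↦ l ++ [a]

/-- The map of free modules on words given by a map of letters. -/
def wordMap (f : A → B) : (List A →₀ k) →ₗ[k] (List B →₀ k) := Finsupp.lmapDomain k k (List.map f)

/-- The word `l` as an element of the free module. -/
def word (k : Type*) [Field k] (l : List A) : List A →₀ k := Finsupp.single l 1

@[simp] theorem wordCons_word (a : A) (l : List A) : wordCons a (word k l) = word k (a :: l) := by
  simp [wordCons, word]

@[simp] theorem wordSnoc_word (a : A) (l : List A) : wordSnoc a (word k l) = word k (l ++ [a]) := by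
  simp [wordSnoc, word]

@[simp] theorem wordMap_word (f : A → B) (l : List A) :
    wordMap f (word k l) = word k (l.map f) := by
  simp [wordMap, word]

theorem word_hom_ext {N : Type*} [AddCommMonoid N] [Module k N] {g h : (List A →₀ k) →ₗ[k] N}
    (H : ∀ l, g (word k l) = h (word k l)) : g = h :=
  Finsupp.lhom_ext' fun l ↦ LinearMap.ext_ring (H l)

/-- The linear extension of a function on words. -/
def wordLift {N : Type*} [AddCommMonoid N] [Module k N] (g : List A → N) : (List A →₀ k) →ₗ[k] N :=
  Finsupp.linearCombination k g

@[simp] theorem wordLift_word {N : Type*} [AddCommMonoid N] [Module k N] (g : List A → N)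
    (l : List A) : wordLift (k := k) g (word k l) = g l := by
  simp [wordLift, word]

/-- The sign `(-1) ^ n` on words of length `n`. -/
def wordSign : (List A →₀ k) →ₗ[k] (List A →₀ k) := wordLift fun l ↦ (-1 : k) ^ l.length • word k l

@[simp] theorem wordSign_word (l : List A) :
    wordSign (word k l) = (-1 : k) ^ l.length • word k l := by
  rw [wordSign, wordLift_word]

variable (k) in
/-- The boundary of a word in the augmented complex. -/
def bdryAux (l : List A) : List A →₀ k :=
  List.rec 0 (fun a l c ↦ word k l - wordCons a c) l

/-- The boundary of the augmented complex of words. -/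
def bdry : (List A →₀ k) →ₗ[k] (List A →₀ k) := wordLift (bdryAux k)

@[simp] theorem bdry_nil : bdry (word k ([] : List A)) = 0 := by
  rw [bdry, wordLift_word]
  rfl

/-- Putting `a` in front contracts the augmented complex; the inductions on words rest on this cone
formula. -/
theorem bdry_wordCons (a : A) (c : List A →₀ k) : bdry (wordCons a c) = c - wordCons a (bdry c) := by
  suffices bdry ∘ₗ wordCons a = LinearMap.id - wordCons a ∘ₗ (bdry : _ →ₗ[k] _) from
    LinearMap.congr_fun this c
  refine word_hom_ext fun l ↦ ?_
  simp only [LinearMap.comp_apply, wordCons_word, LinearMap.sub_apply, LinearMap.id_apply, bdry,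
    wordLift_word]
  rfl

/-- The signed reversal of words. -/
def wordRev : (List A →₀ k) →ₗ[k] (List A →₀ k) :=
  wordLift fun l ↦ revSign k l.length • word k l.reverse

@[simp] theorem wordRev_word (l : List A) :
    wordRev (word k l) = revSign k l.length • word k l.reverse := by
  rw [wordRev, wordLift_word]

theorem wordSign_wordCons (a : A) (c : List A →₀ k) :
    wordSign (wordCons a c) = -wordCons a (wordSign c) := by
  suffices wordSign ∘ₗ wordCons a = -(wordCons a ∘ₗ (wordSign : _ →ₗ[k] _)) from
    LinearMap.congr_fun this c
  refine word_hom_ext fun l ↦ ?_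
  simp [pow_succ]

theorem wordSign_bdry (c : List A →₀ k) : wordSign (bdry c) = -bdry (wordSign c) := by
  suffices wordSign ∘ₗ bdry = -((bdry : (List A →₀ k) →ₗ[k] _) ∘ₗ wordSign) from
    LinearMap.congr_fun this c
  refine word_hom_ext fun l ↦ ?_
  simp only [LinearMap.comp_apply, LinearMap.neg_apply]
  induction l with
  | nil => simp
  | cons a l ih =>
    rw [← wordCons_word, bdry_wordCons, wordSign_wordCons, map_sub, wordSign_wordCons, ih, map_neg,
      map_neg, bdry_wordCons]
    abel

/-- Removing the appended letter is the last face, whose sign is given by the length of the word. -/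
theorem bdry_wordSnoc (a : A) (c : List A →₀ k) :
    bdry (wordSnoc a c) = wordSnoc a (bdry c) + wordSign c := by
  suffices bdry ∘ₗ wordSnoc a = wordSnoc a ∘ₗ bdry + (wordSign : (List A →₀ k) →ₗ[k] _) from
    LinearMap.congr_fun this c
  refine word_hom_ext fun l ↦ ?_
  simp only [LinearMap.comp_apply, LinearMap.add_apply]
  have comm : ∀ (b : A) (c : List A →₀ k), wordSnoc a (wordCons b c) = wordCons b (wordSnoc a c) := by
    intro b c
    refine LinearMap.congr_fun (f := wordSnoc a ∘ₗ wordCons b) (g := wordCons b ∘ₗ wordSnoc a)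
      (word_hom_ext fun l ↦ ?_) c
    simp
  induction l with
  | nil =>
    rw [wordSnoc_word, List.nil_append, ← wordCons_word, bdry_wordCons]
    simp
  | cons b l ih =>
    rw [← wordCons_word, comm, bdry_wordCons, bdry_wordCons, ih, wordSign_wordCons, map_sub, comm,
      map_add]
    abel

theorem wordRev_wordCons (a : A) (c : List A →₀ k) :
    wordRev (wordCons a c) = wordSnoc a (wordRev (wordSign c)) := by
  suffices wordRev ∘ₗ wordCons a = wordSnoc a ∘ₗ wordRev ∘ₗ (wordSign : (List A →₀ k) →ₗ[k] _) from
    LinearMap.congr_fun this c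
  refine word_hom_ext fun l ↦ ?_
  simp [revSign_succ, smul_smul]

theorem wordSign_wordRev_wordSign (c : List A →₀ k) :
    wordSign (wordRev (wordSign c)) = wordRev c := by
  suffices wordSign ∘ₗ wordRev ∘ₗ wordSign = (wordRev : (List A →₀ k) →ₗ[k] _) from
    LinearMap.congr_fun this c
  refine word_hom_ext fun l ↦ ?_
  have : ((-1 : k) ^ l.length) * (-1) ^ l.length = 1 := by
    rw [← mul_pow]
    simp
  simp only [LinearMap.comp_apply, wordSign_word, wordRev_word, map_smul, smul_smul,
    List.length_reverse]
  rw [mul_right_comm, this, one_mul]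

theorem bdry_wordRev (c : List A →₀ k) : bdry (wordRev c) = wordRev (bdry c) := by
  suffices bdry ∘ₗ wordRev = wordRev ∘ₗ (bdry : (List A →₀ k) →ₗ[k] _) from
    LinearMap.congr_fun this c
  refine word_hom_ext fun l ↦ ?_
  simp only [LinearMap.comp_apply]
  induction l with
  | nil => simp
  | cons a l ih =>
    -- On a single word `wordSign` is a scalar, so the induction hypothesis applies to the signed
    -- word too.
    have ih' : bdry (wordRev (wordSign (word k l))) = wordRev (bdry (wordSign (word k l))) := by
      simp only [wordSign_word, map_smul, ih]
    rw [← wordCons_word, wordRev_wordCons, bdry_wordSnoc, ih', bdry_wordCons, map_sub,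
      wordRev_wordCons, wordSign_bdry, map_neg, map_neg, wordSign_wordRev_wordSign]
    abel

variable (k) in
/-- The homotopy from the identity to the signed reversal, on a word. -/
def revHomotopyAux (l : List A) : List A →₀ k :=
  List.rec 0 (fun a l c ↦ wordCons a (wordRev (word k (a :: l))) - wordCons a c) l

/-- The homotopy from the identity to the signed reversal. -/
def revHomotopy : (List A →₀ k) →ₗ[k] (List A →₀ k) := wordLift (revHomotopyAux k)

@[simp] theorem revHomotopy_nil : revHomotopy (word k ([] : List A)) = 0 := by
  rw [revHomotopy, wordLift_word]
  rfl

theorem revHomotopy_wordCons (a : A) (c : List A →₀ k) :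
    revHomotopy (wordCons a c) = wordCons a (wordRev (wordCons a c)) - wordCons a (revHomotopy c) := by
  suffices revHomotopy ∘ₗ wordCons a =
      wordCons a ∘ₗ wordRev ∘ₗ wordCons a - wordCons a ∘ₗ (revHomotopy : _ →ₗ[k] _) from
    LinearMap.congr_fun this c
  refine word_hom_ext fun l ↦ ?_
  simp only [LinearMap.comp_apply, LinearMap.sub_apply, wordCons_word, revHomotopy, wordLift_word]
  rfl

/-- The homotopy cones off the reversed word from the first letter `a`. By `bdry_wordCons` the
boundary of that cone is the reversal minus the cone on its boundary, and the surplus terms reduce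
to the cone on the identity for the shorter word. -/
theorem bdry_revHomotopy (l : List A) :
    bdry (revHomotopy (word k l)) + revHomotopy (bdry (word k l)) =
      wordRev (word k l) - word k l := by
  induction l with
  | nil => simp [revSign_zero]
  | cons a l ih =>
    rw [← wordCons_word, revHomotopy_wordCons, bdry_wordCons, map_sub, bdry_wordCons, bdry_wordCons,
      map_sub, revHomotopy_wordCons, bdry_wordRev, bdry_wordCons, map_sub, map_sub]
    rw [← eq_sub_iff_add_eq] at ih
    rw [ih]
    simp only [map_sub]
    abel

theorem wordMap_wordCons (f : A → B) (a : A) (c : List A →₀ k) :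
    wordMap f (wordCons a c) = wordCons (f a) (wordMap f c) := by
  refine LinearMap.congr_fun (f := wordMap f ∘ₗ wordCons a) (g := wordCons (f a) ∘ₗ wordMap f)
    (word_hom_ext fun l ↦ ?_) c
  simp

theorem wordMap_wordRev (f : A → B) (c : List A →₀ k) :
    wordMap f (wordRev c) = wordRev (wordMap f c) := by
  refine LinearMap.congr_fun (f := wordMap f ∘ₗ wordRev) (g := wordRev ∘ₗ wordMap f)
    (word_hom_ext fun l ↦ ?_) c
  simp

/-- Naturality in the letters allows the homotopy on the faces of a simplex to be computed by one
cochain `revCochain`. -/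
theorem wordMap_revHomotopy (f : A → B) (l : List A) :
    wordMap f (revHomotopy (word k l)) = revHomotopy (word k (l.map f)) := by
  induction l with
  | nil => simp
  | cons a l ih =>
    rw [List.map_cons, ← wordCons_word, ← wordCons_word, revHomotopy_wordCons, revHomotopy_wordCons,
      map_sub, wordMap_wordCons, wordMap_wordCons, wordMap_wordRev, wordMap_wordCons, ih,
      wordMap_word]

theorem bdry_word (l : List A) :
    bdry (word k l) = ∑ j : Fin l.length, (-1 : k) ^ (j : ℕ) • word k (l.eraseIdx j) := by
  induction l with
  | nil => simp
  | cons a l ih =>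
    rw [← wordCons_word, bdry_wordCons, ih]
    simp only [List.length_cons]
    rw [Fin.sum_univ_succ]
    simp [map_sum, pow_succ, sub_eq_add_neg]

end Words

/-! ### Graded commutativity of the homology coalgebra of a space. -/

section Reversal

variable {k : Type u} [Field k] {Y : TopCat.{u}}

/-- The singular simplex obtained from `x` by an arbitrary map of vertices. -/
def vertexMap {m n : ℕ} (w : Fin (m + 1) → Fin (n + 1)) (x : (TopCat.toSSet.obj Y) _⦋n⦌) :
    (TopCat.toSSet.obj Y) _⦋m⦌ :=
  (TopCat.toSSetObjEquiv Y (Opposite.op ⦋m⦌)).symm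
    ((TopCat.toSSetObjEquiv Y (Opposite.op ⦋n⦌) x).comp
      ⟨stdSimplex.map (S := ℝ) w, stdSimplex.continuous_map w⟩)

theorem vertexMap_vertexMap {l m n : ℕ} (v : Fin (l + 1) → Fin (m + 1))
    (w : Fin (m + 1) → Fin (n + 1)) (x : (TopCat.toSSet.obj Y) _⦋n⦌) :
    vertexMap v (vertexMap w x) = vertexMap (w ∘ v) x := by
  rw [vertexMap, vertexMap, vertexMap, Equiv.apply_symm_apply]
  congr 1
  ext s
  exact congrArg (TopCat.toSSetObjEquiv Y (Opposite.op ⦋n⦌) x) (stdSimplex.map_comp_apply v w s)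

theorem map_eq_vertexMap {m n : ℕ} (θ : (⦋m⦌ : SimplexCategory) ⟶ ⦋n⦌)
    (x : (TopCat.toSSet.obj Y) _⦋n⦌) :
    (TopCat.toSSet.obj Y).map θ.op x = vertexMap (fun i ↦ θ.toOrderHom i) x := by
  rfl

theorem vertexMap_id {n : ℕ} (x : (TopCat.toSSet.obj Y) _⦋n⦌) : vertexMap id x = x := by
  have := map_eq_vertexMap (𝟙 _) x
  rw [op_id, (TopCat.toSSet.obj Y).map_id] at this
  exact this.symm

theorem δ_eq_vertexMap {n : ℕ} (j : Fin (n + 2)) (x : (TopCat.toSSet.obj Y) _⦋n + 1⦌) :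
    (TopCat.toSSet.obj Y).δ j x = vertexMap j.succAbove x :=
  map_eq_vertexMap (SimplexCategory.δ j) x

theorem segment_eq_vertexMap {n : ℕ} (x : (TopCat.toSSet.obj Y) _⦋n⦌) (a l : ℕ) (h : a + l ≤ n) :
    segment x a l h = vertexMap (fun v ↦ ⟨v + a, by omega⟩) x :=
  map_eq_vertexMap (SimplexCategory.subinterval a l h) x

/-- The value of a cochain at the face of `x` spanned by a word of vertices. -/
def evalWord {m n : ℕ} (α : (TopCat.toSSet.obj Y) _⦋m⦌ → k) (x : (TopCat.toSSet.obj Y) _⦋n⦌) :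
    (List (Fin (n + 1)) →₀ k) →ₗ[k] k :=
  wordLift fun l ↦
    if h : l.length = m + 1 then α (vertexMap (fun i ↦ l.get (i.cast h.symm)) x) else 0

theorem evalWord_word {m n : ℕ} (α : (TopCat.toSSet.obj Y) _⦋m⦌ → k)
    (x : (TopCat.toSSet.obj Y) _⦋n⦌) (l : List (Fin (n + 1))) (h : l.length = m + 1) :
    evalWord α x (word k l) = α (vertexMap (fun i ↦ l.get (i.cast h.symm)) x) := by
  rw [evalWord, wordLift_word, dif_pos h]

theorem evalWord_word_of_ne {m n : ℕ} (α : (TopCat.toSSet.obj Y) _⦋m⦌ → k)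
    (x : (TopCat.toSSet.obj Y) _⦋n⦌) (l : List (Fin (n + 1))) (h : l.length ≠ m + 1) :
    evalWord α x (word k l) = 0 := by
  rw [evalWord, wordLift_word, dif_neg h]

/-- Words of length `m + 1` index `m`-dimensional faces, possibly degenerate or out of order, and
deleting a letter is taking a face. -/
theorem evalWord_bdry {m n : ℕ} (α : (TopCat.toSSet.obj Y) _⦋m⦌ → k)
    (x : (TopCat.toSSet.obj Y) _⦋n⦌) (c : List (Fin (n + 1)) →₀ k) :
    evalWord α x (bdry c) = evalWord (coboundary α) x c := by
  refine LinearMap.congr_fun (f := evalWord α x ∘ₗ bdry) (word_hom_ext fun l ↦ ?_) c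
  rw [LinearMap.comp_apply, bdry_word, map_sum]
  by_cases h : l.length = m + 2
  · rw [evalWord_word _ _ _ h, coboundary, ← (finCongr h.symm).sum_comp]
    refine Finset.sum_congr rfl fun j _ ↦ ?_
    have hl : (l.eraseIdx j).length = m + 1 := by
      rw [List.length_eraseIdx_of_lt (by omega), h]
      rfl
    simp only [finCongr_apply, Fin.val_cast, map_smul, smul_eq_mul]
    rw [evalWord_word _ _ _ hl, δ_eq_vertexMap, vertexMap_vertexMap]
    congr 3
    funext i
    simp only [List.get_eq_getElem, Function.comp_apply, Fin.val_cast, List.getElem_eraseIdx,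
      Fin.succAbove, Fin.lt_def, Fin.val_castSucc]
    split_ifs <;> rfl
  · rw [evalWord_word_of_ne _ _ _ h]
    refine Finset.sum_eq_zero fun j _ ↦ ?_
    rw [map_smul, evalWord_word_of_ne, smul_zero]
    rw [List.length_eraseIdx_of_lt j.2]
    have := j.2
    omega

theorem evalWord_vertexMap {l m n : ℕ} (α : (TopCat.toSSet.obj Y) _⦋l⦌ → k)
    (x : (TopCat.toSSet.obj Y) _⦋n⦌) (f : Fin (m + 1) → Fin (n + 1))
    (c : List (Fin (m + 1)) →₀ k) :
    evalWord α (vertexMap f x) c = evalWord α x (wordMap f c) := by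
  refine LinearMap.congr_fun (g := evalWord α x ∘ₗ wordMap f) (word_hom_ext fun w ↦ ?_) c
  rw [LinearMap.comp_apply, wordMap_word]
  by_cases h : w.length = l + 1
  · rw [evalWord_word _ _ _ h, evalWord_word _ _ _ (by simpa using h), vertexMap_vertexMap]
    congr 2
    funext i
    simp
  · rw [evalWord_word_of_ne _ _ _ h, evalWord_word_of_ne _ _ _ (by simpa using h)]

/-- The cochain homotopy dual to `revHomotopy`. -/
def revCochain {n : ℕ} (α : (TopCat.toSSet.obj Y) _⦋n + 1⦌ → k) (y : (TopCat.toSSet.obj Y) _⦋n⦌) : k :=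
  evalWord α y (revHomotopy (word k (List.finRange (n + 1))))

/-- The signed reversal of cochains. -/
def reverseCochain {n : ℕ} (α : (TopCat.toSSet.obj Y) _⦋n⦌ → k) (x : (TopCat.toSSet.obj Y) _⦋n⦌) : k :=
  revSign k (n + 1) * α (vertexMap Fin.rev x)

theorem eraseIdx_finRange {n : ℕ} (j : Fin (n + 2)) :
    (List.finRange (n + 2)).eraseIdx j = (List.finRange (n + 1)).map j.succAbove := by
  refine List.ext_getElem ?_ fun i h1 h2 ↦ ?_
  · rw [List.length_eraseIdx_of_lt (by simp)]
    simp
  · rw [List.getElem_eraseIdx]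
    simp only [List.getElem_finRange, List.getElem_map, Fin.succAbove, Fin.lt_def]
    split_ifs <;> simp_all

theorem evalWord_finRange {n : ℕ} (α : (TopCat.toSSet.obj Y) _⦋n⦌ → k)
    (x : (TopCat.toSSet.obj Y) _⦋n⦌) : evalWord α x (word k (List.finRange (n + 1))) = α x := by
  rw [evalWord_word _ _ _ (by simp)]
  conv_rhs => rw [← vertexMap_id x]
  congr 2
  funext i
  ext
  simp

theorem evalWord_wordRev_finRange {n : ℕ} (α : (TopCat.toSSet.obj Y) _⦋n⦌ → k)
    (x : (TopCat.toSSet.obj Y) _⦋n⦌) :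
    evalWord α x (wordRev (word k (List.finRange (n + 1)))) = reverseCochain α x := by
  rw [wordRev_word, map_smul, evalWord_word _ _ _ (by simp), reverseCochain, smul_eq_mul]
  simp only [List.length_finRange]
  congr 3
  funext i
  ext
  simp

theorem reverseCochain_zero (α : (TopCat.toSSet.obj Y) _⦋0⦌ → k) : reverseCochain α = α := by
  ext x
  have : (Fin.rev : Fin (0 + 1) → Fin (0 + 1)) = id := by
    funext i
    fin_cases i
    rfl
  rw [reverseCochain, this, vertexMap_id]
  simp [revSign_succ, revSign_zero]

/-- Evaluate the homotopy formula on the word of all vertices: one term contains the coboundary of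
`α` and vanishes, the other is by naturality the coboundary of `revCochain α`. -/
theorem reverseCochain_succ {n : ℕ} {α : (TopCat.toSSet.obj Y) _⦋n + 1⦌ → k}
    (hα : coboundary α = 0) : reverseCochain α = α + coboundary (revCochain α) := by
  ext x
  have h := congrArg (evalWord α x) (bdry_revHomotopy (k := k) (List.finRange (n + 2)))
  rw [map_add, map_sub, evalWord_wordRev_finRange, evalWord_finRange, evalWord_bdry, hα, bdry_word,
    map_sum, map_sum] at h
  have h0 : evalWord (0 : (TopCat.toSSet.obj Y) _⦋n + 1 + 1⦌ → k) x = 0 :=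
    word_hom_ext fun l ↦ by
      rw [evalWord, wordLift_word]
      simp
  rw [h0, LinearMap.zero_apply, zero_add, eq_sub_iff_add_eq'] at h
  rw [← h, Pi.add_apply, coboundary, ← (finCongr (List.length_finRange (n := n + 2)).symm).sum_comp]
  congr 1
  refine Finset.sum_congr rfl fun j _ ↦ ?_
  simp only [finCongr_apply, Fin.val_cast, map_smul, smul_eq_mul]
  rw [eraseIdx_finRange, ← wordMap_revHomotopy, ← evalWord_vertexMap, revCochain, δ_eq_vertexMap]

theorem coboundary_coboundary {X : SSet.{u}} {n : ℕ} (α : X _⦋n⦌ → k) :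
    coboundary (coboundary α) = 0 := by
  ext x
  rw [← evalChain_simplexChain (coboundary (coboundary α)) x, evalChain_coboundary,
    evalChain_coboundary, LinearMap.comp_assoc, ← ModuleCat.hom_comp, (chains k X).d_comp_d]
  simp

theorem coboundary_add {X : SSet.{u}} {n : ℕ} (α β : X _⦋n⦌ → k) :
    coboundary (α + β) = coboundary α + coboundary β := by
  ext x
  simp [coboundary, mul_add, Finset.sum_add_distrib]

theorem evalChain_add {X : SSet.{u}} {n : ℕ} (α β : X _⦋n⦌ → k) :
    evalChain (α + β) = evalChain α + evalChain β :=
  chain_hom_ext fun x ↦ by simp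

theorem coboundary_reverseCochain {n : ℕ} {α : (TopCat.toSSet.obj Y) _⦋n⦌ → k}
    (hα : coboundary α = 0) : coboundary (reverseCochain α) = 0 := by
  obtain _ | n := n
  · rw [reverseCochain_zero, hα]
  · rw [reverseCochain_succ hα, coboundary_add, hα, coboundary_coboundary, add_zero]

/-- Reversal acts trivially on cohomology. -/
theorem evalCycle_reverseCochain {n : ℕ} {α : (TopCat.toSSet.obj Y) _⦋n⦌ → k}
    (hα : coboundary α = 0) (z : (chains k (TopCat.toSSet.obj Y)).cycles n) :
    evalCycle (reverseCochain α) z = evalCycle α z := by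
  obtain _ | n := n
  · rw [reverseCochain_zero]
  · rw [reverseCochain_succ hα, evalCycle, evalChain_add, LinearMap.add_apply]
    exact (congrArg _ (evalCycle_coboundary _ z)).trans (add_zero _)

/-- Reversing the vertices turns the front `p`-face into the reversed back `p`-face and conversely;
the sign comes from `revSign_add_succ`. -/
theorem reverseCochain_cup {p q n : ℕ} (h : p + q = n) (h' : q + p = n)
    (α : (TopCat.toSSet.obj Y) _⦋p⦌ → k) (β : (TopCat.toSSet.obj Y) _⦋q⦌ → k) :
    reverseCochain (cup h α β) =
      (-1 : k) ^ (p * q) • cup h' (reverseCochain β) (reverseCochain α) := by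
  subst h
  ext x
  simp only [reverseCochain, cup, Pi.smul_apply, smul_eq_mul, segment_eq_vertexMap,
    vertexMap_vertexMap, revSign_add_succ p q]
  have e1 : (Fin.rev ∘ fun v : Fin (p + 1) ↦ (⟨v + 0, by omega⟩ : Fin (p + q + 1))) =
      (fun v : Fin (p + 1) ↦ (⟨v + q, by omega⟩ : Fin (p + q + 1))) ∘ Fin.rev := by
    funext i
    ext
    simp
    omega
  have e2 : (Fin.rev ∘ fun v : Fin (q + 1) ↦ (⟨v + p, by omega⟩ : Fin (p + q + 1))) =
      (fun v : Fin (q + 1) ↦ (⟨v + 0, by omega⟩ : Fin (p + q + 1))) ∘ Fin.rev := by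
    funext i
    ext
    simp
    omega
  rw [e1, e2]
  ring

/-- On cycles a cocycle and its reversal agree, so `α ∪ β` may be reversed, which swaps the factors
with the sign, and then each reversed factor may be replaced by the original one. -/
theorem convolution_comm {p q : ℕ} {φ ψ : Module.Dual k (H k (TopCat.toSSet.obj Y))}
    (hφ : φ ∈ dualHomogeneous k (fun n ↦ Hn k (TopCat.toSSet.obj Y) n) id p)
    (hψ : ψ ∈ dualHomogeneous k (fun n ↦ Hn k (TopCat.toSSet.obj Y) n) id q) :
    convolution (comul k (TopCat.toSSet.obj Y)) φ ψ =
      (-1 : k) ^ (p * q) • convolution (comul k (TopCat.toSSet.obj Y)) ψ φ := by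
  have hc := coboundary_representative φ p
  have hc' := coboundary_representative ψ q
  refine homology_functional_ext (convolution_mem_dualHomogeneous hφ hψ)
    (Submodule.smul_mem _ _ (add_comm q p ▸ convolution_mem_dualHomogeneous hψ hφ)) fun z ↦ ?_
  rw [LinearMap.smul_apply, convolution_cycleClass rfl hφ, convolution_cycleClass (add_comm q p) hψ,
    ← evalCycle_reverseCochain (coboundary_cup_eq_zero rfl hc hc'),
    reverseCochain_cup rfl (add_comm q p), evalCycle, evalChain_smul, LinearMap.smul_apply]
  congr 1
  exact evalCycle_cup_congr _ hc' (coboundary_reverseCochain hc) (evalCycle_reverseCochain hc')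
    (evalCycle_reverseCochain hc) z

variable (k Y) in
/-- The homology coalgebra of a space, in terms of its dual algebra. -/
theorem isDualAlgebra_homology :
    IsDualAlgebra id (fun n ↦ dualHomogeneous k (fun n ↦ Hn k (TopCat.toSSet.obj Y) n) id n)
      (comul k (TopCat.toSSet.obj Y)) (augmentation k (TopCat.toSSet.obj Y)) where
  degree _ _ h := h
  mul_mem _ _ _ hφ _ hψ := convolution_mem_dualHomogeneous hφ hψ
  assoc _ _ _ _ hφ _ hψ _ hχ := convolution_assoc hφ hψ hχ
  comm _ _ _ hφ _ hψ := convolution_comm hφ hψ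
  unit_mem := augmentation_mem
  one_mul _ _ hφ := augmentation_convolution hφ
  mul_one _ _ hφ := convolution_augmentation hφ

end Reversal

end MomentAngle

end

theorem theorem3p9 {k : Type u} [Field k] {m : ℕ} (K : LowerSet (Finset (Fin m)))
    (X : Fin m → TopCat.{u}) (A : ∀ j, Set (X j))
    (S : ∀ j, MomentAngle.Splitting (MomentAngle.inducedMap k X A j))
    (hS : ∀ j, (S j).IsCoalgebraSplitting
      (MomentAngle.comul k (MomentAngle.sub X A j)) (MomentAngle.comul k (MomentAngle.ambient X j))) :
    TensorProduct.map (MomentAngle.T.incl S K) (MomentAngle.T.incl S K) ∘ₗ MomentAngle.deltaT S K =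
        MomentAngle.totalComul S ∘ₗ MomentAngle.T.incl S K ∧
      MomentAngle.IsGradedCocommutativeCoalgebra MomentAngle.AdmissibleIndex.degree
        (MomentAngle.deltaT S K) ∧
      MomentAngle.IsGradedCommutativeAlgebra MomentAngle.AdmissibleIndex.degree
        (MomentAngle.T.dual S K) (MomentAngle.convolution (MomentAngle.deltaT S K)) ∧
      MomentAngle.IsGradedCommutativeAlgebra MomentAngle.AdmissibleIndex.degree
        ⊤ (MomentAngle.convolution (MomentAngle.deltaT S K)) := by
  exact ⟨MomentAngle.map_incl_comp_comul K hS, MomentAngle.comul_properties K hS fun j ↦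
    (hS j).isDualAlgebra (MomentAngle.isDualAlgebra_homology k (TopCat.of (A j)))
      (MomentAngle.isDualAlgebra_homology k (X j))
      (MomentAngle.augmentation_comp_lmap (MomentAngle.inclusion X A j))⟩
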